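/- All graphs are finite, simple and undirected. A graph is $k$-connected if it has more than $k$ vertices and deleting fewer than $k$ vertices never disconnects it; it is uniquely hamiltonian if it has exactly one hamiltonian cycle. A graph $G$ realizes a finite set $M\subset\mathbb{N}$ if $G$ is uniquely hamiltonian, $\{\deg(v) : v\in V(G)\}=M$, and $G$ is $2$-connected if $2\in M$ and $3$-connected otherwise. The set $M$ is uhc-realizable if some graph realizes it. A set $M=\{d_0,d_1,\dots,d_k\}$ with $k>0$ and $d_0<d_1<\dots<d_k$ is strongly uhc-realizable if for each partition $D_1,D_2$ of $\{d_1,\dots,d_k\}$ (one of $D_1,D_2$ possibly empty) there are constants $c_1\in\mathbb{N}$ and $c_2\in\mathbb{R}$, $c_2>0$, and an infinite sequence of graphs $G_i=(V_i,E_i)$ realizing $M$, with $|V_1|<|V_2|<\cdots$, such that every $G_i$ has at most $c_1$ vertices of degree $d$ for each $d\in D_1$, and at least $c_2|V_i|$ vertices of degree $d'$ for each $d'\in D_2$. For an integer $d\ge 4$, a $d$-seed is a graph $G=(V,E)$ with vertices $s,t\in V$ such that 1. $G$ has maximum degree $4$ and exactly $d-2$ vertices of degree $3$, among them $s$, and $t$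 is the unique vertex of degree $2$; 2. $G$ has exactly one hamiltonian path from $s$ to $t$; 3. let $W(G)$ be the graph obtained from $G$ by adding a new vertex $v$ adjacent to $t$ and to all vertices of degree $3$ in $G$ except $s$; then $W(G)$ together with a further new vertex adjacent to exactly $v$, $s$ and $t$ is $3$-connected. **Theorem.** Let $k\ge 0$ and $M=\{4,d_1,\dots,d_k\}$ with integers $4<d_1<\dots<d_k$. Suppose that there is a $4$-seed, or that $k\ge 1$ and there is a $d_1$-seed (where $d_1$ is the smallest element of $M$ greater than $4$). Then $M$ is uhc-realizable. If $k\ge 1$, then $M$ is also strongly uhc-realizable. -/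

import Mathlib

namespace UHC

/-- `k`-connectedness of a finite graph: more than `k` vertices, and deleting fewer than `k`
vertices never disconnects the graph. -/
def IsKConnected {V : Type*} [Fintype V] (k : ℕ) (G : SimpleGraph V) : Prop :=
  k < Fintype.card V ∧
    ∀ S : Finset V, S.card < k → (G.induce ((S : Set V)ᶜ)).Connected

/-- Uniquely hamiltonian: there is exactly one hamiltonian cycle. Cycles are identified with
their edge sets, so neither the starting vertex nor the direction of a walk matters. -/
def IsUniquelyHamiltonian {V : Type*} [DecidableEq V] (G : SimpleGraph V) : Prop :=
  ∃! C : Set (Sym2 V), ∃ (a : V) (p : G.Walk a a), p.IsHamiltonianCycle ∧ p.edgeSet = C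

/-- There is exactly one hamiltonian path from `s` to `t`. -/
def HasUniqueHamiltonianPath {V : Type*} [DecidableEq V] (G : SimpleGraph V) (s t : V) : Prop :=
  ∃! p : G.Walk s t, p.IsHamiltonian

open Classical in
/-- The set of vertex degrees of a finite graph. -/
noncomputable def degreeSet {V : Type*} [Fintype V] (G : SimpleGraph V) : Finset ℕ :=
  Finset.univ.image fun v => G.degree v

open Classical in
/-- The number of vertices of degree `d`. -/
noncomputable def numDegree {V : Type*} [Fintype V] (G : SimpleGraph V) (d : ℕ) : ℕ :=
  (Finset.univ.filter fun v => G.degree v = d).card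

/-- `G` realizes `M`: it is uniquely hamiltonian with degree set `M`, and it is 2-connected
if `2 ∈ M`, and 3-connected otherwise. -/
def Realizes {V : Type*} [Fintype V] [DecidableEq V] (G : SimpleGraph V) (M : Finset ℕ) : Prop :=
  (if 2 ∈ M then IsKConnected 2 G else IsKConnected 3 G) ∧
    IsUniquelyHamiltonian G ∧ degreeSet G = M

/-- `M` is uhc-realizable. -/
def UhcRealizable (M : Finset ℕ) : Prop :=
  ∃ (n : ℕ) (G : SimpleGraph (Fin n)), Realizes G M

/-- `M` is strongly uhc-realizable: it has at least two elements, and for every partition of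
`M` without its least element into two (possibly empty) parts `D₁`, `D₂` there are an infinite
sequence of graphs realizing `M` and constants `c₁`, `c₂ > 0` such that every degree in `D₁`
occurs at most `c₁` times, and every degree in `D₂` occurs at least `c₂ |V|` times, in each of
the graphs. The graphs are required to have strictly increasing orders, so that the sequence
consists of infinitely many different graphs. -/
def StronglyUhcRealizable (M : Finset ℕ) : Prop :=
  1 < M.card ∧ ∃ d₀ : ℕ, IsLeast (M : Set ℕ) d₀ ∧
    ∀ D₁ D₂ : Finset ℕ, Disjoint D₁ D₂ → D₁ ∪ D₂ = M.erase d₀ →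
      ∃ (c₁ : ℕ) (c₂ : ℝ), 0 < c₂ ∧
        ∃ (n : ℕ → ℕ) (G : ∀ i, SimpleGraph (Fin (n i))), StrictMono n ∧
          ∀ i, Realizes (G i) M ∧
            (∀ d ∈ D₁, numDegree (G i) d ≤ c₁) ∧
            (∀ d ∈ D₂, c₂ * (n i : ℝ) ≤ (numDegree (G i) d : ℝ))

/-- Add one new vertex `none` to `G` and join it to exactly the vertices in `N`. -/
def addVertex {V : Type*} (G : SimpleGraph V) (N : Set V) : SimpleGraph (Option V) where
  Adj a b :=
    match a, b with
    | some x, some y => G.Adj x y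
    | some x, none => x ∈ N
    | none, some y => y ∈ N
    | none, none => False
  symm := ⟨fun a b h => by
    cases a <;> cases b <;> simp_all [SimpleGraph.adj_comm]⟩
  loopless := ⟨fun a h => by
    cases a <;> simp_all⟩

open Classical in
/-- The graph `W(G)`: a new vertex `v` (here `none`) is joined to `t` and to all vertices of
degree 3 except `s`. -/
def seedPlugin {V : Type*} [Fintype V] (G : SimpleGraph V) (s t : V) : SimpleGraph (Option V) :=
  addVertex G {w | w = t ∨ (w ≠ s ∧ G.degree w = 3)}

open Classical in
/-- `G` with the vertices `s` and `t` is a `d`-seed: its maximum degree is 4, there are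
`d - 2 ≥ 2` vertices of degree 3, among them `s`, and `t` is the only vertex of degree 2;
there is exactly one hamiltonian path from `s` to `t`; and `W(G)` together with a new vertex
joined to `v`, `s` and `t` is 3-connected. -/
structure IsSeed {V : Type*} [Fintype V] [DecidableEq V] (d : ℕ) (G : SimpleGraph V) (s t : V) :
    Prop where
  maxDegree_eq : G.maxDegree = 4
  four_le : 4 ≤ d
  numDegree_three : numDegree G 3 = d - 2
  degree_s : G.degree s = 3
  degree_eq_two_iff : ∀ w, G.degree w = 2 ↔ w = t
  uniquePath : HasUniqueHamiltonianPath G s t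
  threeConnected :
    IsKConnected 3 (addVertex (seedPlugin G s t) {none, some s, some t})

/-- There is a `d`-seed. -/
def HasSeed (d : ℕ) : Prop :=
  ∃ (n : ℕ) (G : SimpleGraph (Fin n)) (s t : Fin n), IsSeed d G s t

end UHC

namespace UHC

open SimpleGraph

/-! The engine is substitution. Let `C` be the hamiltonian cycle of a graph, and let `x` be a cubic
vertex with `C`-neighbours `a`, `b` and third neighbour `c`. Replace `x` by a block `B` with exactly
one hamiltonian path from `p` to `q`, joining `a` to `p`, `b` to `q`, and `c` to all of `R`. If `c`
was cubic as well, its degree becomes `|R| + 2`. `NoTwoCut.substitute` preserves 3-connectedness and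
`UniqueCyc.substitute` preserves uniqueness.

For uniqueness, consider how a cycle meets the block. If it avoids the edges from `c` to the block,
contracting the block gives `C`, contracting the rest gives the unique cycle of the block, and
together they determine the cycle. If it uses one such edge, contracting the block gives a cycle
through the chord `xc`, which is impossible if uniqueness holds in the presence of the chord;
alternatively, contracting the rest gives a cycle of the block that uses an edge to `R`, which a
strict block forbids. If it uses two such edges, contracting the block together with `c` gives a
cycle that misses `c`. This last case is why `UniqueCyc E T C` also excludes cycles that miss
vertices of `T`; the chord ends `c` are kept in `T`.

There are two stages. A seed for `e` is a block whose vertices all get degree 4, but it need not be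
strict. It is substituted at 29 vertices of an explicit graph on 79 vertices whose cycle is unique
even with all chords present and with the 29 chord ends optional (`uniqueCyc_base`, by a verified
case search in a related cubic graph). The outcome is a 3-connected uniquely hamiltonian graph with
degrees 4 and `e`, and deleting a vertex of degree `e` from it leaves a strict block
(`HasSeed.exists_block`).

In the second stage strict blocks are substituted in a bipartite skeleton (`isSkeleton_skeleton`).
Without its chords the skeleton has a unique hamiltonian cycle, because the cycle edges are forced
one vertex after another. The remaining degrees come from disjoint complete bipartite pieces, one
piece with sides of size `d - 2` for each desired batch of vertices of degree `d`. The number of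
blocks depends only on the maximum of `M`, so the multiplicities of all degrees can be prescribed up
to a bounded error (`exists_realizes`), which gives strong realizability. -/

/-- `D` is a single cycle, possibly together with isolated vertices. -/
structure IsCyc {V : Type*} (D : SimpleGraph V) : Prop where
  exists_adj : ∃ v w, D.Adj v w
  deg : ∀ v, (∀ w, ¬ D.Adj v w) ∨ ∃ a b, a ≠ b ∧ ∀ z, D.Adj v z ↔ z = a ∨ z = b
  closed : ∀ X : Set V, (∀ v w, D.Adj v w → v ∈ X → w ∈ X) → (∃ v w, v ∈ X ∧ D.Adj v w) →
    ∀ v w, D.Adj v w → v ∈ X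

/-- `C` is a hamiltonian cycle of `E`, and every cycle of `E` that visits all the vertices
outside `T` is equal to `C`. -/
structure UniqueCyc {V : Type*} (E : SimpleGraph V) (T : Set V) (C : SimpleGraph V) : Prop where
  le : C ≤ E
  isCyc : IsCyc C
  spanning : ∀ v, ∃ w, C.Adj v w
  eq_of_isCyc : ∀ D ≤ E, IsCyc D → (∀ v, v ∉ T → ∃ w, D.Adj v w) → D = C

/-! ### Cycles as graphs of degree 0 or 2 with one nontrivial component. -/

namespace IsCyc

variable {V : Type*} {D : SimpleGraph V}

lemma exists_eq_of_adj (h : IsCyc D) {v w : V} (hvw : D.Adj v w) :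
    ∃ w', w' ≠ w ∧ ∀ z, D.Adj v z ↔ z = w ∨ z = w' := by
  obtain h0 | ⟨a, b, hab, hz⟩ := h.deg v
  · exact absurd hvw (h0 w)
  · obtain rfl | rfl := (hz w).1 hvw
    · exact ⟨b, hab.symm, hz⟩
    · exact ⟨a, hab, fun z => by rw [hz z, or_comm]⟩

lemma eq_or_eq_of_adj (h : IsCyc D) {v a b z : V} (hab : a ≠ b) (ha : D.Adj v a) (hb : D.Adj v b)
    (hz : D.Adj v z) : z = a ∨ z = b := by
  obtain ⟨w', hw', hw⟩ := h.exists_eq_of_adj ha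
  rcases (hw z).1 hz with rfl | rfl
  · exact Or.inl rfl
  · rcases (hw b).1 hb with rfl | rfl
    · exact absurd rfl hab
    · exact Or.inr rfl

/-- A cycle has no closed part that misses one of its vertices. -/
lemma false_of_closed (h : IsCyc D) {X : Set V} (hX : ∀ v w, D.Adj v w → v ∈ X → w ∈ X)
    {v w v' w' : V} (hv : v ∈ X) (hvw : D.Adj v w) (hv' : v' ∉ X) (hvw' : D.Adj v' w') : False :=
  hv' (h.closed X hX ⟨v, w, hv, hvw⟩ _ _ hvw')

lemma isCycles (h : IsCyc D) : D.IsCycles := by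
  rintro v ⟨w, hw⟩
  obtain h0 | ⟨a, b, hab, hz⟩ := h.deg v
  · exact absurd hw (h0 w)
  · have : D.neighborSet v = {a, b} := by ext z; simp [hz]
    rw [this, Set.ncard_pair hab]

/-- At a vertex of `C` both edges of `D` are already edges of `C`, so the vertices of `C` form a
closed part of `D`. -/
lemma eq_of_le {C : SimpleGraph V} (hD : IsCyc D) (hC : IsCyc C) (h : C ≤ D) : D = C := by
  have key : ∀ v w, (∃ w, C.Adj v w) → D.Adj v w → C.Adj v w := by
    rintro v w ⟨x, hx⟩ hvw
    obtain ⟨y, hy, hxy⟩ := hC.exists_eq_of_adj hx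
    have hy' : C.Adj v y := (hxy y).2 (Or.inr rfl)
    exact (hxy w).2 (hD.eq_or_eq_of_adj hy.symm (h hx) (h hy') hvw)
  refine le_antisymm (fun v w hvw => ?_) h
  obtain ⟨a, b, hab⟩ := hC.exists_adj
  refine key v w ?_ hvw
  exact hD.closed {v | ∃ w, C.Adj v w}
    (fun v w hvw hv => ⟨v, (key v w hv hvw).symm⟩) ⟨a, b, ⟨b, hab⟩, h hab⟩ v w hvw

end IsCyc

/-! ### Parity of the crossings of a cut. -/

section Parity

variable {V : Type*} [Fintype V] {D : SimpleGraph V}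

open Classical in
-- The degrees in `S` sum to an even number, and every edge inside `S` is counted twice. The set `P`
-- may be any finite set of ordered pairs across the cut that includes all those joined in `D`.
lemma IsCyc.even_crossing (h : IsCyc D) (S : Set V) (P : Finset (V × V))
    (hP : ∀ p ∈ P, p.1 ∈ S ∧ p.2 ∉ S)
    (hP' : ∀ v ∈ S, ∀ w, w ∉ S → D.Adj v w → (v, w) ∈ P) :
    Even (P.filter fun p => D.Adj p.1 p.2).card := by
  have hdeg : ∀ v, Even (D.degree v) := fun v => by
    rcases h.deg v with h0 | ⟨a, b, hab, hz⟩
    · have : D.neighborFinset v = ∅ := by ext z; simp [h0]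
      rw [← card_neighborFinset_eq_degree, this]; simp
    · have : D.neighborFinset v = {a, b} := by ext z; simp [hz]
      rw [← card_neighborFinset_eq_degree, this, Finset.card_pair hab]; simp
  let D' : SimpleGraph V :=
    { Adj := fun v w => v ∈ S ∧ w ∈ S ∧ D.Adj v w
      symm := ⟨fun v w h => ⟨h.2.1, h.1, h.2.2.symm⟩⟩
      loopless := ⟨fun v h => D.loopless.irrefl v h.2.2⟩ }
  have h1 : ∀ v ∈ Finset.univ.filter (· ∈ S),
      D.degree v = D'.degree v + (Finset.univ.filter fun w => w ∉ S ∧ D.Adj v w).card := by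
    intro v hv
    have hv : v ∈ S := by simpa using hv
    rw [← card_neighborFinset_eq_degree, ← card_neighborFinset_eq_degree,
      ← Finset.card_filter_add_card_filter_not (fun w => w ∈ S)]
    congr 2
    · ext w; simp [D', hv, and_comm]
    · ext w; simp [and_comm]
  have h2 : ∑ v ∈ Finset.univ.filter (· ∈ S), D'.degree v = ∑ v, D'.degree v := by
    refine Finset.sum_subset (Finset.subset_univ _) fun v _ hv => ?_
    have hv : v ∉ S := by simpa using hv
    rw [← card_neighborFinset_eq_degree, Finset.card_eq_zero]
    ext w; simp [D', hv]
  have h3 : (P.filter fun p => D.Adj p.1 p.2).card =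
      ∑ v ∈ Finset.univ.filter (· ∈ S), (Finset.univ.filter fun w => w ∉ S ∧ D.Adj v w).card := by
    rw [← Finset.card_sigma]
    refine Finset.card_bij (fun p _ => ⟨p.1, p.2⟩) ?_ ?_ ?_
    · rintro ⟨v, w⟩ hp
      have := hP (v, w) (by simp at hp; exact hp.1)
      simp at hp this ⊢
      exact ⟨this.1, this.2, hp.2⟩
    · rintro ⟨v, w⟩ _ ⟨v', w'⟩ _ h
      simpa using h
    · rintro ⟨v, w⟩ hp
      simp at hp
      exact ⟨(v, w), by simp [hP' v hp.1 w hp.2.1 hp.2.2, hp.2.2], rfl⟩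
  have h4 : Even (∑ v ∈ Finset.univ.filter (· ∈ S), D.degree v) :=
    Finset.even_sum _ fun v _ => hdeg v
  rw [Finset.sum_congr rfl h1, Finset.sum_add_distrib, h2, sum_degrees_eq_twice_card_edges,
    ← h3] at h4
  exact (Nat.even_add.1 h4).1 (by simp)

/-- A cycle does not cross a cut exactly once. -/
lemma IsCyc.not_adj_of_crossing (h : IsCyc D) {S : Set V} {u w : V} (hu : u ∈ S) (hw : w ∉ S)
    (hS : ∀ v ∈ S, ∀ z, z ∉ S → D.Adj v z → v = u ∧ z = w) : ¬ D.Adj u w := by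
  classical
  intro huw
  have := h.even_crossing S {(u, w)} (by simp [hu, hw]) (fun v hv z hz hvz => by
    simpa using hS v hv z hz hvz)
  rw [Finset.filter_singleton, if_pos huw] at this
  simp at this

end Parity

/-! ### Translation between cycles as graphs and cycles as walks. -/

section Walks

variable {V : Type*} {G : SimpleGraph V}

lemma mem_of_walk {D : SimpleGraph V} {X : Set V} (hX : ∀ v w, D.Adj v w → v ∈ X → w ∈ X)
    {v w : V} (p : D.Walk v w) (hv : v ∈ X) : w ∈ X := by
  induction p with
  | nil => exact hv
  | cons h _ ih => exact ih (hX _ _ h hv)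

lemma isCyc_of_isCycle {a : V} {p : G.Walk a a} (hp : p.IsCycle) :
    IsCyc p.toSubgraph.spanningCoe where
  exists_adj := ⟨_, _, p.toSubgraph_adj_snd hp.not_nil⟩
  deg v := by
    have := hp.isCycles_spanningCoe_toSubgraph (v := v)
    by_cases h0 : ∀ w, ¬ p.toSubgraph.spanningCoe.Adj v w
    · exact Or.inl h0
    · push Not at h0
      obtain ⟨w, hw⟩ := h0
      obtain ⟨x, y, hxy, h⟩ := Set.ncard_eq_two.1 (this ⟨w, hw⟩)
      refine Or.inr ⟨x, y, hxy, fun z => ?_⟩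
      rw [← mem_neighborSet, h]; simp
  closed X hX := by
    rintro ⟨v, w, hv, hvw⟩ v' w' hvw'
    have hc := p.toSubgraph_connected
    have h1 : v ∈ p.toSubgraph.verts := p.toSubgraph.edge_vert hvw
    have h2 : v' ∈ p.toSubgraph.verts := p.toSubgraph.edge_vert hvw'
    obtain ⟨q⟩ := hc.preconnected ⟨v, h1⟩ ⟨v', h2⟩
    exact mem_of_walk (X := {x : p.toSubgraph.verts | (x : V) ∈ X})
      (fun v w hvw hv => hX v w hvw hv) q hv

lemma mem_edgeSet_spanningCoe {a b : V} (p : G.Walk a b) :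
    p.toSubgraph.spanningCoe.edgeSet = p.edgeSet := by
  rw [Subgraph.edgeSet_spanningCoe, Walk.edgeSet_toSubgraph]

/-- A cycle walk exhausts the component of `a`; it is a cycle inside the cycle `D`, hence all of `D`
by `IsCyc.eq_of_le`. -/
lemma exists_walk_of_isCyc [DecidableEq V] [Finite V] {D : SimpleGraph V} (hD : IsCyc D)
    (hsp : ∀ v, ∃ w, D.Adj v w) (a : V) :
    ∃ p : D.Walk a a, p.IsHamiltonianCycle ∧ p.toSubgraph.spanningCoe = D := by
  obtain ⟨p, hp, hv⟩ := hD.isCycles.exists_cycle_toSubgraph_verts_eq_connectedComponentSupp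
    (c := D.connectedComponentMk a) rfl (hsp a)
  refine ⟨p, ?_, (hD.eq_of_le (isCyc_of_isCycle hp) (Subgraph.spanningCoe_le _)).symm⟩
  refine ⟨hp, (hp.isPath_tail.isHamiltonian_iff).2 fun w => ?_⟩
  have hw : w ∈ p.support := by
    rw [← Walk.mem_verts_toSubgraph, hv]
    obtain ⟨x, hx⟩ := hsp w
    obtain ⟨y, hy⟩ := hsp a
    have := hD.closed {v | D.Reachable a v} (fun v w hvw hv => hv.trans hvw.reachable)
      ⟨a, y, Reachable.refl _, hy⟩ w x hx
    rw [ConnectedComponent.mem_supp_iff, ConnectedComponent.eq]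
    exact this.symm
  rw [Walk.support_tail_of_not_nil _ hp.not_nil]
  rcases eq_or_ne w a with rfl | hwa
  · exact Walk.end_mem_tail_support hp.not_nil
  · rw [Walk.mem_support_iff] at hw
    exact hw.resolve_left hwa

lemma UniqueCyc.isUniquelyHamiltonian [DecidableEq V] [Finite V] [Nonempty V] {T : Set V}
    {C : SimpleGraph V} (h : UniqueCyc G T C) : IsUniquelyHamiltonian G := by
  obtain ⟨a⟩ := ‹Nonempty V›
  obtain ⟨p, hp, hpC⟩ := exists_walk_of_isCyc h.isCyc h.spanning a
  refine ⟨C.edgeSet, ⟨a, p.mapLe h.le, ?_, ?_⟩, ?_⟩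
  · exact hp.map (f := Hom.ofLE h.le) Function.bijective_id
  · rw [← mem_edgeSet_spanningCoe]
    conv_rhs => rw [← hpC]
    rw [mem_edgeSet_spanningCoe]
    ext e; simp [Walk.edgeSet]
  · rintro _ ⟨b, q, hq, rfl⟩
    rw [← mem_edgeSet_spanningCoe,
      h.eq_of_isCyc q.toSubgraph.spanningCoe (Subgraph.spanningCoe_le _)
        (isCyc_of_isCycle hq.isCycle) fun v _ => ?_]
    have hv : v ∈ q.toSubgraph.verts := (Walk.mem_verts_toSubgraph _).2 (hq.mem_support v)
    have := hq.isCycle.ncard_neighborSet_toSubgraph_eq_two ((Walk.mem_verts_toSubgraph _).1 hv)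
    obtain ⟨w, hw⟩ := Set.nonempty_of_ncard_ne_zero (by rw [this]; simp)
    exact ⟨w, hw⟩

end Walks


/-! ### Hamiltonian paths as cycles through an added vertex. -/

section HamiltonianPaths

variable {V : Type*} {G : SimpleGraph V}

@[simp] lemma addVertex_some_some {N : Set V} {x y : V} :
    (addVertex G N).Adj (some x) (some y) ↔ G.Adj x y := Iff.rfl

@[simp] lemma addVertex_some_none {N : Set V} {x : V} :
    (addVertex G N).Adj (some x) none ↔ x ∈ N := Iff.rfl

@[simp] lemma addVertex_none_some {N : Set V} {x : V} :
    (addVertex G N).Adj none (some x) ↔ x ∈ N := Iff.rfl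

lemma addVertex_mono {G' : SimpleGraph V} {N N' : Set V} (h : G ≤ G') (hN : N ⊆ N') :
    addVertex G N ≤ addVertex G' N' := by
  rintro (_ | x) (_ | y) hxy
  · exact hxy
  · exact hN hxy
  · exact hN hxy
  · exact h hxy

lemma addVertex_comap_some {D : SimpleGraph (Option V)} {N : Set V}
    (h : ∀ x, D.Adj none (some x) ↔ x ∈ N) : addVertex (D.comap some) N = D := by
  ext x y
  rcases x with _ | x <;> rcases y with _ | y
  · simp
  · simp [h]
  · rw [addVertex_some_none, D.adj_comm, h]
  · simp

lemma spanningCoe_toSubgraph_le_of_walk {a b : V} (p : G.Walk a b) {D : SimpleGraph V}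
    (h : ∀ e ∈ p.edges, e ∈ D.edgeSet) : p.toSubgraph.spanningCoe ≤ D := by
  intro v w hvw
  exact h s(v, w) (Walk.adj_toSubgraph_iff_mem_edges.1 hvw)

lemma isCyc_addVertex_of_isPath [DecidableEq V] {s t : V} (hst : s ≠ t) {p : G.Walk s t}
    (hp : p.IsPath) : IsCyc (addVertex p.toSubgraph.spanningCoe {s, t}) := by
  -- The complete graph serves as an ambient graph in which the path can be closed through `none`.
  let A := addVertex (⊤ : SimpleGraph V) Set.univ
  obtain ⟨f, hf⟩ : ∃ f : G →g A, ∀ x, f x = some x := ⟨⟨some, fun h => h.ne⟩, fun _ => rfl⟩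
  have hinj : Function.Injective f := fun x y h => by simpa [hf] using h
  have h1 : A.Adj none (f s) := by rw [hf]; trivial
  have h2 : A.Adj (f t) none := by rw [hf]; trivial
  have hpf : (p.map f).IsPath := Walk.IsPath.map hinj hp
  have hns : none ∉ (p.map f).support := by
    rw [Walk.support_map]; simp [hf]
  have hc : (((p.map f).concat h2).cons h1).IsCycle := by
    rw [Walk.cons_isCycle_iff]
    refine ⟨hpf.concat hns h2, ?_⟩
    rw [Walk.edges_concat, List.concat_eq_append, List.mem_append]
    rintro (h | h)
    · exact hns (Walk.fst_mem_support_of_mem_edges _ h)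
    · simp [hf] at h
      exact hst h
  have hnone : ∀ x, s(none, x) ∉ (p.map f).edges := fun x h =>
    hns (Walk.fst_mem_support_of_mem_edges _ h)
  have hsome : ∀ x y, s(some x, some y) ∈ (p.map f).edges ↔ s(x, y) ∈ p.edges := fun x y => by
    rw [Walk.edges_map, ← hf, ← hf, ← Sym2.map_mk]
    exact List.mem_map_of_injective (Sym2.map.injective hinj)
  have := isCyc_of_isCycle hc
  convert this using 1
  ext x y
  rw [Subgraph.spanningCoe_adj, Walk.adj_toSubgraph_iff_mem_edges]
  have hm : ∀ x y, s(x, y) ∈ p.edges ↔ p.toSubgraph.spanningCoe.Adj x y := fun x y => by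
    rw [Subgraph.spanningCoe_adj, Walk.adj_toSubgraph_iff_mem_edges]
  rw [Walk.edges_cons, Walk.edges_concat, List.concat_eq_append, List.mem_cons, List.mem_append,
    List.mem_singleton]
  generalize (p.map f).edges = L at hnone hsome
  rcases x with _ | x <;> rcases y with _ | y
  · simp [hf, hnone]
  · simp [hf, hnone, eq_comm]
  · rw [Sym2.eq_swap (a := some x)]
    simp [hf, hnone, eq_comm]
  · rw [addVertex_some_some, ← hm, hsome]
    simp [hf]

/-- A walk that avoids the new vertex comes from the original graph. -/
lemma exists_map_eq_of_notMem {D : SimpleGraph (Option V)} {a b : Option V} (r : D.Walk a b) :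
    none ∉ r.support → ∀ x y, a = some x → b = some y →
      ∃ p : (D.comap some).Walk x y, r.support = p.support.map some := by
  induction r with
  | nil =>
    rintro _ x y rfl h
    obtain rfl := Option.some_injective _ h
    exact ⟨Walk.nil, by simp⟩
  | @cons u v w h r ih =>
    rintro hn x y rfl rfl
    rw [Walk.support_cons, List.mem_cons, not_or] at hn
    rcases v with _ | z
    · exact absurd r.start_mem_support hn.2
    · obtain ⟨p, hp⟩ := ih hn.2 z y rfl rfl
      have h' : (D.comap some).Adj x z := h
      exact ⟨Walk.cons h' p, by rw [Walk.support_cons, Walk.support_cons, hp, List.map_cons]⟩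

/-- The cycle, read as a closed walk from `none`, loses both its edges at `none`. What is left is a
hamiltonian path between two distinct elements of `{s, t}`. -/
lemma exists_path_of_isCyc_addVertex [DecidableEq V] [Finite V] {s t : V}
    {D : SimpleGraph (Option V)} (hD : IsCyc D) (hsp : ∀ v, ∃ w, D.Adj v w)
    (hle : D ≤ addVertex G {s, t}) :
    ∃ p : G.Walk s t, p.IsHamiltonian ∧ D = addVertex p.toSubgraph.spanningCoe {s, t} := by
  obtain ⟨q, hq, -⟩ := exists_walk_of_isCyc hD hsp none
  have hnone : ∀ x, D.Adj none (some x) → x = s ∨ x = t := fun x hx => hle hx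
  -- Given such a path inside `D`, closing it through `none` yields a cycle contained in the cycle
  -- `D`, hence equal to it.
  suffices ∃ p : (D.comap some).Walk s t, p.IsHamiltonian ∧ s ≠ t by
    obtain ⟨p, hp, hst⟩ := this
    have hle' : D.comap some ≤ G := fun x y hxy => hle hxy
    have hn : ∀ x, D.Adj none (some x) ↔ x ∈ ({s, t} : Set V) := by
      rcases hD.deg none with h0 | ⟨a, b, hab, hz⟩
      · obtain ⟨w, hw⟩ := hsp none
        exact absurd hw (h0 w)
      · have ha := (hz a).2 (Or.inl rfl)
        have hb := (hz b).2 (Or.inr rfl)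
        rcases a with _ | a
        · exact absurd rfl ha.ne
        rcases b with _ | b
        · exact absurd rfl hb.ne
        have h1 := hnone a ha
        have h2 := hnone b hb
        intro x
        rw [hz]
        simp only [Option.some.injEq, Set.mem_insert_iff, Set.mem_singleton_iff]
        have hab' : a ≠ b := fun h => hab (by rw [h])
        grind
    refine ⟨p.mapLe hle', hp.map (f := Hom.ofLE hle') Function.bijective_id, ?_⟩
    refine hD.eq_of_le (isCyc_addVertex_of_isPath hst ?_) ?_
    · exact (Walk.isPath_map_iff_of_injective Function.injective_id).2 hp.isPath
    · conv_rhs => rw [← addVertex_comap_some hn]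
      refine addVertex_mono ?_ subset_rfl
      refine spanningCoe_toSubgraph_le_of_walk _ fun e he => ?_
      rw [Walk.edges_mapLe_eq_edges] at he
      exact Walk.edges_subset_edgeSet p he
  have hqt := hq.isHamiltonian_tail
  cases q with
  | nil => exact absurd rfl hq.isCycle.ne_nil
  | @cons _ u _ h q' =>
    rw [Walk.tail_cons] at hqt
    rcases u with _ | x
    · exact absurd rfl h.ne
    have hq' : q'.IsHamiltonian := by
      intro a
      have := hqt a
      simpa using this
    have hrev : ∀ a, a ∈ q'.reverse.support := fun a => by
      rw [Walk.support_reverse, List.mem_reverse]; exact hq'.mem_support a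
    have hpath : q'.reverse.IsPath := hq'.isPath.reverse
    have hcyc := hq.isCycle
    rw [Walk.cons_isCycle_iff] at hcyc
    have hedge : s(none, some x) ∉ q'.reverse.edges := by
      rw [Walk.edges_reverse, List.mem_reverse]; exact hcyc.2
    generalize q'.reverse = r0 at hrev hpath hedge
    cases r0 with
    | @cons _ u _ h' r =>
      rcases u with _ | y
      · exact absurd rfl h'.ne
      rw [Walk.cons_isPath_iff] at hpath
      obtain ⟨p, hp⟩ := exists_map_eq_of_notMem r hpath.2 y x rfl rfl
      have hpp : p.IsPath := by
        refine Walk.IsPath.mk' ?_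
        have := hpath.1.support_nodup
        rw [hp] at this
        exact this.of_map
      have hpm : ∀ a, a ∈ p.support := by
        intro a
        have := hrev (some a)
        rw [Walk.support_cons, List.mem_cons, hp] at this
        simpa using this
      have hpH := (hpp.isHamiltonian_iff).2 hpm
      have hxy : x ≠ y := by
        rintro rfl
        exact hedge (by simp)
      rcases hnone x h with rfl | rfl <;> rcases hnone y h' with rfl | rfl
      · exact absurd rfl hxy
      · exact ⟨p.reverse, ((hpp.reverse).isHamiltonian_iff).2 (by simpa using hpm), hxy⟩
      · exact ⟨p, hpH, hxy.symm⟩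
      · exact absurd rfl hxy

/-- This turns the path condition of a seed into the cycle condition used for blocks: hamiltonian
paths from `s` to `t` correspond to hamiltonian cycles after a vertex joined to `s` and `t` is
added. -/
lemma HasUniqueHamiltonianPath.exists_uniqueCyc [DecidableEq V] [Finite V] {s t : V}
    (hst : s ≠ t) (h : HasUniqueHamiltonianPath G s t) :
    ∃ C, UniqueCyc (addVertex G {s, t}) ∅ C := by
  obtain ⟨p, hp, huniq⟩ := h
  have hc := isCyc_addVertex_of_isPath hst (Walk.IsHamiltonian.isPath hp)
  refine ⟨_, addVertex_mono (Subgraph.spanningCoe_le _) subset_rfl, hc, ?_, ?_⟩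
  · rintro (_ | v)
    · exact ⟨some s, by simp⟩
    · have hv : v ∈ p.toSubgraph.verts := (Walk.mem_verts_toSubgraph _).2 (hp.mem_support v)
      have hn : ¬ p.Nil := fun h0 => hst h0.eq
      by_contra! h0
      obtain ⟨w, hw⟩ : ∃ w, p.toSubgraph.Adj v w := by
        have := p.mem_support_iff_exists_getVert.1 (hp.mem_support v)
        obtain ⟨i, rfl, hi⟩ := this
        rcases hi.lt_or_eq with hi | rfl
        · exact ⟨_, p.toSubgraph_adj_getVert hi⟩
        · have hpos : 0 < p.length := Walk.not_nil_iff_lt_length.1 hn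
          have := p.toSubgraph_adj_getVert (i := p.length - 1) (by omega)
          rw [Nat.sub_add_cancel hpos] at this
          exact ⟨_, this.symm⟩
      exact h0 (some w) hw
  · intro D hD hcyc hsp
    obtain ⟨q, hq, rfl⟩ := exists_path_of_isCyc_addVertex hcyc (fun v => hsp v (by simp)) hD
    rw [huniq q hq]

end HamiltonianPaths


/-! ### Contraction of cycles. -/

/-- The simple graph obtained from `D` by identifying vertices along `f`. -/
def contract {A B : Type*} (f : A → B) (D : SimpleGraph A) : SimpleGraph B where
  Adj u v := u ≠ v ∧ ∃ y z, f y = u ∧ f z = v ∧ D.Adj y z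
  symm := ⟨fun _ _ ⟨h, y, z, hy, hz, hyz⟩ => ⟨h.symm, z, y, hz, hy, hyz.symm⟩⟩
  loopless := ⟨fun _ h => h.1 rfl⟩

section Contract

variable {A B : Type*} {f : A → B} {D : SimpleGraph A}

/-- Closed sets pull back along `f`, so connectedness is inherited and only the degrees need to be
checked. -/
lemma IsCyc.isCyc_contract (hD : IsCyc D) (hne : ∃ u v, (contract f D).Adj u v)
    (hdeg : ∀ u, (∀ w, ¬ (contract f D).Adj u w) ∨
      ∃ a b, a ≠ b ∧ ∀ z, (contract f D).Adj u z ↔ z = a ∨ z = b) :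
    IsCyc (contract f D) where
  exists_adj := hne
  deg := hdeg
  closed X hX := by
    rintro ⟨v, w, hv, -, y, z, rfl, rfl, hyz⟩ _ _ ⟨-, y', z', rfl, rfl, hyz'⟩
    refine hD.closed (f ⁻¹' X) (fun a b hab ha => ?_) ⟨y, z, hv, hyz⟩ y' z' hyz'
    by_cases h : f a = f b
    · exact Set.mem_preimage.2 (h ▸ ha)
    · exact hX (f a) (f b) ⟨h, a, b, rfl, rfl, hab⟩ ha

/-- A vertex that is not merged with another one keeps its degree as long as no two of its
neighbours on the cycle are merged. -/
lemma IsCyc.contract_deg (hD : IsCyc D) {y : A} (hy : ∀ z, f z = f y → z = y)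
    (hinj : ∀ z z', D.Adj y z → D.Adj y z' → f z = f z' → z = z') :
    (∀ w, ¬ (contract f D).Adj (f y) w) ∨
      ∃ a b, a ≠ b ∧ ∀ z, (contract f D).Adj (f y) z ↔ z = a ∨ z = b := by
  rcases hD.deg y with h0 | ⟨a, b, hab, h⟩
  · left
    rintro w ⟨-, y', z, hy', -, hyz⟩
    rw [hy y' hy'] at hyz
    exact h0 z hyz
  · right
    have ha := (h a).2 (Or.inl rfl)
    have hb := (h b).2 (Or.inr rfl)
    refine ⟨f a, f b, fun hf => hab (hinj a b ha hb hf), fun z => ⟨?_, ?_⟩⟩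
    · rintro ⟨-, y', z, hy', rfl, hyz⟩
      rw [hy y' hy'] at hyz
      rcases (h z).1 hyz with rfl | rfl
      · exact Or.inl rfl
      · exact Or.inr rfl
    · rintro (rfl | rfl)
      · exact ⟨fun hf => ha.ne (hy a hf.symm).symm, y, a, rfl, rfl, ha⟩
      · exact ⟨fun hf => hb.ne (hy b hf.symm).symm, y, b, rfl, rfl, hb⟩

end Contract

/-! ### Substituting a block for a vertex: cycles. -/

section Substitution

variable {V W : Type*}

/-- The graph obtained from `H` by replacing the vertex `x`, with neighbours `a`, `b`, `c`, by the
graph `B`: the vertex `a` is joined to `p`, `b` to `q`, and `c` to all vertices in `R`. -/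
def substitute (H : SimpleGraph V) (x a b c : V) (B : SimpleGraph W) (p q : W) (R : Set W) :
    SimpleGraph ({v // v ≠ x} ⊕ W) where
  Adj
    | .inl u, .inl v => H.Adj u v
    | .inr u, .inr v => B.Adj u v
    | .inl u, .inr w => (u.1 = a ∧ w = p) ∨ (u.1 = b ∧ w = q) ∨ (u.1 = c ∧ w ∈ R)
    | .inr w, .inl u => (u.1 = a ∧ w = p) ∨ (u.1 = b ∧ w = q) ∨ (u.1 = c ∧ w ∈ R)
  symm := ⟨by rintro (u | u) (v | v) h <;> first | exact h | exact h.symm⟩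
  loopless := ⟨by rintro (u | u) h <;> exact h.ne rfl⟩

/-- Collapsing the inserted graph to the vertex `x`. -/
def toOuter (x : V) : {v // v ≠ x} ⊕ W → V
  | .inl v => v
  | .inr _ => x

/-- Collapsing everything outside the inserted graph. -/
def toInner (x : V) : {v // v ≠ x} ⊕ W → Option W
  | .inl _ => none
  | .inr w => some w

variable {x : V} {D : SimpleGraph ({v // v ≠ x} ⊕ W)}

lemma contract_toOuter_adj {u v : V} (hu : u ≠ x) (hv : v ≠ x) :
    (contract (toOuter x) D).Adj u v ↔ D.Adj (.inl ⟨u, hu⟩) (.inl ⟨v, hv⟩) := by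
  constructor
  · rintro ⟨-, (y | y), (z | z), hy, hz, h⟩
    · obtain rfl : y = ⟨u, hu⟩ := Subtype.ext hy
      obtain rfl : z = ⟨v, hv⟩ := Subtype.ext hz
      exact h
    · exact absurd hz.symm hv
    · exact absurd hy.symm hu
    · exact absurd hy.symm hu
  · exact fun h => ⟨fun h' => h.ne (by simp [h']), _, _, rfl, rfl, h⟩

lemma contract_toOuter_adj_left {v : V} (hv : v ≠ x) :
    (contract (toOuter x) D).Adj x v ↔ ∃ w, D.Adj (.inr w) (.inl ⟨v, hv⟩) := by
  constructor
  · rintro ⟨-, (y | y), (z | z), hy, hz, h⟩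
    · exact absurd hy y.2
    · exact absurd hy y.2
    · obtain rfl : z = ⟨v, hv⟩ := Subtype.ext hz
      exact ⟨y, h⟩
    · exact absurd hz.symm hv
  · rintro ⟨w, h⟩
    exact ⟨hv.symm, _, _, rfl, rfl, h⟩

lemma contract_toInner_adj {u v : W} :
    (contract (toInner x) D).Adj (some u) (some v) ↔ D.Adj (.inr u) (.inr v) := by
  constructor
  · rintro ⟨-, (y | y), (z | z), hy, hz, h⟩
    · cases hy
    · cases hy
    · cases hz
    · cases hy; cases hz; exact h
  · exact fun h => ⟨fun h' => h.ne (by simpa using h'), _, _, rfl, rfl, h⟩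

lemma contract_toInner_adj_none {w : W} :
    (contract (toInner x) D).Adj none (some w) ↔ ∃ v, D.Adj (.inr w) (.inl v) := by
  constructor
  · rintro ⟨-, (y | y), (z | z), hy, hz, h⟩
    · cases hz
    · cases hz; exact ⟨y, h.symm⟩
    · cases hy
    · cases hy
  · rintro ⟨v, h⟩
    exact ⟨by simp, _, _, rfl, rfl, h.symm⟩

variable {v₁ v₂ : {v // v ≠ x}} {w₁ w₂ : W}

/-- A cycle that enters the inserted graph exactly once collapses to a cycle. -/
lemma IsCyc.contract_toOuter (hD : IsCyc D) (hv : v₁ ≠ v₂)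
    (h : ∀ w v, D.Adj (.inr w) (.inl v) ↔ (w = w₁ ∧ v = v₁) ∨ (w = w₂ ∧ v = v₂)) :
    IsCyc (contract (toOuter x) D) := by
  have hx : ∀ z, (contract (toOuter x) D).Adj x z ↔ z = v₁ ∨ z = v₂ := fun z => by
    by_cases hz : z = x
    · subst hz
      simp [v₁.2.symm, v₂.2.symm]
    · simp only [contract_toOuter_adj_left hz, h, Subtype.ext_iff]
      exact ⟨by rintro ⟨w, h | h⟩ <;> simp [h], by
        rintro (rfl | rfl)
        · exact ⟨w₁, by simp⟩
        · exact ⟨w₂, by simp⟩⟩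
  refine hD.isCyc_contract ⟨x, v₁, (hx _).2 (Or.inl rfl)⟩ fun u => ?_
  by_cases hu : u = x
  · subst hu
    exact Or.inr ⟨v₁, v₂, fun h => hv (Subtype.ext h), hx⟩
  · refine hD.contract_deg (y := .inl ⟨u, hu⟩) ?_ ?_
    · rintro (z | z) hz
      · exact congrArg Sum.inl (Subtype.ext hz)
      · exact absurd hz.symm hu
    · rintro (z | z) (z' | z') hz hz' hzz
      · exact congrArg Sum.inl (Subtype.ext hzz)
      · exact absurd hzz z.2
      · exact absurd hzz.symm z'.2
      · have h1 := (h _ _).1 hz.symm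
        have h2 := (h _ _).1 hz'.symm
        grind

lemma IsCyc.contract_toInner (hD : IsCyc D) (hw : w₁ ≠ w₂)
    (h : ∀ w v, D.Adj (.inr w) (.inl v) ↔ (w = w₁ ∧ v = v₁) ∨ (w = w₂ ∧ v = v₂)) :
    IsCyc (contract (toInner x) D) := by
  have hx : ∀ z, (contract (toInner x) D).Adj none z ↔ z = some w₁ ∨ z = some w₂ := by
    rintro (_ | z)
    · simp
    · simp only [contract_toInner_adj_none, h, Option.some.injEq]
      exact ⟨by rintro ⟨w, h | h⟩ <;> simp [h], by
        rintro (rfl | rfl)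
        · exact ⟨v₁, by simp⟩
        · exact ⟨v₂, by simp⟩⟩
  refine hD.isCyc_contract ⟨none, some w₁, (hx _).2 (Or.inl rfl)⟩ ?_
  rintro (_ | u)
  · exact Or.inr ⟨some w₁, some w₂, by simpa using hw, hx⟩
  · refine hD.contract_deg (y := .inr u) ?_ ?_
    · rintro (z | z) hz
      · cases hz
      · cases hz; rfl
    · rintro (z | z) (z' | z') hz hz' hzz
      · have h1 := (h _ _).1 hz
        have h2 := (h _ _).1 hz'
        grind
      · cases hzz
      · cases hzz
      · cases hzz; rfl

end Substitution


lemma IsCyc.forall_mem {V : Type*} {C : SimpleGraph V} (hC : IsCyc C) (hsp : ∀ v, ∃ w, C.Adj v w)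
    {X : Set V} (hX : ∀ v w, C.Adj v w → v ∈ X → w ∈ X) {v : V} (hv : v ∈ X) (w : V) : w ∈ X := by
  obtain ⟨u, hu⟩ := hsp v
  obtain ⟨z, hz⟩ := hsp w
  exact hC.closed X hX ⟨v, u, hv, hu⟩ w z hz

section

variable {V W : Type*} {C : SimpleGraph V} {CB : SimpleGraph (Option W)} {x a b c : V} {p q : W}

/-- The two cycles are spliced by replacing the edges `xa`, `xb` of `C` and the two edges of `CB` at
`none` by `ap` and `bq`. The empty set in the place of `R` expresses that `c` has no edge to the
block. -/
lemma isCyc_substitute [Fintype V] (hC : IsCyc C) (hsp : ∀ v, ∃ w, C.Adj v w)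
    (hCx : ∀ z, C.Adj x z ↔ z = a ∨ z = b) (hab : a ≠ b) (hB : IsCyc CB)
    (hBsp : ∀ v, ∃ w, CB.Adj v w) (hBn : ∀ z, CB.Adj none z ↔ z = some p ∨ z = some q)
    (hpq : p ≠ q) :
    IsCyc (substitute C x a b c (CB.comap some) p q ∅) := by
  have hxa : C.Adj x a := (hCx a).2 (Or.inl rfl)
  have hxb : C.Adj x b := (hCx b).2 (Or.inr rfl)
  have hnp : CB.Adj none (some p) := (hBn _).2 (Or.inl rfl)
  have hnq : CB.Adj none (some q) := (hBn _).2 (Or.inr rfl)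
  set S := substitute C x a b c (CB.comap some) p q ∅ with hS
  have hll : ∀ u v, S.Adj (.inl u) (.inl v) ↔ C.Adj u v := fun _ _ => Iff.rfl
  have hrr : ∀ u v, S.Adj (.inr u) (.inr v) ↔ CB.Adj (some u) (some v) := fun _ _ => Iff.rfl
  have hlr : ∀ u w, S.Adj (.inl u) (.inr w) ↔ (u.1 = a ∧ w = p) ∨ (u.1 = b ∧ w = q) :=
    fun u w => by simp [hS, substitute]
  have hrl : ∀ u w, S.Adj (.inr w) (.inl u) ↔ (u.1 = a ∧ w = p) ∨ (u.1 = b ∧ w = q) :=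
    fun u w => by rw [S.adj_comm, hlr]
  have houter : ∀ (u : {v // v ≠ x}) (w : W), C.Adj u x →
      (∀ z, S.Adj (.inl u) (.inr z) ↔ z = w) →
      ∃ e f, e ≠ f ∧ ∀ z, S.Adj (.inl u) z ↔ z = e ∨ z = f := by
    intro u w hux h
    obtain ⟨w', hw', hz⟩ := hC.exists_eq_of_adj hux
    refine ⟨.inr w, .inl ⟨w', hw'⟩, by simp, ?_⟩
    rintro (z | z)
    · simp [hll, hz, z.2, Subtype.ext_iff]
    · simp [h]
  have hinner : ∀ (u : {v // v ≠ x}) (w : W), CB.Adj (some w) none →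
      (∀ z, S.Adj (.inr w) (.inl z) ↔ z = u) →
      ∃ e f, e ≠ f ∧ ∀ z, S.Adj (.inr w) z ↔ z = e ∨ z = f := by
    intro u w hux h
    obtain ⟨w', hw', hz⟩ := hB.exists_eq_of_adj hux
    obtain ⟨w', rfl⟩ := Option.ne_none_iff_exists'.1 hw'
    refine ⟨.inl u, .inr w', by simp, ?_⟩
    rintro (z | z)
    · simp [h]
    · simp [hrr, hz]
  refine ⟨?_, ?_, ?_⟩
  · exact ⟨.inl ⟨a, hxa.ne'⟩, .inr p, (hlr _ _).2 (Or.inl ⟨rfl, rfl⟩)⟩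
  · rintro (⟨u, hu⟩ | w)
    · right
      by_cases hua : u = a
      · subst hua
        exact houter _ p hxa.symm (fun z => by simp [hlr, hab])
      by_cases hub : u = b
      · subst hub
        exact houter _ q hxb.symm (fun z => by simp [hlr, hab.symm])
      rcases hC.deg u with h0 | ⟨e, f, hef, h⟩
      · obtain ⟨w, hw⟩ := hsp u
        exact absurd hw (h0 w)
      · have hx : ∀ y, C.Adj u y → y ≠ x := by
          rintro y hy rfl
          rcases (hCx u).1 hy.symm with rfl | rfl
          · exact hua rfl
          · exact hub rfl
        refine ⟨.inl ⟨e, hx e ((h e).2 (Or.inl rfl))⟩, .inl ⟨f, hx f ((h f).2 (Or.inr rfl))⟩,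
          by simpa using hef, ?_⟩
        rintro (z | z)
        · simp [hll, h, Subtype.ext_iff]
        · simp [hlr, hua, hub]
    · right
      by_cases hua : w = p
      · subst hua
        exact hinner ⟨a, hxa.ne'⟩ w hnp.symm (fun z => by simp [hrl, hpq, Subtype.ext_iff])
      by_cases hub : w = q
      · subst hub
        exact hinner ⟨b, hxb.ne'⟩ w hnq.symm (fun z => by simp [hrl, hpq.symm, Subtype.ext_iff])
      rcases hB.deg (some w) with h0 | ⟨e, f, hef, h⟩
      · obtain ⟨z, hz⟩ := hBsp (some w)
        exact absurd hz (h0 z)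
      · have hx : ∀ y, CB.Adj (some w) y → ∃ y', y = some y' := by
          intro y hy
          rcases y with _ | y
          · rcases (hBn _).1 hy.symm with h | h
            · exact absurd (Option.some_injective _ h) hua
            · exact absurd (Option.some_injective _ h) hub
          · exact ⟨y, rfl⟩
        obtain ⟨e, rfl⟩ := hx e ((h e).2 (Or.inl rfl))
        obtain ⟨f, rfl⟩ := hx f ((h f).2 (Or.inr rfl))
        refine ⟨.inr e, .inr f, by simpa using hef, ?_⟩
        rintro (z | z)
        · simp [hrl, hua, hub]
        · simp [hrr, h]
  · intro X hX hne
    suffices h : ∀ v, v ∈ X from fun v _ _ => h v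
    obtain ⟨v₀, -, hv₀, -⟩ := hne
    set a' : {v // v ≠ x} ⊕ W := .inl ⟨a, hxa.ne'⟩
    set b' : {v // v ≠ x} ⊕ W := .inl ⟨b, hxb.ne'⟩
    have hap : S.Adj a' (.inr p) := (hlr _ _).2 (Or.inl ⟨rfl, rfl⟩)
    have hbq : S.Adj b' (.inr q) := (hlr _ _).2 (Or.inr ⟨rfl, rfl⟩)
    have hap' : a' ∈ X ↔ .inr p ∈ X := ⟨hX _ _ hap, hX _ _ hap.symm⟩
    have hbq' : b' ∈ X ↔ .inr q ∈ X := ⟨hX _ _ hbq, hX _ _ hbq.symm⟩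
    -- `Y` and, below, `Z` are the traces of `X` on the two original cycles, with the membership of
    -- the contracted vertices `x` and `none` dictated by `a'`.
    let Y : Set V := {v | (v = x ∧ a' ∈ X) ∨ ∃ h : v ≠ x, Sum.inl ⟨v, h⟩ ∈ X}
    have hYx : x ∈ Y ↔ a' ∈ X := by simp [Y]
    have hYo : ∀ u (hu : u ≠ x), u ∈ Y ↔ Sum.inl ⟨u, hu⟩ ∈ X := fun u hu => by simp [Y, hu]
    have hYoo : ∀ u v, u ≠ x → v ≠ x → C.Adj u v → u ∈ Y → v ∈ Y := fun u v hu hv huv h => by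
      rw [hYo v hv]
      exact hX (.inl ⟨u, hu⟩) (.inl ⟨v, hv⟩) huv ((hYo u hu).1 h)
    -- Otherwise `xb` would be the only edge of `C` between `Y` and its complement, against parity.
    have hab' : a' ∈ X ↔ b' ∈ X := by
      rw [← hYx, ← hYo b hxb.ne']
      by_contra hne
      rw [not_iff] at hne
      by_cases hx : x ∈ Y
      · refine hC.not_adj_of_crossing (u := x) (w := b) hx (fun h => (hne.2 h) hx) ?_ hxb
        intro v hv z hz hvz
        rcases eq_or_ne v x with rfl | hvx
        · refine ⟨rfl, ((hCx z).1 hvz).resolve_left ?_⟩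
          rintro rfl
          exact hz ((hYo z hxa.ne').2 (hYx.1 hx))
        · rcases eq_or_ne z x with rfl | hzx
          · exact absurd hx hz
          · exact absurd (hYoo v z hvx hzx hvz hv) hz
      · refine hC.not_adj_of_crossing (u := b) (w := x) (hne.1 hx) hx ?_ hxb.symm
        intro v hv z hz hvz
        rcases eq_or_ne z x with rfl | hzx
        · refine ⟨((hCx v).1 hvz.symm).resolve_left ?_, rfl⟩
          rintro rfl
          exact hz (hYx.2 ((hYo v hxa.ne').1 hv))
        · rcases eq_or_ne v x with rfl | hvx
          · exact absurd hv hx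
          · exact absurd (hYoo v z hvx hzx hvz hv) hz
    have hYclosed : ∀ v w, C.Adj v w → v ∈ Y → w ∈ Y := by
      intro v w hvw hv
      rcases eq_or_ne v x with rfl | hvx
      · rcases (hCx w).1 hvw with rfl | rfl
        · exact (hYo _ hxa.ne').2 (hYx.1 hv)
        · exact (hYo _ hxb.ne').2 (hab'.1 (hYx.1 hv))
      · rcases eq_or_ne w x with rfl | hwx
        · rcases (hCx v).1 hvw.symm with rfl | rfl
          · exact hYx.2 ((hYo _ hxa.ne').1 hv)
          · exact hYx.2 (hab'.2 ((hYo _ hxb.ne').1 hv))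
        · exact hYoo v w hvx hwx hvw hv
    let Z : Set (Option W) := {w | (w = none ∧ a' ∈ X) ∨ ∃ z, w = some z ∧ .inr z ∈ X}
    have hZn : none ∈ Z ↔ a' ∈ X := by simp [Z]
    have hZs : ∀ w, some w ∈ Z ↔ .inr w ∈ X := fun w => by simp [Z]
    have hZclosed : ∀ v w, CB.Adj v w → v ∈ Z → w ∈ Z := by
      have hn : ∀ w, CB.Adj none (some w) → (a' ∈ X ↔ .inr w ∈ X) := fun w hw => by
        rcases (hBn _).1 hw with h | h
        · obtain rfl := Option.some_injective _ h
          exact hap'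
        · obtain rfl := Option.some_injective _ h
          exact hab'.trans hbq'
      rintro (_ | v) (_ | w) hvw hv
      · exact hv
      · exact (hZs w).2 ((hn w hvw).1 (hZn.1 hv))
      · exact hZn.2 ((hn v hvw.symm).2 ((hZs v).1 hv))
      · exact (hZs w).2 (hX (.inr v) (.inr w) hvw ((hZs v).1 hv))
    have ha : a' ∈ X := by
      rcases v₀ with ⟨v, hv⟩ | w
      · exact hYx.1 (hC.forall_mem hsp hYclosed ((hYo v hv).2 hv₀) x)
      · exact hZn.1 (hB.forall_mem hBsp hZclosed ((hZs w).2 hv₀) none)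
    rintro (⟨v, hv⟩ | w)
    · exact (hYo v hv).1 (hC.forall_mem hsp hYclosed (hYx.2 ha) v)
    · exact (hZs w).1 (hB.forall_mem hBsp hZclosed (hZn.2 ha) (some w))

end


section

variable {V W : Type*}

lemma IsCyc.adj_none_iff {B : SimpleGraph W} {p q : W} {D : SimpleGraph (Option W)} (hD : IsCyc D)
    (hle : D ≤ addVertex B {p, q}) (hn : ∃ w, D.Adj none w) (z : Option W) :
    D.Adj none z ↔ z = some p ∨ z = some q := by
  have key : ∀ z, D.Adj none z → z = some p ∨ z = some q := by
    rintro (_ | z) hz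
    · exact absurd rfl hz.ne
    · rcases hle hz with rfl | rfl <;> simp
  rcases hD.deg none with h0 | ⟨e, f, hef, h⟩
  · obtain ⟨w, hw⟩ := hn
    exact absurd hw (h0 w)
  · have h1 := key e ((h e).2 (Or.inl rfl))
    have h2 := key f ((h f).2 (Or.inr rfl))
    rw [h]
    grind

/-- The hamiltonian cycles of `B` with a new vertex joined to `p`, `q` and `R` do not use edges
from the new vertex to `R`. -/
def IsStrictBlock (B : SimpleGraph W) (p q : W) (R : Set W) : Prop :=
  p ∉ R ∧ q ∉ R ∧ ∀ D ≤ addVertex B ({p, q} ∪ R), IsCyc D → (∀ v, ∃ w, D.Adj v w) →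
    ∀ r ∈ R, ¬ D.Adj none (some r)

variable [Fintype V] [Fintype W] {E C : SimpleGraph V} {T : Set V} {x a b c : V}
  {B : SimpleGraph W} {p q : W} {R : Set W} {CB : SimpleGraph (Option W)}

/-- The cases are distinguished by the number of edges that the cycle uses from `c` to the block: 0,
1 or 2. The vertex `z` outside `T` keeps the cycle from staying inside the block. Since `c` is
consumed by the substitution, it is no longer optional afterwards. -/
theorem UniqueCyc.substitute (hC : UniqueCyc E T C) (hCx : ∀ z, C.Adj x z ↔ z = a ∨ z = b)
    (hab : a ≠ b) (hxT : x ∉ T) (hc : c ∈ T) (hca : c ≠ a) (hcb : c ≠ b)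
    (hz : ∃ z, z ∉ T ∧ z ≠ x) (hpq : p ≠ q) (hB : UniqueCyc (addVertex B {p, q}) ∅ CB)
    (hE : E.Adj x c ∨ IsStrictBlock B p q R) :
    UniqueCyc (substitute E x a b c B p q R) {v | ∃ u, u.1 ∈ T ∧ u.1 ≠ c ∧ v = .inl u}
      (substitute C x a b c (CB.comap some) p q ∅) := by
  classical
  have hBn := hB.isCyc.adj_none_iff hB.le (hB.spanning none)
  have hcx : c ≠ x := fun h => hxT (h ▸ hc)
  have hxa : C.Adj x a := (hCx a).2 (Or.inl rfl)
  have hxb : C.Adj x b := (hCx b).2 (Or.inr rfl)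
  refine ⟨?_, isCyc_substitute hC.isCyc hC.spanning hCx hab hB.isCyc hB.spanning hBn hpq, ?_, ?_⟩
  · rintro (u | u) (v | v) huv
    · exact hC.le huv
    · rcases huv with h | h | h
      · exact Or.inl h
      · exact Or.inr (Or.inl h)
      · exact absurd h.2 (Set.notMem_empty _)
    · rcases huv with h | h | h
      · exact Or.inl h
      · exact Or.inr (Or.inl h)
      · exact absurd h.2 (Set.notMem_empty _)
    · exact hB.le huv
  · rintro (⟨u, hu⟩ | w)
    · obtain ⟨v, hv⟩ := hC.spanning u
      by_cases hvx : v = x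
      · subst hvx
        rcases (hCx u).1 hv.symm with rfl | rfl
        · exact ⟨.inr p, Or.inl ⟨rfl, rfl⟩⟩
        · exact ⟨.inr q, Or.inr (Or.inl ⟨rfl, rfl⟩)⟩
      · exact ⟨.inl ⟨v, hvx⟩, hv⟩
    · obtain ⟨v | v, hv⟩ := hB.spanning (some w)
      · rcases (hBn _).1 hv.symm with h | h
        · obtain rfl := Option.some_injective _ h
          exact ⟨.inl ⟨a, hxa.ne'⟩, Or.inl ⟨rfl, rfl⟩⟩
        · obtain rfl := Option.some_injective _ h
          exact ⟨.inl ⟨b, hxb.ne'⟩, Or.inr (Or.inl ⟨rfl, rfl⟩)⟩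
      · exact ⟨.inr v, hv⟩
  intro D hle hD hcov
  have hcovW : ∀ w, ∃ v, D.Adj (.inr w) v := fun w => hcov _ (by simp)
  have hcovV : ∀ u (hu : u ≠ x), u ∉ T ∨ u = c → ∃ v, D.Adj (.inl ⟨u, hu⟩) v := fun u hu h =>
    hcov _ (by rintro ⟨u', h1, h2, h3⟩; cases h3; rcases h with h | h; exacts [h h1, h2 h])
  set a' : {v // v ≠ x} := ⟨a, hxa.ne'⟩ with ha'
  set b' : {v // v ≠ x} := ⟨b, hxb.ne'⟩ with hb'
  set c' : {v // v ≠ x} := ⟨c, hcx⟩ with hc'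
  have hab' : a' ≠ b' := fun h => hab (congrArg Subtype.val h)
  have hca' : c' ≠ a' := fun h => hca (congrArg Subtype.val h)
  have hcb' : c' ≠ b' := fun h => hcb (congrArg Subtype.val h)
  have hlink : ∀ w v, D.Adj (.inr w) (.inl v) →
      (w = p ∧ v = a') ∨ (w = q ∧ v = b') ∨ (w ∈ R ∧ v = c') := by
    intro w v h
    rcases hle h with h | h | h
    · exact Or.inl ⟨h.2, Subtype.ext h.1⟩
    · exact Or.inr (Or.inl ⟨h.2, Subtype.ext h.1⟩)
    · exact Or.inr (Or.inr ⟨h.2, Subtype.ext h.1⟩)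
  obtain ⟨z, hzT, hzx⟩ := hz
  have hzc : z ≠ c := fun h => hzT (h ▸ hc)
  obtain ⟨vz, hvz⟩ := hcovV z hzx (Or.inl hzT)
  -- the contraction of a cycle entering the block once
  have houter : ∀ {w₁ w₂ : W} {v₁ v₂ : {v // v ≠ x}}, v₁ ≠ v₂ →
      (∀ w v, D.Adj (.inr w) (.inl v) ↔ (w = w₁ ∧ v = v₁) ∨ (w = w₂ ∧ v = v₂)) →
      E.Adj x v₁ → E.Adj x v₂ → contract (toOuter x) D = C := by
    intro w₁ w₂ v₁ v₂ hv h h1 h2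
    have hEx : ∀ v, (contract (toOuter x) D).Adj x v → E.Adj x v := by
      intro v hxv
      have hvx := hxv.ne'
      obtain ⟨w, hw⟩ := (contract_toOuter_adj_left hvx).1 hxv
      rcases (h _ _).1 hw with h | h
      · obtain rfl := h.2; exact h1
      · obtain rfl := h.2; exact h2
    have hcyc := hD.contract_toOuter hv h
    refine hC.eq_of_isCyc _ ?_ hcyc ?_
    · intro u v huv
      rcases eq_or_ne u x with rfl | hu
      · exact hEx v huv
      rcases eq_or_ne v x with rfl | hv
      · exact (hEx u huv.symm).symm
      · exact hle ((contract_toOuter_adj hu hv).1 huv)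
    · intro v hvT
      rcases eq_or_ne v x with rfl | hvx
      · exact ⟨v₁, (contract_toOuter_adj_left v₁.2).2 ⟨w₁, (h _ _).2 (Or.inl ⟨rfl, rfl⟩)⟩⟩
      · obtain ⟨u | u, hu⟩ := hcovV v hvx (Or.inl hvT)
        · exact ⟨u, (contract_toOuter_adj hvx u.2).2 hu⟩
        · exact ⟨x, ((contract_toOuter_adj_left hvx).2 ⟨u, hu.symm⟩).symm⟩
  have hinner : ∀ {w₁ w₂ : W} {v₁ v₂ : {v // v ≠ x}} {N : Set W}, w₁ ≠ w₂ →
      (∀ w v, D.Adj (.inr w) (.inl v) ↔ (w = w₁ ∧ v = v₁) ∨ (w = w₂ ∧ v = v₂)) →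
      w₁ ∈ N → w₂ ∈ N → contract (toInner x) D ≤ addVertex B N ∧
        ∀ v, ∃ w, (contract (toInner x) D).Adj v w := by
    intro w₁ w₂ v₁ v₂ N hw h h1 h2
    have hnN : ∀ w, (contract (toInner x) D).Adj none (some w) → w ∈ N := fun w hw => by
      obtain ⟨v, hv⟩ := contract_toInner_adj_none.1 hw
      rcases (h _ _).1 hv with h | h
      · obtain rfl := h.1; exact h1
      · obtain rfl := h.1; exact h2
    constructor
    · rintro (_ | u) (_ | v) huv
      · exact absurd rfl huv.ne
      · exact hnN v huv
      · exact hnN u huv.symm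
      · exact hle (contract_toInner_adj.1 huv)
    · rintro (_ | v)
      · exact ⟨some w₁, contract_toInner_adj_none.2 ⟨v₁, (h _ _).2 (Or.inl ⟨rfl, rfl⟩)⟩⟩
      · obtain ⟨u | u, hu⟩ := hcovW v
        · exact ⟨none, (contract_toInner_adj_none.2 ⟨u, hu⟩).symm⟩
        · exact ⟨some u, contract_toInner_adj.2 hu⟩
  have hExa : E.Adj x a := hC.le hxa
  have hExb : E.Adj x b := hC.le hxb
  -- the cut around the block
  let S : Set ({v // v ≠ x} ⊕ W) := Set.range Sum.inr
  have hSr : ∀ w, Sum.inr w ∈ S := fun w => ⟨w, rfl⟩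
  have hSl : ∀ v, Sum.inl v ∉ S := fun v => by simp [S]
  have hpS : ∀ {v : {v // v ≠ x}} {w : W},
      (∀ w' v', D.Adj (.inr w') (.inl v') → w' = w ∧ v' = v) → ¬ D.Adj (.inr w) (.inl v) := by
    intro v w h
    refine hD.not_adj_of_crossing (hSr w) (hSl v) ?_
    rintro _ ⟨w', rfl⟩ (v' | v') hv' h'
    · obtain ⟨rfl, rfl⟩ := h _ _ h'
      exact ⟨rfl, rfl⟩
    · exact absurd (hSr v') hv'
  by_cases hγ : ∃ r, D.Adj (.inr r) (.inl c')
  swap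
  · -- the vertex `c` is not used to enter the block
    have hcr : ∀ w v, D.Adj (.inr w) (.inl v) → (w = p ∧ v = a') ∨ (w = q ∧ v = b') := by
      intro w v h
      rcases hlink w v h with h' | h' | ⟨-, rfl⟩
      · exact Or.inl h'
      · exact Or.inr h'
      · exact absurd ⟨w, h⟩ hγ
    have hα : D.Adj (.inr p) (.inl a') := by
      by_contra hα
      have hcr' : ∀ w v, D.Adj (.inr w) (.inl v) → w = q ∧ v = b' := by
        intro w v h
        rcases hcr w v h with ⟨rfl, rfl⟩ | h'
        · exact absurd h hα
        · exact h'
      have hβ := hpS hcr'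
      obtain ⟨u, hu⟩ := hcovW p
      -- No edge leaves the block now, yet the cycle must visit both `p` and `z`.
      refine hD.false_of_closed (X := S) ?_ (hSr p) hu (hSl ⟨z, hzx⟩) hvz
      rintro _ (v | v) hv ⟨w, rfl⟩
      · obtain ⟨rfl, rfl⟩ := hcr' w v hv
        exact absurd hv hβ
      · exact hSr v
    have hβ : D.Adj (.inr q) (.inl b') := by
      by_contra hβ
      refine hpS (v := a') (w := p) (fun w v h => ?_) hα
      rcases hcr w v h with h' | ⟨rfl, rfl⟩
      · exact h'
      · exact absurd h hβ
    have hiff : ∀ w v, D.Adj (.inr w) (.inl v) ↔ (w = p ∧ v = a') ∨ (w = q ∧ v = b') := by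
      refine fun w v => ⟨hcr w v, ?_⟩
      rintro (⟨rfl, rfl⟩ | ⟨rfl, rfl⟩)
      · exact hα
      · exact hβ
    have h1 : contract (toOuter x) D = C :=
      houter hab' hiff hExa hExb
    obtain ⟨h2, h3⟩ := hinner (N := {p, q}) hpq hiff (by simp) (by simp)
    have h4 : contract (toInner x) D = CB :=
      hB.eq_of_isCyc _ h2 (hD.contract_toInner hpq hiff) (fun v _ => h3 v)
    have hlr : ∀ w v, (UHC.substitute C x a b c (CB.comap some) p q ∅).Adj (.inr w) (.inl v) ↔
        (w = p ∧ v = a') ∨ (w = q ∧ v = b') := by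
      intro w v
      simp [UHC.substitute, Subtype.ext_iff, ha', hb', and_comm]
    ext (u | u) (v | v)
    · rw [← contract_toOuter_adj, h1]; rfl
    · rw [D.adj_comm, hiff, (UHC.substitute C x a b c (CB.comap some) p q ∅).adj_comm, hlr]
    · rw [hiff, hlr]
    · rw [← contract_toInner_adj, h4]; rfl
  · obtain ⟨r₁, hr₁⟩ := hγ
    obtain ⟨e, he, hce⟩ := hD.exists_eq_of_adj hr₁.symm
    have hr₁R : r₁ ∈ R := by
      rcases hlink _ _ hr₁ with h | h | h
      · exact absurd h.2 hca'
      · exact absurd h.2 hcb'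
      · exact h.1
    rcases e with e | r₂
    · -- exactly one edge from `c` to the block
      have hcr : ∀ w v, D.Adj (.inr w) (.inl v) →
          (w = p ∧ v = a') ∨ (w = q ∧ v = b') ∨ (w = r₁ ∧ v = c') := by
        intro w v h
        rcases hlink w v h with h' | h' | ⟨-, rfl⟩
        · exact Or.inl h'
        · exact Or.inr (Or.inl h')
        · rcases (hce _).1 h.symm with h' | h'
          · exact Or.inr (Or.inr ⟨Sum.inr_injective h', rfl⟩)
          · cases h'
      -- A cycle that uses `c` and one of `a`, `b` is impossible. If `xc` is an edge of `E`, the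
      -- outer contraction equals `C` although it uses `xc`; if the block is strict, the inner
      -- contraction uses a forbidden edge to `R`.
      have hfin : ∀ {w₀ : W} {v₀ : {v // v ≠ x}}, v₀ ≠ c' → w₀ ∈ ({p, q} : Set W) →
          E.Adj x v₀ →
          (∀ w v, D.Adj (.inr w) (.inl v) ↔ (w = w₀ ∧ v = v₀) ∨ (w = r₁ ∧ v = c')) → False := by
        intro w₀ v₀ hv₀ hw₀ hE₀ hiff
        rcases hE with hE | ⟨hpR, hqR, hstrict⟩
        · have h1 := houter hv₀ hiff hE₀ hE
          have : C.Adj x c := by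
            rw [← h1]
            exact (contract_toOuter_adj_left hcx).2 ⟨r₁, hr₁⟩
          rcases (hCx c).1 this with h | h
          · exact hca h
          · exact hcb h
        · have hwr : w₀ ≠ r₁ := by
            rintro rfl
            rcases hw₀ with rfl | rfl
            · exact hpR hr₁R
            · exact hqR hr₁R
          obtain ⟨h2, h3⟩ := hinner (N := {p, q} ∪ R) hwr hiff (Or.inl hw₀) (Or.inr hr₁R)
          exact hstrict _ h2 (hD.contract_toInner hwr hiff) h3 r₁ hr₁R
            (contract_toInner_adj_none.2 ⟨c', hr₁⟩)
      exfalso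
      by_cases hα : D.Adj (.inr p) (.inl a') <;> by_cases hβ : D.Adj (.inr q) (.inl b')
      -- Exactly three edges would cross the cut around the block.
      · have := hD.even_crossing S {(.inr p, .inl a'), (.inr q, .inl b'), (.inr r₁, .inl c')} ?_ ?_
        · rw [Finset.filter_true_of_mem] at this
          · rw [Finset.card_eq_three.2 ⟨_, _, _, ?_, ?_, ?_, rfl⟩] at this
            · revert this; decide
            · simp [hab']
            · simp [hca'.symm]
            · simp [hcb'.symm]
          · simp [hα, hβ, hr₁]
        · simp [S]
        · rintro _ ⟨w, rfl⟩ (v | v) hv h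
          · rcases hcr w v h with ⟨rfl, rfl⟩ | ⟨rfl, rfl⟩ | ⟨rfl, rfl⟩ <;> simp
          · exact absurd (hSr v) hv
      · refine hfin (w₀ := p) (v₀ := a') hca'.symm (by simp) hExa fun w v => ⟨fun h => ?_, ?_⟩
        · rcases hcr w v h with h' | ⟨rfl, rfl⟩ | h'
          · exact Or.inl h'
          · exact absurd h hβ
          · exact Or.inr h'
        · rintro (⟨rfl, rfl⟩ | ⟨rfl, rfl⟩)
          · exact hα
          · exact hr₁
      · refine hfin (w₀ := q) (v₀ := b') hcb'.symm (by simp) hExb fun w v => ⟨fun h => ?_, ?_⟩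
        · rcases hcr w v h with ⟨rfl, rfl⟩ | h' | h'
          · exact absurd h hα
          · exact Or.inl h'
          · exact Or.inr h'
        · rintro (⟨rfl, rfl⟩ | ⟨rfl, rfl⟩)
          · exact hβ
          · exact hr₁
      · refine hpS (v := c') (w := r₁) (fun w v h => ?_) hr₁
        rcases hcr w v h with ⟨rfl, rfl⟩ | ⟨rfl, rfl⟩ | h'
        · exact absurd h hα
        · exact absurd h hβ
        · exact h'
    · -- both edges at `c` enter the block
      exfalso
      have hcl : ∀ v, ¬ D.Adj (.inl c') (.inl v) := fun v h => by
        rcases (hce _).1 h with h | h <;> cases h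
      let S' : Set ({v // v ≠ x} ⊕ W) := insert (.inl c') S
      have hS'l : ∀ v, v ≠ c' → Sum.inl v ∉ S' := fun v h => by
        simp [S', S, h]
      have hout : ∀ y ∈ S', ∀ z, z ∉ S' → D.Adj y z →
          (y = .inr p ∧ z = .inl a') ∨ (y = .inr q ∧ z = .inl b') := by
        rintro y hy (v | v) hv h
        · rcases hy with rfl | ⟨w, rfl⟩
          · exact absurd h (hcl v)
          · rcases hlink w v h with ⟨rfl, rfl⟩ | ⟨rfl, rfl⟩ | ⟨-, rfl⟩
            · simp
            · simp
            · exact absurd (Or.inl rfl) hv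
        · exact absurd (Or.inr (hSr v)) hv
      -- The same cut argument as before, now for the block together with `c'`. The vertex `z` still
      -- lies outside, since `z ∉ T` and `c ∈ T`.
      have hα : D.Adj (.inr p) (.inl a') := by
        by_contra hα
        have hout' : ∀ y ∈ S', ∀ z, z ∉ S' → D.Adj y z → y = .inr q ∧ z = .inl b' := by
          intro y hy z hz h
          rcases hout y hy z hz h with ⟨rfl, rfl⟩ | h'
          · exact absurd h hα
          · exact h'
        have hβ := hD.not_adj_of_crossing (Or.inr (hSr q)) (hS'l b' hcb'.symm) hout'
        obtain ⟨u, hu⟩ := hcovW p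
        refine hD.false_of_closed (X := S') ?_ (Or.inr (hSr p)) hu
          (hS'l ⟨z, hzx⟩ (fun h => hzc (congrArg Subtype.val h))) hvz
        intro y w hyw hy
        by_contra hw
        obtain ⟨rfl, rfl⟩ := hout' y hy w hw hyw
        exact hβ hyw
      have hβ : D.Adj (.inr q) (.inl b') := by
        by_contra hβ
        refine hD.not_adj_of_crossing (Or.inr (hSr p)) (hS'l a' hca'.symm) ?_ hα
        intro y hy z hz h
        rcases hout y hy z hz h with h' | ⟨rfl, rfl⟩
        · exact h'
        · exact absurd h hβ
      -- contract the block together with `c`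
      let f : {v // v ≠ x} ⊕ W → V := fun y => if toOuter x y = c then x else toOuter x y
      have hfr : ∀ w, f (.inr w) = x := fun w => by simp [f, toOuter, hcx.symm]
      have hfc : f (.inl c') = x := by simp [f, toOuter, hc']
      have hfl : ∀ v : {v // v ≠ x}, v ≠ c' → f (.inl v) = v := fun v hv => by
        have : (v : V) ≠ c := fun h => hv (Subtype.ext h)
        simp [f, toOuter, this]
      have hfx : ∀ y, f y = x ↔ y ∈ S' := by
        rintro (v | w)
        · by_cases hv : v = c'
          · subst hv; simp [hfc, S']
          · rw [hfl v hv]; simp [v.2, S', S, hv]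
        · simp [hfr, S', S]
      have hfnc : ∀ y, f y ≠ c := by
        rintro (v | w)
        · by_cases hv : v = c'
          · subst hv; rw [hfc]; exact hcx.symm
          · rw [hfl v hv]; exact fun h => hv (Subtype.ext h)
        · rw [hfr]; exact hcx.symm
      have hxz : ∀ z, (contract f D).Adj x z ↔ z = a ∨ z = b := by
        intro z
        constructor
        · rintro ⟨hne, y, w, hy, rfl, hyw⟩
          rcases hout y ((hfx y).1 hy) w (fun h => hne ((hfx w).2 h).symm) hyw with
            ⟨rfl, rfl⟩ | ⟨rfl, rfl⟩
          · exact Or.inl (hfl a' hca'.symm)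
          · exact Or.inr (hfl b' hcb'.symm)
        · rintro (rfl | rfl)
          · exact ⟨hxa.ne, _, _, hfr p, hfl a' hca'.symm, hα⟩
          · exact ⟨hxb.ne, _, _, hfr q, hfl b' hcb'.symm, hβ⟩
      have hcyc : IsCyc (contract f D) := by
        refine hD.isCyc_contract ⟨x, a, (hxz a).2 (Or.inl rfl)⟩ fun u => ?_
        rcases eq_or_ne u x with rfl | hux
        · exact Or.inr ⟨a, b, hab, hxz⟩
        rcases eq_or_ne u c with rfl | huc
        · left
          rintro w ⟨-, y, z, hy, -⟩
          exact hfnc y hy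
        have huc' : (⟨u, hux⟩ : {v // v ≠ x}) ≠ c' := fun h => huc (congrArg Subtype.val h)
        have hfu := hfl _ huc'
        have hfeq : ∀ z z', z ∉ S' → f z = f z' → z = z' := by
          rintro (z | z) z' hz hzz
          · have hzc : z ≠ c' := fun h => hz (Or.inl (by rw [h]))
            rcases z' with z' | z'
            · by_cases hz' : z' = c'
              · subst hz'
                rw [hfl z hzc, hfc] at hzz
                exact absurd hzz z.2
              · rw [hfl z hzc, hfl z' hz'] at hzz
                exact congrArg Sum.inl (Subtype.ext hzz)
            · rw [hfl z hzc, hfr] at hzz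
              exact absurd hzz z.2
          · exact absurd (Or.inr (hSr z)) hz
        have huS : Sum.inl ⟨u, hux⟩ ∉ S' := hS'l _ huc'
        rw [show u = f (.inl ⟨u, hux⟩) from hfu.symm]
        refine hD.contract_deg (fun z hz => (hfeq _ _ huS hz.symm).symm) ?_
        intro z z' hz hz' hzz
        by_cases hzS : z ∈ S'
        · have hzS' : z' ∈ S' := (hfx z').1 (hzz ▸ (hfx z).2 hzS)
          have h1 := hout z hzS _ huS hz.symm
          have h2 := hout z' hzS' _ huS hz'.symm
          grind
        · exact hfeq z z' hzS hzz
      -- The contraction misses `c`, which is allowed because `c ∈ T`, so it has to equal `C`. But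
      -- `C` visits `c`.
      have hfin := hC.eq_of_isCyc _ ?_ hcyc ?_
      · obtain ⟨w, hw⟩ := hC.spanning c
        rw [← hfin] at hw
        obtain ⟨-, y, z, hy, -⟩ := hw
        exact hfnc y hy
      · have hEx : ∀ v, (contract f D).Adj x v → E.Adj x v := fun v hv => by
          rcases (hxz v).1 hv with rfl | rfl
          · exact hExa
          · exact hExb
        intro u v huv
        rcases eq_or_ne u x with rfl | hux
        · exact hEx v huv
        rcases eq_or_ne v x with rfl | hvx
        · exact (hEx u huv.symm).symm
        obtain ⟨-, y, z, rfl, rfl, hyz⟩ := huv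
        rcases y with y | y
        · rcases z with z | z
          · have hy : y ≠ c' := by rintro rfl; exact hux hfc
            have hz : z ≠ c' := by rintro rfl; exact hvx hfc
            rw [hfl y hy, hfl z hz]
            exact hle hyz
          · exact absurd (hfr z) hvx
        · exact absurd (hfr y) hux
      · intro v hvT
        rcases eq_or_ne v x with rfl | hvx
        · exact ⟨a, (hxz a).2 (Or.inl rfl)⟩
        have hvc : v ≠ c := fun h => hvT (h ▸ hc)
        have hvc' : (⟨v, hvx⟩ : {v // v ≠ x}) ≠ c' := fun h => hvc (congrArg Subtype.val h)
        obtain ⟨u, hu⟩ := hcovV v hvx (Or.inl hvT)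
        refine ⟨f u, ?_, _, u, hfl _ hvc', rfl, hu⟩
        intro hvu
        rcases u with u | u
        · by_cases huc : u = c'
          · subst huc; exact hcl _ hu.symm
          · rw [hfl u huc] at hvu
            exact hu.ne (congrArg Sum.inl (Subtype.ext hvu))
        · rw [hfr] at hvu; exact hvx hvu

end


/-! ### 3-connectedness under substitution. -/

/-- Cut form of the condition that no two vertices separate the graph. -/
def NoTwoCut {V : Type*} (G : SimpleGraph V) : Prop :=
  ∀ (y z : V) (X : Set V),
    (∀ u v, G.Adj u v → u ≠ y → u ≠ z → v ≠ y → v ≠ z → u ∈ X → v ∈ X) →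
    ∀ u v, u ≠ y → u ≠ z → v ≠ y → v ≠ z → u ∈ X → v ∈ X

section Connectivity

variable {V : Type*}

lemma IsKConnected.noTwoCut [Fintype V] {G : SimpleGraph V} (h : IsKConnected 3 G) :
    NoTwoCut G := by
  classical
  intro y z X hX u v huy huz hvy hvz hu
  have hmem : ∀ w, w ≠ y → w ≠ z → w ∈ ((({y, z} : Finset V) : Set V)ᶜ) := fun w h1 h2 => by
    simp [h1, h2]
  obtain ⟨p⟩ := (h.2 {y, z} (lt_of_le_of_lt Finset.card_le_two (by norm_num))).preconnected
    ⟨u, hmem u huy huz⟩ ⟨v, hmem v hvy hvz⟩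
  refine mem_of_walk (X := {w : ((({y, z} : Finset V) : Set V)ᶜ : Set V) | (w : V) ∈ X}) ?_ p hu
  rintro ⟨a, ha⟩ ⟨b, hb⟩ hab haX
  simp at ha hb
  exact hX a b hab ha.1 ha.2 hb.1 hb.2 haX

/-- Since `y = z` is allowed in `NoTwoCut`, sets of one vertex are covered directly; for the empty
set a further vertex is deleted that is neither of the two to be connected. -/
lemma NoTwoCut.isKConnected [Fintype V] {G : SimpleGraph V} (h : NoTwoCut G)
    (hcard : 3 < Fintype.card V) : IsKConnected 3 G := by
  classical
  refine ⟨hcard, fun S hS => ?_⟩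
  have key : ∀ X : Set V, (∀ u v, G.Adj u v → u ∉ S → v ∉ S → u ∈ X → v ∈ X) →
      ∀ u v, u ∉ S → v ∉ S → u ∈ X → v ∈ X := by
    intro X hX u v hu hv huX
    obtain h0 | h1 | h2 : S.card = 0 ∨ S.card = 1 ∨ S.card = 2 := by omega
    · obtain rfl := Finset.card_eq_zero.1 h0
      -- More than three vertices leave room for `y` outside `{u, v}`.
      obtain ⟨y, hy⟩ : ∃ y, y ∉ ({u, v} : Finset V) := by
        by_contra! hall
        have := Finset.card_le_card (fun y _ => hall y : Finset.univ ⊆ ({u, v} : Finset V))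
        have h2 : ({u, v} : Finset V).card ≤ 2 := Finset.card_le_two
        rw [Finset.card_univ] at this
        omega
      simp at hy
      exact h y y X (fun u v huv _ _ _ _ => hX u v huv (by simp) (by simp)) u v
        (Ne.symm hy.1) (Ne.symm hy.1) (Ne.symm hy.2) (Ne.symm hy.2) huX
    · obtain ⟨y, rfl⟩ := Finset.card_eq_one.1 h1
      simp at hu hv hX
      exact h y y X (fun u v huv a _ b _ => hX u v huv a b) u v hu hu hv hv huX
    · obtain ⟨y, z, -, rfl⟩ := Finset.card_eq_two.1 h2
      simp at hu hv hX
      exact h y z X (fun u v huv a a' b b' => hX u v huv a a' b b') u v hu.1 hu.2 hv.1 hv.2 huX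
  have hne : ((S : Set V)ᶜ).Nonempty := by
    by_contra hempty
    rw [Set.not_nonempty_iff_eq_empty, Set.compl_empty_iff] at hempty
    have : S = Finset.univ := by rw [← Finset.coe_eq_univ, hempty]
    rw [this, Finset.card_univ] at hS
    omega
  obtain ⟨w, hw⟩ := hne
  have : Nonempty ((S : Set V)ᶜ : Set V) := ⟨⟨w, hw⟩⟩
  refine ⟨fun u v => ?_⟩
  have := key {w | ∃ h : w ∈ (S : Set V)ᶜ, (G.induce (S : Set V)ᶜ).Reachable u ⟨w, h⟩}
    (by
      rintro a b hab ha hb ⟨ha', hr⟩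
      refine ⟨by simpa using hb, hr.trans (Adj.reachable ?_)⟩
      exact hab) u v u.2 v.2 ⟨u.2, Reachable.refl _⟩
  exact this.2

/-- The connectivity conditions on an inserted graph that keep the result 3-connected. -/
structure IsConnectedBlock {W : Type*} (B : SimpleGraph W) (p q : W) (R : Set W) : Prop where
  nonempty : R.Nonempty
  zero : ∀ X : Set W, (∀ u v, B.Adj u v → u ∈ X → v ∈ X) → ∀ u v, u ∈ X → v ∈ X
  one : ∀ (y : W) (X : Set W), (∀ u v, B.Adj u v → u ≠ y → v ≠ y → u ∈ X → v ∈ X) →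
    ∀ u, u ∈ X → u ≠ y →
      ((p ∈ X ∧ p ≠ y) ∧ (q ∈ X ∧ q ≠ y)) ∨ ((p ∈ X ∧ p ≠ y) ∧ ∃ r ∈ R, r ∈ X ∧ r ≠ y) ∨
        ((q ∈ X ∧ q ≠ y) ∧ ∃ r ∈ R, r ∈ X ∧ r ≠ y)
  two : ∀ (y z : W) (X : Set W),
    (∀ u v, B.Adj u v → u ≠ y → u ≠ z → v ≠ y → v ≠ z → u ∈ X → v ∈ X) →
    ∀ u, u ∈ X → u ≠ y → u ≠ z → ∃ w ∈ X, w ≠ y ∧ w ≠ z ∧ (w = p ∨ w = q ∨ w ∈ R)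

variable {W : Type*} {H : SimpleGraph V} {x a b c : V} {B : SimpleGraph W} {p q : W} {R : Set W}

/-- If both deleted vertices lie outside the block, the connected block behaves like `x`. If one or
both lie inside, the surviving outer vertices remain connected because `H` without `x` and one more
vertex is connected, and every remaining piece of the block is attached to a surviving outer vertex.
-/
lemma NoTwoCut.substitute (hH : NoTwoCut H) (hx : ∀ z, H.Adj x z ↔ z = a ∨ z = b ∨ z = c)
    (hab : a ≠ b) (hac : a ≠ c) (hbc : b ≠ c) (hB : IsConnectedBlock B p q R) :
    NoTwoCut (substitute H x a b c B p q R) := by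
  have hax : a ≠ x := ((hx a).2 (by simp)).ne'
  have hbx : b ≠ x := ((hx b).2 (by simp)).ne'
  have hcx : c ≠ x := ((hx c).2 (by simp)).ne'
  set G := UHC.substitute H x a b c B p q R with hG
  have hll : ∀ u v, G.Adj (.inl u) (.inl v) ↔ H.Adj u v := fun _ _ => Iff.rfl
  have hrr : ∀ u v, G.Adj (.inr u) (.inr v) ↔ B.Adj u v := fun _ _ => Iff.rfl
  have hrl : ∀ u w, G.Adj (.inr w) (.inl u) ↔
      (u.1 = a ∧ w = p) ∨ (u.1 = b ∧ w = q) ∨ (u.1 = c ∧ w ∈ R) := fun u w => Iff.rfl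
  have hpa : G.Adj (.inr p) (.inl ⟨a, hax⟩) := Or.inl ⟨rfl, rfl⟩
  have hqb : G.Adj (.inr q) (.inl ⟨b, hbx⟩) := Or.inr (Or.inl ⟨rfl, rfl⟩)
  have hrc : ∀ r ∈ R, G.Adj (.inr r) (.inl ⟨c, hcx⟩) := fun r hr => Or.inr (Or.inr ⟨rfl, hr⟩)
  -- deletions that meet the inserted graph
  have mixed : ∀ y z : {v // v ≠ x} ⊕ W,
      (∀ X : Set ({v // v ≠ x} ⊕ W),
        (∀ u v, G.Adj u v → u ≠ y → u ≠ z → v ≠ y → v ≠ z → u ∈ X → v ∈ X) →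
        (∀ u v, .inl u ≠ y → .inl u ≠ z → .inl v ≠ y → .inl v ≠ z → .inl u ∈ X → .inl v ∈ X) ∧
        ∀ w, .inr w ∈ X → .inr w ≠ y → .inr w ≠ z →
          ∃ u, .inl u ∈ X ∧ .inl u ≠ y ∧ .inl u ≠ z) →
      ∀ X : Set ({v // v ≠ x} ⊕ W),
        (∀ u v, G.Adj u v → u ≠ y → u ≠ z → v ≠ y → v ≠ z → u ∈ X → v ∈ X) →
        ∀ u v, u ≠ y → u ≠ z → v ≠ y → v ≠ z → u ∈ X → v ∈ X := by
    intro y z h X hX u v huy huz hvy hvz hu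
    by_contra hv
    obtain ⟨h1, h2⟩ := h X hX
    -- The complement of a closed set is closed too. Each side thus contains a surviving outer
    -- vertex, but all of these lie on the same side.
    obtain ⟨-, h4⟩ := h Xᶜ (fun u v huv a1 a2 a3 a4 hu hv =>
      hu (hX v u huv.symm a3 a4 a1 a2 hv))
    obtain ⟨u', hu', hu1, hu2⟩ : ∃ u', .inl u' ∈ X ∧ .inl u' ≠ y ∧ .inl u' ≠ z := by
      rcases u with u | u
      · exact ⟨u, hu, huy, huz⟩
      · exact h2 u hu huy huz
    obtain ⟨v', hv', hv1, hv2⟩ : ∃ u', .inl u' ∈ Xᶜ ∧ .inl u' ≠ y ∧ .inl u' ≠ z := by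
      rcases v with v | v
      · exact ⟨v, hv, hvy, hvz⟩
      · exact h4 v hv hvy hvz
    exact hv' (h1 u' v' hu1 hu2 hv1 hv2 hu')
  have lr : ∀ (y : {v // v ≠ x}) (z : W) (X : Set ({v // v ≠ x} ⊕ W)),
        (∀ u v, G.Adj u v → u ≠ .inl y → u ≠ .inr z → v ≠ .inl y → v ≠ .inr z → u ∈ X → v ∈ X) →
        ∀ u v, u ≠ .inl y → u ≠ .inr z → v ≠ .inl y → v ≠ .inr z → u ∈ X → v ∈ X := by
    intro y z
    refine mixed (.inl y) (.inr z) fun X hX => ⟨?_, ?_⟩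
    · intro u v hu _ hv _ huX
      -- The outer part is `H` with `x` and `y` deleted.
      have := hH x y {v | ∃ h : v ≠ x, Sum.inl ⟨v, h⟩ ∈ X} (by
        rintro u v huv hux huy hvx hvy ⟨h, hu⟩
        exact ⟨hvx, hX (.inl ⟨u, h⟩) (.inl ⟨v, hvx⟩) huv
          (fun h => huy (congrArg Subtype.val (Sum.inl_injective h))) (by simp)
          (fun h => hvy (congrArg Subtype.val (Sum.inl_injective h))) (by simp) hu⟩)
        u v u.2 (fun h => hu (congrArg Sum.inl (Subtype.ext h)))
        v.2 (fun h => hv (congrArg Sum.inl (Subtype.ext h))) ⟨u.2, huX⟩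
      exact this.2
    · intro w hw _ hwz
      have h1 := hB.one z (Sum.inr ⁻¹' X) (fun u v huv hu hv huX =>
        hX (.inr u) (.inr v) huv (by simp) (by simpa using hu) (by simp) (by simpa using hv) huX)
        w hw (by simpa using hwz)
      have hp : (.inr p ∈ X ∧ p ≠ z) → a ≠ y → .inl ⟨a, hax⟩ ∈ X := fun h h' =>
        hX _ _ hpa (by simp) (by simpa using h.2) (by simpa [Subtype.ext_iff] using h') (by simp)
          h.1
      have hq : (.inr q ∈ X ∧ q ≠ z) → b ≠ y → .inl ⟨b, hbx⟩ ∈ X := fun h h' =>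
        hX _ _ hqb (by simp) (by simpa using h.2) (by simpa [Subtype.ext_iff] using h') (by simp)
          h.1
      have hr : (∃ r ∈ R, .inr r ∈ X ∧ r ≠ z) → c ≠ y → .inl ⟨c, hcx⟩ ∈ X := by
        rintro ⟨r, hr, h⟩ h'
        exact hX _ _ (hrc r hr) (by simp) (by simpa using h.2)
          (by simpa [Subtype.ext_iff] using h') (by simp) h.1
      have hyl : ∀ (u : V) (hu : u ≠ x), u ≠ y →
          (Sum.inl ⟨u, hu⟩ : {v // v ≠ x} ⊕ W) ≠ .inl y := fun u hu h h' => h (by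
        simpa [Subtype.ext_iff] using h')
      -- The piece of the block is attached to two of `a`, `b`, `c`, and at most one of them is the
      -- deleted `y`.
      rcases h1 with ⟨h1, h2⟩ | ⟨h1, h2⟩ | ⟨h1, h2⟩
      · by_cases hay : a = y
        · have hby : b ≠ y := fun h => hab (hay.trans h.symm)
          exact ⟨_, hq h2 hby, hyl _ _ hby, by simp⟩
        · exact ⟨_, hp h1 hay, hyl _ _ hay, by simp⟩
      · by_cases hay : a = y
        · have hby : c ≠ y := fun h => hac (hay.trans h.symm)
          exact ⟨_, hr h2 hby, hyl _ _ hby, by simp⟩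
        · exact ⟨_, hp h1 hay, hyl _ _ hay, by simp⟩
      · by_cases hay : b = y
        · have hby : c ≠ y := fun h => hbc (hay.trans h.symm)
          exact ⟨_, hr h2 hby, hyl _ _ hby, by simp⟩
        · exact ⟨_, hq h1 hay, hyl _ _ hay, by simp⟩
  rintro (y | y) (z | z)
  · intro X hX u v huy huz hvy hvz hu
    have hun : ∀ w w', .inr w ∈ X → .inr w' ∈ X := fun w w' h =>
      hB.zero (Sum.inr ⁻¹' X) (fun u v huv hu => hX (.inr u) (.inr v) huv (by simp) (by simp)
        (by simp) (by simp) hu) w w' h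
    -- The block lies on one side of `X` as a whole, so `X` is the preimage of a set `Y` under
    -- `toOuter`.
    let Y : Set V := {v | (v = x ∧ .inr p ∈ X) ∨ ∃ h : v ≠ x, Sum.inl ⟨v, h⟩ ∈ X}
    have hY : ∀ v, v ∈ X ↔ toOuter x v ∈ Y := by
      rintro (⟨v, hv⟩ | v)
      · simp [Y, toOuter, hv]
      · simp only [Y, toOuter, Set.mem_ofPred_eq, true_and, ne_eq, not_true_eq_false,
          IsEmpty.exists_iff, or_false]
        exact ⟨hun _ _, hun _ _⟩
    have hout : ∀ v : {v // v ≠ x} ⊕ W, v ≠ .inl y → toOuter x v ≠ y := by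
      rintro (v | v) hv
      · exact fun h => hv (congrArg Sum.inl (Subtype.ext h))
      · exact fun h => y.2 h.symm
    have hout' : ∀ v : {v // v ≠ x} ⊕ W, v ≠ .inl z → toOuter x v ≠ z := by
      rintro (v | v) hv
      · exact fun h => hv (congrArg Sum.inl (Subtype.ext h))
      · exact fun h => z.2 h.symm
    rw [hY] at hu ⊢
    refine hH y z Y ?_ _ _ (hout u huy) (hout' u huz) (hout v hvy) (hout' v hvz) hu
    have hxlink : ∀ v, H.Adj x v → v ≠ y → v ≠ z → (x ∈ Y ↔ v ∈ Y) := by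
      intro v hv hvy hvz
      obtain ⟨hvx, w, hw⟩ : ∃ hvx : v ≠ x, ∃ w, G.Adj (.inr w) (.inl ⟨v, hvx⟩) := by
        rcases (hx v).1 hv with rfl | rfl | rfl
        · exact ⟨hax, p, hpa⟩
        · exact ⟨hbx, q, hqb⟩
        · obtain ⟨r, hr⟩ := hB.nonempty
          exact ⟨hcx, r, hrc r hr⟩
      have e1 := hY (.inr w)
      have e2 := hY (.inl ⟨v, hvx⟩)
      simp only [toOuter] at e1 e2
      rw [← e1, ← e2]
      have n1 : (Sum.inl ⟨v, hvx⟩ : {v // v ≠ x} ⊕ W) ≠ .inl y := by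
        simpa [Subtype.ext_iff] using hvy
      have n2 : (Sum.inl ⟨v, hvx⟩ : {v // v ≠ x} ⊕ W) ≠ .inl z := by
        simpa [Subtype.ext_iff] using hvz
      exact ⟨hX _ _ hw (by simp) (by simp) n1 n2, hX _ _ hw.symm n1 n2 (by simp) (by simp)⟩
    intro u' v' huv huy huz hvy hvz hu
    rcases eq_or_ne u' x with rfl | hux
    · exact (hxlink v' huv hvy hvz).1 hu
    rcases eq_or_ne v' x with rfl | hvx
    · exact (hxlink u' huv.symm huy huz).2 hu
    have e1 := hY (.inl ⟨u', hux⟩)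
    have e2 := hY (.inl ⟨v', hvx⟩)
    simp only [toOuter] at e1 e2
    rw [← e1] at hu
    rw [← e2]
    exact hX _ _ ((hll ⟨u', hux⟩ ⟨v', hvx⟩).2 huv) (by simpa [Subtype.ext_iff] using huy)
      (by simpa [Subtype.ext_iff] using huz) (by simpa [Subtype.ext_iff] using hvy)
      (by simpa [Subtype.ext_iff] using hvz) hu
  · exact lr y z
  · intro X hX u v huy huz hvy hvz hu
    exact lr z y X (fun u v huv a1 a2 a3 a4 => hX u v huv a2 a1 a4 a3) u v huz huy hvz hvy hu
  · refine mixed (.inr y) (.inr z) fun X hX => ⟨?_, ?_⟩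
    · intro u v _ _ _ _ huX
      have := hH x x {v | ∃ h : v ≠ x, Sum.inl ⟨v, h⟩ ∈ X} (by
        rintro u v huv hux _ hvx _ ⟨h, hu⟩
        exact ⟨hvx, hX (.inl ⟨u, h⟩) (.inl ⟨v, hvx⟩) huv (by simp) (by simp) (by simp) (by simp)
          hu⟩) u v u.2 u.2 v.2 v.2 ⟨u.2, huX⟩
      exact this.2
    · intro w hw hwy hwz
      obtain ⟨w', hw', h1, h2, h3⟩ := hB.two y z (Sum.inr ⁻¹' X) (fun u v huv a1 a2 a3 a4 huX =>
        hX (.inr u) (.inr v) huv (by simpa using a1) (by simpa using a2) (by simpa using a3)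
          (by simpa using a4) huX) w hw (by simpa using hwy) (by simpa using hwz)
      obtain ⟨u, hu⟩ : ∃ u, G.Adj (.inr w') (.inl u) := by
        rcases h3 with rfl | rfl | h3
        · exact ⟨_, hpa⟩
        · exact ⟨_, hqb⟩
        · exact ⟨_, hrc _ h3⟩
      exact ⟨u, hX _ _ hu (by simpa using h1) (by simpa using h2) (by simp) (by simp) hw',
        by simp, by simp⟩

end Connectivity


/-! ### Degrees after a substitution. -/

section Degrees

variable {V W : Type*} [Fintype V] [Fintype W]

open Classical in
/-- The number of vertices of the inserted graph whose degree after the insertion is `d`. -/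
noncomputable def blockDegree (B : SimpleGraph W) (p q : W) (R : Set W) (w : W) : ℕ :=
  B.degree w + (if w = p then 1 else 0) + (if w = q then 1 else 0) + (if w ∈ R then 1 else 0)

open Classical in
lemma degree_eq_ncard (G : SimpleGraph V) (v : V) : G.degree v = {w | G.Adj v w}.ncard := by
  rw [← card_neighborFinset_eq_degree, Set.ncard_eq_toFinset_card']
  congr 1

open Classical in
lemma degree_sum_eq (G : SimpleGraph (V ⊕ W)) (v : V ⊕ W) :
    G.degree v = {w | G.Adj v (.inl w)}.ncard + {w | G.Adj v (.inr w)}.ncard := by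
  rw [degree_eq_ncard, ← Set.ncard_image_of_injective {w | G.Adj v (.inl w)} Sum.inl_injective,
    ← Set.ncard_image_of_injective {w | G.Adj v (.inr w)} Sum.inr_injective,
    ← Set.ncard_union_eq]
  · congr 1
    ext (w | w) <;> simp
  · rw [Set.disjoint_left]
    rintro _ ⟨w, -, rfl⟩ ⟨w', -, h⟩
    cases h

variable {H : SimpleGraph V} {x a b c : V} {B : SimpleGraph W} {p q : W} {R : Set W}

open Classical in
lemma degree_substitute_inr (hax : a ≠ x) (hbx : b ≠ x) (hcx : c ≠ x) (hab : a ≠ b) (hac : a ≠ c)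
    (hbc : b ≠ c) (w : W) :
    (substitute H x a b c B p q R).degree (.inr w) = blockDegree B p q R w := by
  rw [degree_sum_eq, blockDegree, degree_eq_ncard B]
  have h1 : {u | (substitute H x a b c B p q R).Adj (.inr w) (.inl u)} =
      ((if w = p then {⟨a, hax⟩} else ∅) ∪ (if w = q then {⟨b, hbx⟩} else ∅)) ∪
        (if w ∈ R then {⟨c, hcx⟩} else ∅) := by
    ext u
    simp only [substitute, Set.mem_ofPred_eq, Set.mem_union]
    split_ifs <;> simp_all [Subtype.ext_iff, or_assoc]
  have h2 : {u | (substitute H x a b c B p q R).Adj (.inr w) (.inr u)} = {u | B.Adj w u} := rfl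
  rw [h1, h2, Set.ncard_union_eq, Set.ncard_union_eq, add_comm, add_assoc, add_assoc, add_assoc]
  · congr 1
    split_ifs <;> simp
  · split_ifs <;> simp [hab]
  · split_ifs <;> simp [hac, hbc, hac.symm, hbc.symm]

open Classical in
lemma degree_substitute_inl (hx : ∀ z, H.Adj x z ↔ z = a ∨ z = b ∨ z = c) (hab : a ≠ b)
    (hac : a ≠ c) (hbc : b ≠ c) (u : {v // v ≠ x}) :
    (substitute H x a b c B p q R).degree (.inl u) =
      if u.1 = c then H.degree c - 1 + R.ncard else H.degree u := by
  rw [degree_sum_eq]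
  have h1 : {v | (substitute H x a b c B p q R).Adj (.inl u) (.inl v)}.ncard =
      ({v | H.Adj u v} \ {x}).ncard := by
    rw [← Set.ncard_image_of_injective _ Subtype.val_injective]
    congr 1
    ext v
    simp [substitute, and_comm]
  have h2 : ∀ v, v = a ∨ v = b ∨ v = c → ({w | H.Adj v w} \ {x}).ncard = H.degree v - 1 := by
    intro v hv
    rw [degree_eq_ncard, Set.ncard_sdiff_singleton_of_mem]
    exact ((hx v).2 hv).symm
  have h3 : ∀ v, v = a ∨ v = b ∨ v = c → 0 < H.degree v := by
    intro v hv
    rw [← card_neighborFinset_eq_degree, Finset.card_pos]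
    exact ⟨x, by simpa using ((hx v).2 hv).symm⟩
  have h4 : {w | (substitute H x a b c B p q R).Adj (.inl u) (.inr w)} =
      {w | (u.1 = a ∧ w = p) ∨ (u.1 = b ∧ w = q) ∨ (u.1 = c ∧ w ∈ R)} := rfl
  rw [h1, h4]
  by_cases hc : u.1 = c
  · rw [if_pos hc]
    have : {w | (u.1 = a ∧ w = p) ∨ (u.1 = b ∧ w = q) ∨ (u.1 = c ∧ w ∈ R)} = R := by
      ext w; simp [hc, hac.symm, hbc.symm]
    rw [this, hc, h2 c (by simp)]
  rw [if_neg hc]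
  by_cases ha : u.1 = a
  · have : {w | (u.1 = a ∧ w = p) ∨ (u.1 = b ∧ w = q) ∨ (u.1 = c ∧ w ∈ R)} = {p} := by
      ext w; simp [ha, hab, hac]
    rw [this, ha, h2 a (by simp), Set.ncard_singleton]
    have := h3 a (by simp)
    omega
  by_cases hb : u.1 = b
  · have : {w | (u.1 = a ∧ w = p) ∨ (u.1 = b ∧ w = q) ∨ (u.1 = c ∧ w ∈ R)} = {q} := by
      ext w; simp [hb, hab.symm, hbc]
    rw [this, hb, h2 b (by simp), Set.ncard_singleton]
    have := h3 b (by simp)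
    omega
  · have : {w | (u.1 = a ∧ w = p) ∨ (u.1 = b ∧ w = q) ∨ (u.1 = c ∧ w ∈ R)} = ∅ := by
      ext w; simp [ha, hb, hc]
    rw [this, Set.ncard_empty, add_zero, degree_eq_ncard]
    congr 1
    refine Set.sdiff_singleton_eq_self fun h => ?_
    rcases (hx u).1 (Adj.symm h) with h | h | h
    · exact ha h
    · exact hb h
    · exact hc h

open Classical in
-- The only changes are that `x` disappears, `c` trades one edge for `|R|` edges, and the block
-- vertices appear. The losses are added on the left to avoid subtraction in `ℕ`.
lemma numDegree_substitute (hx : ∀ z, H.Adj x z ↔ z = a ∨ z = b ∨ z = c) (hab : a ≠ b)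
    (hac : a ≠ c) (hbc : b ≠ c) (d : ℕ) :
    numDegree (substitute H x a b c B p q R) d + (if H.degree x = d then 1 else 0) +
      (if H.degree c = d then 1 else 0) =
    numDegree H d + {w | blockDegree B p q R w = d}.ncard +
      (if H.degree c - 1 + R.ncard = d then 1 else 0) := by
  have hax : a ≠ x := ((hx a).2 (by simp)).ne'
  have hbx : b ≠ x := ((hx b).2 (by simp)).ne'
  have hcx : c ≠ x := ((hx c).2 (by simp)).ne'
  have hd := degree_substitute_inl (B := B) (p := p) (q := q) (R := R) hx hab hac hbc
  have hdr := degree_substitute_inr (H := H) (B := B) (p := p) (q := q) (R := R)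
    hax hbx hcx hab hac hbc
  generalize substitute H x a b c B p q R = G at hd hdr ⊢
  have h1 : numDegree G d = {u : {v // v ≠ x} | G.degree (.inl u) = d}.ncard +
      {w : W | G.degree (.inr w) = d}.ncard := by
    rw [← Set.ncard_image_of_injective {u : {v // v ≠ x} | G.degree (.inl u) = d} Sum.inl_injective,
      ← Set.ncard_image_of_injective {w : W | G.degree (.inr w) = d} Sum.inr_injective,
      ← Set.ncard_union_eq]
    · rw [numDegree, Set.ncard_eq_toFinset_card']
      congr 1
      ext (w | w) <;> simp
    · rw [Set.disjoint_left]
      rintro _ ⟨w, -, rfl⟩ ⟨w', -, h⟩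
      cases h
  have h2 : {w : W | G.degree (.inr w) = d} = {w | blockDegree B p q R w = d} := by
    ext w
    rw [Set.mem_ofPred_eq, Set.mem_ofPred_eq, hdr]
  have h3 : {u : {v // v ≠ x} | G.degree (.inl u) = d}.ncard =
      {v | v ≠ x ∧ v ≠ c ∧ H.degree v = d}.ncard +
        (if H.degree c - 1 + R.ncard = d then 1 else 0) := by
    rw [← Set.ncard_image_of_injective _ Subtype.val_injective]
    have : Subtype.val '' {u : {v // v ≠ x} | G.degree (.inl u) = d} =
        {v | v ≠ x ∧ v ≠ c ∧ H.degree v = d} ∪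
          (if H.degree c - 1 + R.ncard = d then {c} else ∅) := by
      ext v
      simp only [Set.mem_image, Set.mem_ofPred_eq, hd,
        Subtype.exists, exists_and_right, exists_eq_right, Set.mem_union]
      by_cases hv : v = c
      · subst hv
        by_cases h : H.degree v - 1 + R.ncard = d <;> simp [h, hcx]
      · by_cases hvx : v = x
        · subst hvx
          split_ifs <;> simp [Ne.symm hcx]
        · split_ifs <;> simp [hv, hvx]
    rw [this, Set.ncard_union_eq]
    · split_ifs <;> simp
    · split_ifs <;> simp
  have h4 : numDegree H d = {v | v ≠ x ∧ v ≠ c ∧ H.degree v = d}.ncard +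
      (if H.degree x = d then 1 else 0) + (if H.degree c = d then 1 else 0) := by
    have : {v | H.degree v = d} = ({v | v ≠ x ∧ v ≠ c ∧ H.degree v = d} ∪
        (if H.degree x = d then {x} else ∅)) ∪ (if H.degree c = d then {c} else ∅) := by
      ext v
      by_cases hv : v = c
      · subst hv
        by_cases h : H.degree v = d <;> by_cases h' : H.degree x = d <;> simp [h, h', hcx]
      · by_cases hvx : v = x
        · subst hvx
          by_cases h : H.degree v = d <;> by_cases h' : H.degree c = d <;> simp [h, h', hv]
        · split_ifs <;> simp [hv, hvx]
    rw [show numDegree H d = {v | H.degree v = d}.ncard by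
      rw [numDegree, Set.ncard_eq_toFinset_card']; congr 1; ext; simp, this, Set.ncard_union_eq,
      Set.ncard_union_eq]
    · congr 1
      · congr 1
        split_ifs <;> simp
      · split_ifs <;> simp
    · split_ifs <;> simp
    · split_ifs <;> simp [hcx]
  rw [h1, h2, h3, h4]
  omega

end Degrees


/-! ### Repeated substitution in a skeleton. -/

/-- A graph `H` with a hamiltonian cycle `C` and chords from each `x ∈ X` to `c x`, both of
degree 3, that is ready for substitutions at all vertices in `X`. Here `E` contains all edges
of `H` except possibly these chords. -/
structure IsSkeleton {V : Type} [Fintype V] (H E C : SimpleGraph V) (X : Finset V) (c : V → V) :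
    Prop where
  noTwoCut : NoTwoCut H
  three_lt : 3 < Fintype.card V
  le : E ≤ H
  adj_or : ∀ u v, H.Adj u v → E.Adj u v ∨ ∃ x ∈ X, (u = x ∧ v = c x) ∨ (v = x ∧ u = c x)
  unique : UniqueCyc E (c '' X) C
  notMem : ∀ x ∈ X, ∀ y ∈ X, c x ≠ y
  inj : ∀ x ∈ X, ∀ y ∈ X, c x = c y → x = y
  adj : ∀ x ∈ X, H.Adj x (c x)
  not_adj : ∀ x ∈ X, ¬ C.Adj x (c x)
  ncard_x : ∀ x ∈ X, {v | H.Adj x v}.ncard = 3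
  ncard_c : ∀ x ∈ X, {v | H.Adj (c x) v}.ncard = 3
  free : ∃ z, z ∉ X ∧ ∀ x ∈ X, c x ≠ z

/-- The two neighbours on the cycle and the chord end already account for degree 3. -/
lemma IsSkeleton.exists_neighbors {V : Type} [Fintype V] {H E C : SimpleGraph V} {X : Finset V}
    {c : V → V} (h : IsSkeleton H E C X c) {x : V} (hx : x ∈ X) :
    ∃ a b, a ≠ b ∧ a ≠ c x ∧ b ≠ c x ∧ (∀ z, C.Adj x z ↔ z = a ∨ z = b) ∧
      ∀ z, H.Adj x z ↔ z = a ∨ z = b ∨ z = c x := by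
  obtain ⟨w, hw⟩ := h.unique.spanning x
  obtain ⟨a, b, hab, hC⟩ := (h.unique.isCyc.deg x).resolve_left fun h0 => h0 w hw
  have ha : C.Adj x a := (hC a).2 (Or.inl rfl)
  have hb : C.Adj x b := (hC b).2 (Or.inr rfl)
  have hac : a ≠ c x := fun h' => h.not_adj x hx (h' ▸ ha)
  have hbc : b ≠ c x := fun h' => h.not_adj x hx (h' ▸ hb)
  refine ⟨a, b, hab, hac, hbc, hC, ?_⟩
  have hsub : ({a, b, c x} : Set V) ⊆ {v | H.Adj x v} := by
    rintro z (rfl | rfl | rfl)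
    · exact h.le (h.unique.le ha)
    · exact h.le (h.unique.le hb)
    · exact h.adj x hx
  have heq := Set.eq_of_subset_of_ncard_le hsub (by
    rw [h.ncard_x x hx, Set.ncard_eq_three.2 ⟨a, b, c x, hab, hac, hbc, rfl⟩]) (Set.toFinite _)
  intro z
  rw [← Set.mem_ofPred_eq (p := fun z => H.Adj x z), ← heq]
  simp

variable {W : Type} [Fintype W] {B : SimpleGraph W} {p q : W} {R : Set W}
  {CB : SimpleGraph (Option W)}

open Classical in
/-- Substituting a block at every vertex of `X`. -/
theorem IsSkeleton.exists_substitution (hpq : p ≠ q) (hB : UniqueCyc (addVertex B {p, q}) ∅ CB)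
    (hconn : IsConnectedBlock B p q R) (n : ℕ) :
    ∀ (V : Type) [Fintype V] (H E C : SimpleGraph V) (X : Finset V) (c : V → V), X.card = n →
    IsSkeleton H E C X c → ((∀ x ∈ X, E.Adj x (c x)) ∨ IsStrictBlock B p q R) →
    ∃ (V' : Type) (_ : Fintype V') (H' C' : SimpleGraph V'), NoTwoCut H' ∧
      3 < Fintype.card V' ∧ UniqueCyc H' ∅ C' ∧
      Fintype.card V' + n = Fintype.card V + n * Fintype.card W ∧
      ∀ d, numDegree H' d + 2 * n * (if d = 3 then 1 else 0) =
        numDegree H d + n * ({w | blockDegree B p q R w = d}.ncard +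
          if d = 2 + R.ncard then 1 else 0) := by
  induction n with
  | zero =>
    intro V _ H E C X c hX h _
    obtain rfl := Finset.card_eq_zero.1 hX
    -- Every substitution puts the edges that replace its chord into `E` as well, so `E` and `H`
    -- agree once no chord is left.
    have hHE : H = E := le_antisymm (fun u v huv => by
      rcases h.adj_or u v huv with h | ⟨x, hx, -⟩
      · exact h
      · simp at hx) h.le
    subst hHE
    have hu := h.unique
    rw [Finset.coe_empty, Set.image_empty] at hu
    exact ⟨V, _, H, C, h.noTwoCut, h.three_lt, hu, by simp, by simp⟩
  | succ n ih =>
    intro V _ H E C X c hX h hE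
    obtain ⟨x, hx⟩ : X.Nonempty := by rw [← Finset.card_pos]; omega
    obtain ⟨a, b, hab, hac, hbc, hCx, hHx⟩ := h.exists_neighbors hx
    have hcx : c x ≠ x := h.notMem x hx x hx
    have hxT : ∀ y ∈ X, y ∉ c '' X := by
      rintro y hy ⟨z, hz, h'⟩
      exact h.notMem z hz y hy h'
    have hcT : c x ∈ c '' (X : Set V) := ⟨x, hx, rfl⟩
    have hfree : ∃ z, z ∉ c '' (X : Set V) ∧ z ≠ x := by
      obtain ⟨z, hz, hz'⟩ := h.free
      refine ⟨z, ?_, fun h' => hz (h' ▸ hx)⟩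
      rintro ⟨y, hy, rfl⟩
      exact hz' y hy rfl
    have hunique := h.unique.substitute (c := c x) hCx hab (hxT x hx) hcT hac.symm hbc.symm hfree
      hpq hB (hE.imp_left fun h' => h' x hx)
    have hax : a ≠ x := ((hHx a).2 (by simp)).ne'
    have hbx : b ≠ x := ((hHx b).2 (by simp)).ne'
    let e : {v // v ≠ x} ↪ {v // v ≠ x} ⊕ W := ⟨Sum.inl, Sum.inl_injective⟩
    let X' : Finset ({v // v ≠ x} ⊕ W) := (X.subtype (· ≠ x)).map e
    -- The values `.inr p` and `.inr w` are placeholders: no vertex of `X'` lies in the block, and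
    -- no chord from `X` ends at `x`.
    let c' : {v // v ≠ x} ⊕ W → {v // v ≠ x} ⊕ W
      | .inl u => if hu : c u ≠ x then .inl ⟨c u, hu⟩ else .inr p
      | .inr w => .inr w
    have hmem : ∀ y, y ∈ X' ↔ ∃ u : V, ∃ hu : u ≠ x, u ∈ X ∧ y = .inl ⟨u, hu⟩ := by
      intro y
      simp only [X', Finset.mem_map, Finset.mem_subtype, e, Function.Embedding.coeFn_mk,
        Subtype.exists]
      exact ⟨fun ⟨u, hu, h1, h2⟩ => ⟨u, hu, h1, h2.symm⟩,
        fun ⟨u, hu, h1, h2⟩ => ⟨u, hu, h1, h2.symm⟩⟩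
    have hc' : ∀ (u : V) (hu : u ≠ x), u ∈ X →
        ∃ hcu : c u ≠ x, c' (.inl ⟨u, hu⟩) = .inl ⟨c u, hcu⟩ := fun u hu huX =>
      ⟨h.notMem u huX x hx, by simp [c', h.notMem u huX x hx]⟩
    have hcard : X'.card = n := by
      rw [Finset.card_map, Finset.card_subtype]
      have : X.filter (· ≠ x) = X.erase x := by ext; simp [and_comm]
      rw [this, Finset.card_erase_of_mem hx, hX]; rfl
    have hdx : H.degree x = 3 := by rw [degree_eq_ncard, h.ncard_x x hx]
    have hdc : H.degree (c x) = 3 := by rw [degree_eq_ncard, h.ncard_c x hx]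
    have hncard : ∀ (u : V) (hu : u ≠ x), u ≠ c x → {v | H.Adj u v}.ncard = 3 →
        {v | (substitute H x a b (c x) B p q R).Adj (.inl ⟨u, hu⟩) v}.ncard = 3 := by
      intro u hu huc h3
      rw [← degree_eq_ncard, degree_substitute_inl hHx hab hac hbc, if_neg huc, degree_eq_ncard, h3]
    have hnot : ∀ u ∈ X, u ≠ x → c u ≠ c x := fun u hu hux h' => hux (h.inj u hu x hx h')
    have hsk : IsSkeleton (substitute H x a b (c x) B p q R) (substitute E x a b (c x) B p q R)
        (substitute C x a b (c x) (CB.comap some) p q ∅) X' c' := by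
      refine ⟨h.noTwoCut.substitute hHx hab hac hbc hconn, ?_, ?_, ?_, ?_, ?_, ?_, ?_, ?_,
        ?_, ?_, ?_⟩
      · have h1 : Fintype.card {v // v ≠ x} = Fintype.card V - 1 := by
          rw [Fintype.card_subtype_compl, Fintype.card_subtype_eq]
        have h2 : 1 < Fintype.card W := Fintype.one_lt_card_iff.2 ⟨p, q, hpq⟩
        have h3 := h.three_lt
        rw [Fintype.card_sum]
        omega
      · rintro (u | u) (v | v) huv
        · exact h.le huv
        · exact huv
        · exact huv
        · exact huv
      · rintro (⟨u, hu⟩ | u) (⟨v, hv⟩ | v) huv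
        · rcases h.adj_or u v huv with h' | ⟨y, hy, ⟨rfl, rfl⟩ | ⟨rfl, rfl⟩⟩
          · exact Or.inl h'
          · obtain ⟨hcu, hcu'⟩ := hc' u hu hy
            exact Or.inr ⟨.inl ⟨u, hu⟩, (hmem _).2 ⟨u, hu, hy, rfl⟩, Or.inl ⟨rfl, hcu'.symm⟩⟩
          · obtain ⟨hcu, hcu'⟩ := hc' v hv hy
            exact Or.inr ⟨.inl ⟨v, hv⟩, (hmem _).2 ⟨v, hv, hy, rfl⟩, Or.inr ⟨rfl, hcu'.symm⟩⟩
        · exact Or.inl huv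
        · exact Or.inl huv
        · exact Or.inl huv
      · convert hunique using 1
        ext y
        simp only [Set.mem_image, Finset.mem_coe, Set.mem_ofPred_eq]
        constructor
        · rintro ⟨y, hy, rfl⟩
          obtain ⟨u, hu, huX, rfl⟩ := (hmem y).1 hy
          obtain ⟨hcu, hcu'⟩ := hc' u hu huX
          exact ⟨⟨c u, hcu⟩, ⟨u, huX, rfl⟩, hnot u huX hu, hcu'⟩
        · rintro ⟨⟨_, hv⟩, ⟨u, huX, rfl⟩, hne, rfl⟩
          have hu : u ≠ x := fun h' => hne (congrArg c h')
          obtain ⟨hcu, hcu'⟩ := hc' u hu huX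
          exact ⟨.inl ⟨u, hu⟩, (hmem _).2 ⟨u, hu, huX, rfl⟩, hcu'⟩
      · intro y hy z hz
        obtain ⟨u, hu, huX, rfl⟩ := (hmem y).1 hy
        obtain ⟨v, hv, hvX, rfl⟩ := (hmem z).1 hz
        obtain ⟨hcu, hcu'⟩ := hc' u hu huX
        rw [hcu']
        simpa [Subtype.ext_iff] using h.notMem u huX v hvX
      · intro y hy z hz
        obtain ⟨u, hu, huX, rfl⟩ := (hmem y).1 hy
        obtain ⟨v, hv, hvX, rfl⟩ := (hmem z).1 hz
        obtain ⟨hcu, hcu'⟩ := hc' u hu huX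
        obtain ⟨hcv, hcv'⟩ := hc' v hv hvX
        rw [hcu', hcv']
        simpa [Subtype.ext_iff] using h.inj u huX v hvX
      · intro y hy
        obtain ⟨u, hu, huX, rfl⟩ := (hmem y).1 hy
        obtain ⟨hcu, hcu'⟩ := hc' u hu huX
        rw [hcu']
        exact h.adj u huX
      · intro y hy
        obtain ⟨u, hu, huX, rfl⟩ := (hmem y).1 hy
        obtain ⟨hcu, hcu'⟩ := hc' u hu huX
        rw [hcu']
        exact h.not_adj u huX
      · intro y hy
        obtain ⟨u, hu, huX, rfl⟩ := (hmem y).1 hy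
        exact hncard u hu (fun h' => h.notMem x hx u huX h'.symm) (h.ncard_x u huX)
      · intro y hy
        obtain ⟨u, hu, huX, rfl⟩ := (hmem y).1 hy
        obtain ⟨hcu, hcu'⟩ := hc' u hu huX
        rw [hcu']
        exact hncard _ hcu (hnot u huX hu) (h.ncard_c u huX)
      -- Any block vertex will do, since the remaining chords live outside the block.
      · refine ⟨.inr p, fun h' => ?_, fun y hy => ?_⟩
        · obtain ⟨u, hu, -, h'⟩ := (hmem _).1 h'
          cases h'
        · obtain ⟨u, hu, huX, rfl⟩ := (hmem y).1 hy
          obtain ⟨hcu, hcu'⟩ := hc' u hu huX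
          rw [hcu']
          simp
    obtain ⟨V', _, H', C', h1, h2, h3, h4, h5⟩ := ih _ _ _ _ X' c' hcard hsk (by
      refine hE.imp_left fun hE y hy => ?_
      obtain ⟨u, hu, huX, rfl⟩ := (hmem y).1 hy
      obtain ⟨hcu, hcu'⟩ := hc' u hu huX
      rw [hcu']
      exact hE u huX)
    refine ⟨V', _, H', C', h1, h2, h3, ?_, fun d => ?_⟩
    · have h6 : Fintype.card {v // v ≠ x} = Fintype.card V - 1 := by
        rw [Fintype.card_subtype_compl, Fintype.card_subtype_eq]
      have h7 := h.three_lt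
      rw [Fintype.card_sum, h6] at h4
      rw [add_mul, one_mul]
      omega
    · have h6 := h5 d
      have h7 := numDegree_substitute (B := B) (p := p) (q := q) (R := R) hHx hab hac hbc d
      rw [hdx, hdc] at h7
      have e1 : (if 3 = d then 1 else 0) = (if d = 3 then 1 else 0) := by simp only [eq_comm]
      have e2 : (if 3 - 1 + R.ncard = d then 1 else 0) = (if d = 2 + R.ncard then 1 else 0) := by
        simp only [eq_comm (a := d)]
      rw [e1, e2] at h7
      generalize (if d = 3 then 1 else 0) = i at *
      generalize (if d = 2 + R.ncard then 1 else 0) = j at *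
      rw [show 2 * (n + 1) * i = 2 * n * i + i + i by ring, add_mul, one_mul]
      omega


/-! ### Invariance under relabelling. -/

section Transport

variable {V A : Type*}

lemma IsCyc.comap {C : SimpleGraph V} (hC : IsCyc C) (e : A ≃ V) : IsCyc (C.comap e) where
  exists_adj := by
    obtain ⟨v, w, h⟩ := hC.exists_adj
    exact ⟨e.symm v, e.symm w, by simpa using h⟩
  deg v := by
    rcases hC.deg (e v) with h0 | ⟨a, b, hab, h⟩
    · exact Or.inl fun w => h0 (e w)
    · refine Or.inr ⟨e.symm a, e.symm b, fun h' => hab (e.symm.injective h'), fun z => ?_⟩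
      rw [comap_adj, h, e.eq_symm_apply, e.eq_symm_apply]
  closed X hX := by
    rintro ⟨v, w, hv, hvw⟩ v' w' hvw'
    have := hC.closed (e.symm ⁻¹' X)
      (fun a b hab ha => hX (e.symm a) (e.symm b) (by simpa using hab) ha)
      ⟨e v, e w, by simpa using hv, hvw⟩ (e v') (e w') hvw'
    simpa using this

lemma UniqueCyc.comap {E C : SimpleGraph V} {T : Set V} (h : UniqueCyc E T C) (e : A ≃ V) :
    UniqueCyc (E.comap e) (e ⁻¹' T) (C.comap e) where
  le _ _ hvw := h.le hvw
  isCyc := h.isCyc.comap e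
  spanning v := by
    obtain ⟨w, hw⟩ := h.spanning (e v)
    exact ⟨e.symm w, by simpa using hw⟩
  eq_of_isCyc D hD hcyc hcov := by
    have := h.eq_of_isCyc (D.comap e.symm) (fun v w hvw => by simpa using hD hvw)
      (hcyc.comap e.symm) (fun v hv => by
        obtain ⟨w, hw⟩ := hcov (e.symm v) (by simpa using hv)
        exact ⟨e w, by simpa using hw⟩)
    rw [← this]
    ext v w
    simp

lemma UniqueCyc.mono {E E' C : SimpleGraph V} {T : Set V} (h : UniqueCyc E T C) (hC : C ≤ E')
    (hE : E' ≤ E) : UniqueCyc E' T C :=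
  ⟨hC, h.isCyc, h.spanning, fun D hD => h.eq_of_isCyc D (hD.trans hE)⟩

lemma NoTwoCut.comap {G : SimpleGraph V} (h : NoTwoCut G) (e : A ≃ V) : NoTwoCut (G.comap e) := by
  intro y z X hX u v huy huz hvy hvz hu
  have := h (e y) (e z) (e.symm ⁻¹' X) (fun a b hab h1 h2 h3 h4 ha =>
    hX (e.symm a) (e.symm b) (by simpa using hab) (by simpa [e.symm_apply_eq] using h1)
      (by simpa [e.symm_apply_eq] using h2) (by simpa [e.symm_apply_eq] using h3)
      (by simpa [e.symm_apply_eq] using h4) ha) (e u) (e v) (by simpa using huy)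
      (by simpa using huz) (by simpa using hvy) (by simpa using hvz) (by simpa using hu)
  simpa using this

lemma numDegree_eq_ncard [Fintype V] (G : SimpleGraph V) (d : ℕ) :
    numDegree G d = {v | {w | G.Adj v w}.ncard = d}.ncard := by
  classical
  rw [numDegree, Set.ncard_eq_toFinset_card']
  congr 1
  ext v
  simp [degree_eq_ncard]

lemma numDegree_comap [Fintype V] [Fintype A] (G : SimpleGraph V) (e : A ≃ V) (d : ℕ) :
    numDegree (G.comap e) d = numDegree G d := by
  have key : ∀ v, {w | (G.comap e).Adj v w}.ncard = {w | G.Adj (e v) w}.ncard := fun v => by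
    rw [← Set.ncard_image_of_injective _ e.injective]
    congr 1
    ext w
    simp
  rw [numDegree_eq_ncard, numDegree_eq_ncard]
  simp only [key]
  rw [← Set.ncard_image_of_injective {v | {w | G.Adj (e v) w}.ncard = d} e.injective]
  congr 1
  ext v
  exact ⟨by rintro ⟨a, ha, rfl⟩; exact ha, fun h => ⟨e.symm v, by simpa using h, by simp⟩⟩

/-- The degree set in terms of the numbers of vertices of each degree. -/
lemma degreeSet_eq [Fintype V] (G : SimpleGraph V) {M : Finset ℕ}
    (h : ∀ d, numDegree G d ≠ 0 ↔ d ∈ M) : degreeSet G = M := by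
  ext d
  rw [← h, degreeSet, numDegree, Finset.card_ne_zero]
  simp [Finset.Nonempty]

end Transport

/-! ### Strict blocks from uniquely hamiltonian graphs. -/

section VertexDeleted

variable {V : Type} [Fintype V] {H C : SimpleGraph V}

open Classical in
/-- Deleting a vertex `y` of a uniquely hamiltonian 3-connected graph gives a block. -/
lemma exists_block_of_uniqueCyc (hH : NoTwoCut H) (hC : UniqueCyc H ∅ C) {y : V} {e : ℕ}
    (he : {w | H.Adj y w}.ncard = e) (he3 : 3 ≤ e) :
    ∃ (B : SimpleGraph {v // v ≠ y}) (p q : {v // v ≠ y}) (R : Set {v // v ≠ y})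
      (CB : SimpleGraph (Option {v // v ≠ y})), p ≠ q ∧ UniqueCyc (addVertex B {p, q}) ∅ CB ∧
        IsConnectedBlock B p q R ∧ IsStrictBlock B p q R ∧ R.ncard + 2 = e ∧
        ∀ d, {w | blockDegree B p q R w = d}.ncard + (if e = d then 1 else 0) = numDegree H d := by
  classical
  obtain ⟨w, hw⟩ := hC.spanning y
  obtain ⟨p, q, hpq, hCy⟩ := (hC.isCyc.deg y).resolve_left fun h0 => h0 w hw
  have hp : C.Adj y p := (hCy p).2 (Or.inl rfl)
  have hq : C.Adj y q := (hCy q).2 (Or.inr rfl)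
  let p' : {v // v ≠ y} := ⟨p, hp.ne'⟩
  let q' : {v // v ≠ y} := ⟨q, hq.ne'⟩
  let B : SimpleGraph {v // v ≠ y} := H.comap Subtype.val
  let R : Set {v // v ≠ y} := {w | H.Adj y w ∧ w.1 ≠ p ∧ w.1 ≠ q}
  let f : Option {v // v ≠ y} ≃ V :=
    { toFun := fun o => o.elim y Subtype.val
      invFun := fun v => if h : v = y then none else some ⟨v, h⟩
      left_inv := by
        rintro (_ | ⟨v, hv⟩)
        · simp
        · simp [hv]
      right_inv := fun v => by
        by_cases h : v = y
        · simp [h]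
        · simp [h] }
  have hfn : f none = y := rfl
  have hfs : ∀ v, f (some v) = v := fun v => rfl
  -- Adding `none` with neighbourhood `{p', q'} ∪ R` restores the deleted vertex `y`, so cycles
  -- there are cycles of `H`.
  have hle : addVertex B ({p', q'} ∪ R) ≤ H.comap f := by
    have hn : ∀ w, w ∈ ({p', q'} ∪ R : Set _) → H.Adj y w := by
      rintro w ((rfl | rfl) | hw)
      · exact hC.le hp
      · exact hC.le hq
      · exact hw.1
    rintro (_ | u) (_ | v) huv
    · exact absurd rfl huv.ne
    · exact hn v huv
    · exact (hn u huv).symm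
    · exact huv
  have hu := hC.comap f
  rw [Set.preimage_empty] at hu
  have hpq' : p' ≠ q' := fun h => hpq (congrArg Subtype.val h)
  have hpR : p' ∉ R := fun h => h.2.1 rfl
  have hqR : q' ∉ R := fun h => h.2.2 rfl
  have hN : {w | H.Adj y w} = {p, q} ∪ Subtype.val '' R := by
    ext w
    simp only [Set.mem_ofPred_eq, Set.mem_union, Set.mem_insert_iff, Set.mem_singleton_iff,
      Set.mem_image, R]
    constructor
    · intro hw
      by_cases h1 : w = p
      · exact Or.inl (Or.inl h1)
      by_cases h2 : w = q
      · exact Or.inl (Or.inr h2)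
      · exact Or.inr ⟨⟨w, hw.ne'⟩, ⟨hw, h1, h2⟩, rfl⟩
    · rintro ((rfl | rfl) | ⟨w, h, rfl⟩)
      · exact hC.le hp
      · exact hC.le hq
      · exact h.1
  have hRe : R.ncard + 2 = e := by
    rw [← he, hN, Set.ncard_union_eq, Set.ncard_pair hpq,
      Set.ncard_image_of_injective _ Subtype.val_injective, add_comm]
    rw [Set.disjoint_left]
    rintro v (rfl | rfl) ⟨w, hw, hw'⟩
    · exact hw.2.1 hw'
    · exact hw.2.2 hw'
  obtain ⟨r, hr⟩ : R.Nonempty := Set.nonempty_of_ncard_ne_zero (by omega)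
  have hrp : r ≠ p' := fun h => hpR (h ▸ hr)
  have hrq : r ≠ q' := fun h => hqR (h ▸ hr)
  refine ⟨B, p', q', R, C.comap f, hpq', ?_, ?_, ⟨hpR, hqR, ?_⟩, hRe, ?_⟩
  -- Dropping the edges from `none` to `R` keeps the cycle `C`, which uses only `p` and `q` at `y`.
  · refine hu.mono ?_ ((addVertex_mono le_rfl Set.subset_union_left).trans hle)
    have hn : ∀ w : {v // v ≠ y}, C.Adj y w → w ∈ ({p', q'} : Set _) := fun w hw => by
      rcases (hCy w).1 hw with h | h
      · exact Or.inl (Subtype.ext h)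
      · exact Or.inr (Subtype.ext h)
    rintro (_ | u) (_ | v) huv
    · exact absurd rfl huv.ne
    · exact hn v huv
    · exact hn u (Adj.symm huv)
    · exact hC.le huv
  -- As `H` has no 2-cut, `B` stays connected after any single deletion; hence two of `p'`, `q'`,
  -- `r` survive in the same piece.
  · have key : ∀ (z : {v // v ≠ y}) (X : Set {v // v ≠ y}),
        (∀ u v, B.Adj u v → u ≠ z → v ≠ z → u ∈ X → v ∈ X) →
        ∀ u v, u ≠ z → v ≠ z → u ∈ X → v ∈ X := by
      intro z X hX u v huz hvz huX
      have := hH z y (Subtype.val '' X) (by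
        rintro u v huv huz hua hvz hva ⟨u, hu, rfl⟩
        exact ⟨⟨v, hva⟩, hX u ⟨v, hva⟩ huv (fun h => huz (by rw [h]))
          (fun h => hvz (by rw [← h])) hu, rfl⟩)
        u v (fun h => huz (Subtype.ext h)) u.2 (fun h => hvz (Subtype.ext h)) v.2 ⟨u, huX, rfl⟩
      obtain ⟨v', hv', h⟩ := this
      rwa [Subtype.ext h] at hv'
    refine ⟨⟨r, hr⟩, ?_, ?_, ?_⟩
    · intro X hX u v hu
      have := hH y y (Subtype.val '' X) (by
        rintro u v huv huz hua hvz hva ⟨u, hu, rfl⟩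
        exact ⟨⟨v, hvz⟩, hX u ⟨v, hvz⟩ huv hu, rfl⟩) u v u.2 u.2 v.2 v.2 ⟨u, hu, rfl⟩
      obtain ⟨v', hv', h⟩ := this
      rwa [Subtype.ext h] at hv'
    · intro z X hX u hu huz
      have h1 : ∀ v, v ≠ z → v ∈ X := fun v hv =>
        key z X hX u v huz hv hu
      by_cases hpz : p' = z
      · subst hpz
        exact Or.inr (Or.inr ⟨⟨h1 _ hpq'.symm, hpq'.symm⟩, r, hr, h1 _ hrp, hrp⟩)
      by_cases hqz : q' = z
      · subst hqz
        exact Or.inr (Or.inl ⟨⟨h1 _ hpq', hpq'⟩, r, hr, h1 _ hrq, hrq⟩)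
      · exact Or.inl ⟨⟨h1 _ hpz, hpz⟩, ⟨h1 _ hqz, hqz⟩⟩
    · intro z z' X hX u hu huz huz'
      by_contra! hno
      -- A piece that avoids `p'`, `q'` and `R` has no neighbour at `y`, so `{z, z'}` would separate
      -- it from `y` in `H`.
      have hXy : ∀ w ∈ X, w ≠ z → w ≠ z' → ¬ H.Adj w y := fun w hw h1 h2 h3 => by
        obtain ⟨h4, h5, h6⟩ := hno w hw h1 h2
        exact h6 ⟨h3.symm, fun h => h4 (Subtype.ext h), fun h => h5 (Subtype.ext h)⟩
      have := hH z z' (Subtype.val '' X) (by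
        rintro u v huv huz hua hvz hva ⟨u, hu, rfl⟩
        have huz1 : u ≠ z := fun h => huz (by rw [h])
        have huz2 : u ≠ z' := fun h => hua (by rw [h])
        have hvy : v ≠ y := by
          rintro rfl
          exact hXy u hu huz1 huz2 huv
        exact ⟨⟨v, hvy⟩, hX u ⟨v, hvy⟩ huv huz1 huz2 (fun h => hvz (by rw [← h]))
          (fun h => hva (by rw [← h])) hu, rfl⟩) u y (fun h => huz (Subtype.ext h))
          (fun h => huz' (Subtype.ext h)) z.2.symm z'.2.symm ⟨u, hu, rfl⟩
      obtain ⟨v', -, h⟩ := this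
      exact v'.2 h
  · intro D hD hcyc hsp r hr hDr
    have := hu.eq_of_isCyc D (hD.trans hle) hcyc (fun v _ => hsp v)
    rw [this] at hDr
    rcases (hCy r).1 hDr with h | h
    · exact hr.2.1 h
    · exact hr.2.2 h
  · intro d
    have hdeg : ∀ w, blockDegree B p' q' R w = {v | H.Adj w v}.ncard := by
      intro w
      have h1 : {v | H.Adj w v} = Subtype.val '' {v | B.Adj w v} ∪
          (if H.Adj w y then {y} else ∅) := by
        ext v
        by_cases hv : v = y
        · subst hv
          by_cases h : H.Adj w v <;> simp [h]
        · by_cases h : H.Adj w y <;> simp [h, hv, B]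
      have h2 : blockDegree B p' q' R w =
          {v | B.Adj w v}.ncard + (if H.Adj w y then 1 else 0) := by
        rw [blockDegree, degree_eq_ncard]
        by_cases hwp : w = p'
        · subst hwp
          simp [hpq', hpR, (hC.le hp).symm, p']
        by_cases hwq : w = q'
        · subst hwq
          simp [hpq'.symm, hqR, (hC.le hq).symm, q']
        · have : w ∈ R ↔ H.Adj w y := by
            simp only [R, Set.mem_ofPred_eq, H.adj_comm]
            exact ⟨fun h => h.1, fun h => ⟨h, fun h' => hwp (Subtype.ext h'),
              fun h' => hwq (Subtype.ext h')⟩⟩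
          simp [hwp, hwq, this]
      rw [h2, h1, Set.ncard_union_eq, Set.ncard_image_of_injective _ Subtype.val_injective]
      · congr 1
        split_ifs <;> simp
      · split_ifs <;> simp
    simp only [hdeg]
    rw [numDegree_eq_ncard, ← Set.ncard_image_of_injective _ Subtype.val_injective]
    have h3 : {v | {w | H.Adj v w}.ncard = d} =
        (Subtype.val '' {w : {v // v ≠ y} | {v | H.Adj w v}.ncard = d}) ∪
          (if e = d then {y} else ∅) := by
      ext v
      by_cases hv : v = y
      · subst hv
        by_cases h : e = d <;> simp [h, he]
      · by_cases h : e = d <;> simp [h, hv]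
    rw [h3, Set.ncard_union_eq]
    · congr 1
      split_ifs <;> simp
    · split_ifs <;> simp

end VertexDeleted

/-! ### Seeds as blocks. -/

section Seed

variable {n e : ℕ} {G : SimpleGraph (Fin n)} {s t : Fin n}

open Classical in
-- Take `p = s`, `q = t`, and `R` the neighbourhood of `v` in `W(G)`. The vertex `t` of degree 2
-- gains two edges, being both `q` and an element of `R`; all vertices of degree 3 gain one edge.
-- Thus all degrees become 4, while `R` has `1 + (e - 3)` elements.
lemma IsSeed.isBlock (h : IsSeed e G s t) :
    ∃ (R : Set (Fin n)) (CB : SimpleGraph (Option (Fin n))), s ≠ t ∧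
      UniqueCyc (addVertex G {s, t}) ∅ CB ∧ IsConnectedBlock G s t R ∧ R.ncard + 2 = e ∧
      ∀ w, blockDegree G s t R w = 4 := by
  have hdt : G.degree t = 2 := (h.degree_eq_two_iff t).2 rfl
  have hst : s ≠ t := by
    rintro rfl
    have := h.degree_s
    omega
  obtain ⟨CB, hCB⟩ := HasUniqueHamiltonianPath.exists_uniqueCyc hst (by
    convert h.uniquePath)
  let R : Set (Fin n) := {w | w = t ∨ (w ≠ s ∧ G.degree w = 3)}
  have htR : t ∈ R := Or.inl rfl
  have hsR : s ∉ R := by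
    rintro (h | h)
    · exact hst h
    · exact h.1 rfl
  have hK := h.threeConnected.noTwoCut
  have hcard := h.threeConnected.1
  have hseed : seedPlugin G s t = addVertex G R := rfl
  rw [hseed] at hK
  -- In the 3-connected graph of the seed condition, `some none` is `v` and `none` is the vertex
  -- joined to `v`, `s` and `t`. A part `X` of `G` whose edges to these two vertices are blocked, or
  -- lead to deleted vertices, is closed there.
  have hlift : ∀ (X : Set (Fin n)) (y z : Option (Option (Fin n))),
      (∀ u v, G.Adj u v → some (some u) ≠ y → some (some u) ≠ z → some (some v) ≠ y →
        some (some v) ≠ z → u ∈ X → v ∈ X) →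
      (none = y ∨ none = z ∨
        ∀ u ∈ X, some (some u) ≠ y → some (some u) ≠ z → u ≠ s ∧ u ≠ t) →
      (some none = y ∨ some none = z ∨
        ∀ u ∈ X, some (some u) ≠ y → some (some u) ≠ z → u ∉ R) →
      ∀ u ∈ X, some (some u) ≠ y → some (some u) ≠ z → ∀ v, v ≠ y → v ≠ z →
        ∃ w ∈ X, v = some (some w) := by
    intro X y z hX h1 h2 u hu huy huz v hvy hvz
    refine hK y z {v | ∃ w ∈ X, v = some (some w)} ?_ (some (some u)) v huy huz hvy hvz
      ⟨u, hu, rfl⟩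
    rintro _ v huv huy huz hvy hvz ⟨u, hu, rfl⟩
    rcases v with _ | _ | v
    · rcases h1 with h1 | h1 | h1
      · exact absurd h1 hvy
      · exact absurd h1 hvz
      · obtain ⟨a, b⟩ := h1 u hu huy huz
        rcases huv with h | h | h
        · cases h
        · exact absurd (Option.some_injective _ h) a
        · exact absurd (Option.some_injective _ h) b
    · rcases h2 with h2 | h2 | h2
      · exact absurd h2 hvy
      · exact absurd h2 hvz
      · exact absurd huv (h2 u hu huy huz)
    · exact ⟨v, hX u v huv huy huz hvy hvz hu, rfl⟩
  refine ⟨R, CB, hst, hCB, ⟨⟨t, htR⟩, ?_, ?_, ?_⟩, ?_, ?_⟩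
  · intro X hX u v hu
    obtain ⟨w, hw, h⟩ := hlift X none (some none) (fun u v huv _ _ _ _ => hX u v huv)
      (Or.inl rfl) (Or.inr (Or.inl rfl)) u hu (by simp) (by simp) (some (some v)) (by simp)
      (by simp)
    simp at h
    exact h ▸ hw
  · intro y X hX u hu huy
    -- The vertex `t` alone supplies two attachments, one as `q` and one as an element of `R`.
    by_cases hQ : t ∈ X ∧ t ≠ y
    · exact Or.inr (Or.inr ⟨hQ, t, htR, hQ⟩)
    refine Or.inr (Or.inl ⟨?_, ?_⟩)
    -- Without `s`, deleting `y` and `v` would separate `X` from `none`; in the other branch,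
    -- without an element of `R`, deleting `y` and `none` would separate `X` from `v`.
    · by_contra hP
      obtain ⟨w, hw, h⟩ := hlift X (some (some y)) (some none)
        (fun u v huv a _ b _ => hX u v huv (by simpa using a) (by simpa using b))
        (Or.inr (Or.inr fun u hu huy _ => ⟨fun h => hP (h ▸ ⟨hu, by simpa using huy⟩),
          fun h => hQ (h ▸ ⟨hu, by simpa using huy⟩)⟩)) (Or.inr (Or.inl rfl)) u hu
        (by simpa using huy) (by simp) none (by simp) (by simp)
      cases h
    · by_contra! hP
      obtain ⟨w, hw, h⟩ := hlift X (some (some y)) none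
        (fun u v huv a _ b _ => hX u v huv (by simpa using a) (by simpa using b))
        (Or.inr (Or.inl rfl)) (Or.inr (Or.inr fun u hu huy _ huR =>
          huy (by rw [hP u huR hu]))) u hu (by simpa using huy) (by simp) (some none) (by simp)
        (by simp)
      cases h
  · intro y z X hX u hu huy huz
    by_contra! hno
    obtain ⟨w, hw, h⟩ := hlift X (some (some y)) (some (some z))
      (fun u v huv a a' b b' => hX u v huv (by simpa using a) (by simpa using a')
        (by simpa using b) (by simpa using b'))
      (Or.inr (Or.inr fun u hu huy huz => by
        obtain ⟨h1, h2, -⟩ := hno u hu (by simpa using huy) (by simpa using huz)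
        exact ⟨h1, h2⟩))
      (Or.inr (Or.inr fun u hu huy huz =>
        (hno u hu (by simpa using huy) (by simpa using huz)).2.2)) u hu
      (by simpa using huy) (by simpa using huz) none (by simp) (by simp)
    cases h
  · have h3 := h.numDegree_three
    have h4 := h.four_le
    have : {v | G.degree v = 3} = insert s (R \ {t}) := by
      ext v
      simp only [R, Set.mem_ofPred_eq, Set.mem_insert_iff, Set.mem_sdiff, Set.mem_singleton_iff]
      constructor
      · intro hv
        by_cases hvs : v = s
        · exact Or.inl hvs
        · refine Or.inr ⟨Or.inr ⟨hvs, hv⟩, ?_⟩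
          rintro rfl
          omega
      · rintro (rfl | ⟨h1 | h1, h2⟩)
        · exact h.degree_s
        · exact absurd h1 h2
        · exact h1.2
    have h5 : numDegree G 3 = {v | G.degree v = 3}.ncard := by
      rw [numDegree, Set.ncard_eq_toFinset_card']
      congr 1
      ext v
      simp
    rw [h5, this, Set.ncard_insert_of_notMem (fun h => hsR h.1),
      Set.ncard_sdiff_singleton_add_one htR] at h3
    omega
  · intro w
    have hle : G.degree w ≤ 4 := by
      have := G.degree_le_maxDegree w
      have h' := h.maxDegree_eq
      convert this
      rw [← h']
    rw [blockDegree]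
    have hwt := h.degree_eq_two_iff w
    by_cases hws : w = s
    · subst hws
      have := h.degree_s
      simp [hst, hsR, this]
    by_cases hw : w = t
    · subst hw
      simp [hst.symm, htR, hdt]
    by_cases hw3 : G.degree w = 3
    · have : w ∈ R := Or.inr ⟨hws, hw3⟩
      simp [hws, hw, this, hw3]
    have hwR : w ∉ R := by
      rintro (h | h)
      · exact hw h
      · exact hw3 h.2
    simp only [hws, hw, hwR, if_false, add_zero]
    -- A remaining vertex of degree at most 1 would have no edge to `v` or `none`, so its neighbour
    -- would cut it off.
    by_contra hw4
    have hle1 : G.degree w ≤ 1 := by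
      have : G.degree w ≠ 2 := fun h => hw (hwt.1 h)
      omega
    obtain ⟨y, hy⟩ : ∃ y, ∀ z, G.Adj w z → z = y := by
      have : Nonempty (Fin n) := ⟨w⟩
      rw [← card_neighborFinset_eq_degree, Finset.card_le_one_iff_subset_singleton] at hle1
      obtain ⟨y, hy⟩ := hle1
      refine ⟨y, fun z hz => ?_⟩
      simpa using hy ((G.mem_neighborFinset w z).2 hz)
    by_cases hyw : y = w
    · obtain ⟨w', hw', h⟩ := hlift {w} (some (some t)) (some (some t))
        (fun u v huv _ _ _ _ hu => by
          obtain rfl : u = w := hu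
          exact (hy v huv).trans hyw)
        (Or.inr (Or.inr fun u hu _ _ => by obtain rfl : u = w := hu; exact ⟨hws, hw⟩))
        (Or.inr (Or.inr fun u hu _ _ => by obtain rfl : u = w := hu; exact hwR)) w rfl
        (by simpa using hw) (by simpa using hw) none (by simp) (by simp)
      cases h
    · obtain ⟨w', hw', h⟩ := hlift {w} (some (some y)) (some (some y))
        (fun u v huv _ _ hv _ hu => by
          obtain rfl : u = w := hu
          exact absurd (by rw [hy v huv]) hv)
        (Or.inr (Or.inr fun u hu _ _ => by obtain rfl : u = w := hu; exact ⟨hws, hw⟩))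
        (Or.inr (Or.inr fun u hu _ _ => by obtain rfl : u = w := hu; exact hwR)) w rfl
        (by simpa using Ne.symm hyw) (by simpa using Ne.symm hyw) none (by simp) (by simp)
      cases h

end Seed


/-! ### A cycle on `Fin n` and its chords. -/

lemma iff_of_forall_succ {P : ℕ → Prop} {a b : ℕ}
    (h : ∀ k, a ≤ k → k + 1 < b → (P k ↔ P (k + 1))) {i j : ℕ} (hai : a ≤ i) (hib : i < b)
    (haj : a ≤ j) (hjb : j < b) : P i ↔ P j := by
  have key : ∀ d i, a ≤ i → i + d < b → (P i ↔ P (i + d)) := by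
    intro d
    induction d with
    | zero => intros; rfl
    | succ d ih =>
      intro i hi hd
      exact (ih i hi (by omega)).trans (h (i + d) (by omega) (by omega))
  rcases le_total i j with hij | hij
  · have := key (j - i) i hai (by omega)
    rwa [Nat.add_sub_cancel' hij] at this
  · have := key (i - j) j haj (by omega)
    rw [Nat.add_sub_cancel' hij] at this
    exact this.symm

section FinCycle

variable {n : ℕ}

/-- The cycle `0, 1, …, n - 1`. -/
def finCycle (n : ℕ) (hn : 3 ≤ n) : SimpleGraph (Fin n) where
  Adj u v := u.1 + 1 = v.1 ∨ v.1 + 1 = u.1 ∨ (u.1 = 0 ∧ v.1 + 1 = n) ∨ (v.1 = 0 ∧ u.1 + 1 = n)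
  symm := ⟨fun u v h => by omega⟩
  loopless := ⟨fun u h => by omega⟩

lemma isCyc_finCycle (hn : 3 ≤ n) : IsCyc (finCycle n hn) where
  exists_adj := ⟨⟨0, by omega⟩, ⟨1, by omega⟩, Or.inl rfl⟩
  deg v := by
    right
    obtain ⟨v, hv⟩ := v
    refine ⟨⟨if v = 0 then n - 1 else v - 1, by split_ifs <;> omega⟩,
      ⟨if v + 1 = n then 0 else v + 1, by split_ifs <;> omega⟩, ?_, fun ⟨z, hz⟩ => ?_⟩
    · simp only [ne_eq, Fin.mk.injEq]
      split_ifs <;> omega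
    · simp only [finCycle, Fin.mk.injEq]
      split_ifs <;> omega
  closed X hX := by
    rintro ⟨u, -, hu, -⟩ v - -
    have := iff_of_forall_succ (P := fun k => ∃ h : k < n, (⟨k, h⟩ : Fin n) ∈ X) (a := 0) (b := n)
      (fun k _ hk => ⟨fun ⟨_, h2⟩ => ⟨hk, hX _ _ (Or.inl rfl) h2⟩,
        fun ⟨_, h2⟩ => ⟨by omega, hX _ _ (Or.inr (Or.inl rfl)) h2⟩⟩)
      (Nat.zero_le _) u.2 (Nat.zero_le _) v.2
    exact (this.1 ⟨u.2, hu⟩).2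

lemma exists_finCycle_adj (hn : 3 ≤ n) (v : Fin n) : ∃ w, (finCycle n hn).Adj v w := by
  obtain ⟨v, hv⟩ := v
  by_cases h : v + 1 < n
  · exact ⟨⟨v + 1, h⟩, Or.inl rfl⟩
  · exact ⟨⟨0, by omega⟩, Or.inr (Or.inr (Or.inr ⟨rfl, by change v + 1 = n; omega⟩))⟩

/-- A hamiltonian graph has no 2-cut if every pair of complementary arcs of the hamiltonian cycle
is joined by a chord. -/
lemma noTwoCut_of_chords (hn : 3 ≤ n) {G : SimpleGraph (Fin n)} (hG : finCycle n hn ≤ G)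
    (hch : ∀ y z : ℕ, y + 1 < z → z < n → (y ≠ 0 ∨ z + 1 ≠ n) →
      ∃ p q : Fin n, y < p.1 ∧ p.1 < z ∧ (q.1 < y ∨ z < q.1) ∧ G.Adj p q) : NoTwoCut G := by
  suffices h : ∀ y z : Fin n, y.1 ≤ z.1 → ∀ X : Set (Fin n),
      (∀ u v, G.Adj u v → u ≠ y → u ≠ z → v ≠ y → v ≠ z → u ∈ X → v ∈ X) →
      ∀ u v, u ≠ y → u ≠ z → v ≠ y → v ≠ z → u ∈ X → v ∈ X by
    intro y z X hX u v h1 h2 h3 h4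
    rcases le_total y.1 z.1 with hyz | hyz
    · exact h y z hyz X hX u v h1 h2 h3 h4
    · exact h z y hyz X (fun u v huv a b c d => hX u v huv b a d c) u v h2 h1 h4 h3
  rintro ⟨y, hy⟩ ⟨z, hz⟩ hyz X hX
  replace hyz : y ≤ z := hyz
  let P : ℕ → Prop := fun k => ∃ h : k < n, (⟨k, h⟩ : Fin n) ∈ X
  have hadj : ∀ i j (hi : i < n) (hj : j < n), G.Adj ⟨i, hi⟩ ⟨j, hj⟩ → i ≠ y → i ≠ z → j ≠ y →
      j ≠ z → (P i ↔ P j) := by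
    intro i j hi hj h h1 h2 h3 h4
    have e : ∀ (a b : ℕ) (ha : a < n) (hb : b < n), a ≠ b → (⟨a, ha⟩ : Fin n) ≠ ⟨b, hb⟩ :=
      fun a b ha hb hab h => hab (congrArg Fin.val h)
    exact ⟨fun ⟨_, h'⟩ => ⟨hj, hX _ _ h (e _ _ _ _ h1) (e _ _ _ _ h2) (e _ _ _ _ h3)
      (e _ _ _ _ h4) h'⟩, fun ⟨_, h'⟩ => ⟨hi, hX _ _ h.symm (e _ _ _ _ h3) (e _ _ _ _ h4)
      (e _ _ _ _ h1) (e _ _ _ _ h2) h'⟩⟩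
  have hsucc : ∀ k, k + 1 < n → k ≠ y → k ≠ z → k + 1 ≠ y → k + 1 ≠ z → (P k ↔ P (k + 1)) :=
    fun k hk h1 h2 h3 h4 => hadj k (k + 1) (by omega) hk (hG (Or.inl rfl)) h1 h2 h3 h4
  have hA : ∀ i j, y < i → i < z → y < j → j < z → (P i ↔ P j) := fun i j h1 h2 h3 h4 =>
    iff_of_forall_succ (a := y + 1) (b := z)
      (fun k _ _ => hsucc k (by omega) (by omega) (by omega) (by omega) (by omega))
      h1 h2 h3 h4
  have hB1 : ∀ i j, i < y → j < y → (P i ↔ P j) := fun i j h1 h2 =>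
    iff_of_forall_succ (a := 0) (b := y)
      (fun k _ _ => hsucc k (by omega) (by omega) (by omega) (by omega) (by omega))
      (Nat.zero_le _) h1 (Nat.zero_le _) h2
  have hB2 : ∀ i j, z < i → i < n → z < j → j < n → (P i ↔ P j) := fun i j h1 h2 h3 h4 =>
    iff_of_forall_succ (a := z + 1) (b := n)
      (fun k _ _ => hsucc k (by omega) (by omega) (by omega) (by omega) (by omega))
      h1 h2 h3 h4
  -- The two outer intervals are connected through the edge between `n - 1` and `0`.
  have hB3 : ∀ i j, i < y → z < j → j < n → (P i ↔ P j) := by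
    intro i j hi hj hjn
    refine (hB1 i 0 hi (by omega)).trans (Iff.trans ?_ (hB2 (n - 1) j (by omega) (by omega) hj hjn))
    exact hadj 0 (n - 1) (by omega) (by omega)
      (hG (Or.inr (Or.inr (Or.inl ⟨rfl, by change n - 1 + 1 = n; omega⟩))))
      (by omega) (by omega) (by omega) (by omega)
  have hB : ∀ i j, (i < y ∨ z < i) → (j < y ∨ z < j) → i < n → j < n → (P i ↔ P j) := by
    rintro i j (hi | hi) (hj | hj) hin hjn
    · exact hB1 i j hi hj
    · exact hB3 i j hi hj hjn
    · exact (hB3 j i hj hi hin).symm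
    · exact hB2 i j hi hin hj hjn
  have hAB : ∀ i j, y < i → i < z → (j < y ∨ z < j) → j < n → (P i ↔ P j) := by
    intro i j h1 h2 h3 h4
    obtain ⟨p, q, hp1, hp2, hq, hpq⟩ := hch y z (by omega) hz (by omega)
    refine (hA i p h1 h2 hp1 hp2).trans (Iff.trans ?_ (hB q j hq h3 q.2 h4))
    exact hadj p q p.2 q.2 hpq (by omega) (by omega) (by omega) (by omega)
  rintro ⟨u, hu⟩ ⟨v, hv⟩ h1 h2 h3 h4 huX
  simp only [ne_eq, Fin.mk.injEq] at h1 h2 h3 h4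
  have : P u ↔ P v := by
    by_cases hu' : y < u ∧ u < z <;> by_cases hv' : y < v ∧ v < z
    · exact hA u v hu'.1 hu'.2 hv'.1 hv'.2
    · exact hAB u v hu'.1 hu'.2 (by omega) hv
    · exact (hAB v u hv'.1 hv'.2 (by omega) hu).symm
    · exact hB u v (by omega) (by omega) hu hv
  exact (this.1 ⟨hu, huX⟩).2

end FinCycle


/-! ### A verified case search for cycles in cubic graphs. -/

section Checker

/-- Exactly two of three propositions hold. -/
def TwoOf (p q r : Prop) : Prop := (p ∧ q ∧ ¬ r) ∨ (p ∧ ¬ q ∧ r) ∨ (¬ p ∧ q ∧ r)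

/-- None or exactly two of three propositions hold. -/
def ZeroOrTwo (p q r : Prop) : Prop := (¬ p ∧ ¬ q ∧ ¬ r) ∨ TwoOf p q r

/-- A clause `(i, j, k, l)`: if the literals `i` and `j` hold, then so do `k` and `l`. -/
def applyClause (s : ℕ) (c : ℕ × ℕ × ℕ × ℕ) : ℕ :=
  bif s.testBit c.1 && s.testBit c.2.1 then s ||| 2 ^ c.2.2.1 ||| 2 ^ c.2.2.2 else s

/-- The clauses saying that two (or, if `o` is true, none or two) of three edges are used. The
literal `2 * i` says that the edge `i` is used, the literal `2 * i + 1` that it is not used. -/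
def clauses : Bool → ℕ → ℕ → ℕ → List (ℕ × ℕ × ℕ × ℕ)
  | false, a, b, c =>
    [(2 * a, 2 * b, 2 * c + 1, 2 * c + 1), (2 * b, 2 * c, 2 * a + 1, 2 * a + 1),
      (2 * c, 2 * a, 2 * b + 1, 2 * b + 1), (2 * a + 1, 2 * a + 1, 2 * b, 2 * c),
      (2 * b + 1, 2 * b + 1, 2 * c, 2 * a), (2 * c + 1, 2 * c + 1, 2 * a, 2 * b)]
  | true, a, b, c =>
    [(2 * a, 2 * b, 2 * c + 1, 2 * c + 1), (2 * b, 2 * c, 2 * a + 1, 2 * a + 1),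
      (2 * c, 2 * a, 2 * b + 1, 2 * b + 1),
      (2 * a + 1, 2 * b + 1, 2 * c + 1, 2 * c + 1), (2 * b + 1, 2 * c + 1, 2 * a + 1, 2 * a + 1),
      (2 * c + 1, 2 * a + 1, 2 * b + 1, 2 * b + 1),
      (2 * a + 1, 2 * b, 2 * c, 2 * c), (2 * b + 1, 2 * c, 2 * a, 2 * a),
      (2 * c + 1, 2 * a, 2 * b, 2 * b),
      (2 * a, 2 * b + 1, 2 * c, 2 * c), (2 * b, 2 * c + 1, 2 * a, 2 * a),
      (2 * c, 2 * a + 1, 2 * b, 2 * b)]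

/-- A refutation tree: branch on an edge and propagate at the listed vertices, until there is a
contradiction, a cut without edges, or all edges of the given cycle are used. -/
inductive RefTree
  | conf (i : ℕ)
  | sol
  | cut (X r₀ r₁ : ℕ)
  | node (i : ℕ) (vs : List ℕ) (l : RefTree) (ws : List ℕ) (r : RefTree)

/-- The local constraints: a vertex is given by its three edges and whether it is optional. -/
abbrev Constraints := List (Bool × ℕ × ℕ × ℕ)

/-- Propagation at a vertex. -/
def propagate (K : Constraints) (s v : ℕ) : ℕ :=
  match K[v]? with
  | none => s
  | some (o, a, b, c) => (clauses o a b c).foldl applyClause s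

/-- Verification of a refutation tree. -/
def RefTree.check (K : Constraints) (ends : List (ℕ × ℕ)) (cyc : List ℕ) : RefTree → ℕ → Bool
  | conf i, s => s.testBit (2 * i) && s.testBit (2 * i + 1)
  | sol, s => cyc.all fun i => s.testBit (2 * i)
  | cut X r₀ r₁, s =>
    (K[r₀]?.any fun k => !k.1) && (K[r₁]?.any fun k => !k.1) && X.testBit r₀ && !X.testBit r₁ &&
      ends.zipIdx.all fun e => (X.testBit e.1.1 == X.testBit e.1.2) || s.testBit (2 * e.2 + 1)
  | node i vs l ws r, s =>
    l.check K ends cyc (vs.foldl (propagate K) (s ||| 2 ^ (2 * i))) &&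
      r.check K ends cyc (ws.foldl (propagate K) (s ||| 2 ^ (2 * i + 1)))

/-- The meaning of a literal. -/
def Holds (lit : ℕ → Prop) (k : ℕ) : Prop := if k % 2 = 0 then lit (k / 2) else ¬ lit (k / 2)

/-- All literals in the bit mask `s` hold. -/
def HoldsAll (lit : ℕ → Prop) (s : ℕ) : Prop := ∀ k, s.testBit k = true → Holds lit k

variable {lit : ℕ → Prop}

@[simp] lemma holds_two_mul {i : ℕ} : Holds lit (2 * i) ↔ lit i := by
  simp [Holds]

@[simp] lemma holds_two_mul_add_one {i : ℕ} : Holds lit (2 * i + 1) ↔ ¬ lit i := by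
  have h1 : (2 * i + 1) % 2 = 1 := by omega
  have h2 : (2 * i + 1) / 2 = i := by omega
  simp [Holds, h1, h2]

lemma HoldsAll.or {s k : ℕ} (h : HoldsAll lit s) (hk : Holds lit k) :
    HoldsAll lit (s ||| 2 ^ k) := by
  intro j hj
  rw [Nat.testBit_or, Bool.or_eq_true] at hj
  rcases hj with hj | hj
  · exact h j hj
  · rw [Nat.testBit_two_pow, decide_eq_true_iff] at hj
    exact hj ▸ hk

lemma HoldsAll.applyClause {s : ℕ} (h : HoldsAll lit s) {c : ℕ × ℕ × ℕ × ℕ}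
    (hc : Holds lit c.1 → Holds lit c.2.1 → Holds lit c.2.2.1 ∧ Holds lit c.2.2.2) :
    HoldsAll lit (applyClause s c) := by
  unfold UHC.applyClause
  by_cases hs : (s.testBit c.1 && s.testBit c.2.1) = true
  · rw [hs, cond_true]
    rw [Bool.and_eq_true] at hs
    obtain ⟨h1, h2⟩ := hc (h _ hs.1) (h _ hs.2)
    exact (h.or h1).or h2
  · rw [Bool.not_eq_true] at hs
    rw [hs, cond_false]
    exact h

lemma HoldsAll.propagate {K : Constraints} {s v : ℕ} (h : HoldsAll lit s)
    (hK : ∀ (v : ℕ) (o : Bool) (a b c : ℕ), K[v]? = some (o, a, b, c) →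
      if o = true then ZeroOrTwo (lit a) (lit b) (lit c) else TwoOf (lit a) (lit b) (lit c)) :
    HoldsAll lit (propagate K s v) := by
  unfold UHC.propagate
  split
  · exact h
  · rename_i o a b c hv
    have h' := hK v o a b c hv
    have key : ∀ (l : List (ℕ × ℕ × ℕ × ℕ)) (s : ℕ), HoldsAll lit s →
        (∀ c ∈ l, Holds lit c.1 → Holds lit c.2.1 → Holds lit c.2.2.1 ∧ Holds lit c.2.2.2) →
        HoldsAll lit (l.foldl UHC.applyClause s) := by
      intro l
      induction l with
      | nil => exact fun s hs _ => hs
      | cons c l ih =>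
        intro s hs hl
        exact ih _ (hs.applyClause (hl c (by simp))) fun c' hc' => hl c' (by simp [hc'])
    refine key _ s h ?_
    cases o
    · simp only [Bool.false_eq_true, if_false, TwoOf] at h'
      simp only [clauses, List.mem_cons, List.not_mem_nil, or_false, forall_eq_or_imp, forall_eq,
        holds_two_mul, holds_two_mul_add_one]
      refine ⟨?_, ?_, ?_, ?_, ?_, ?_⟩ <;> tauto
    · simp only [if_true, ZeroOrTwo, TwoOf] at h'
      simp only [clauses, List.mem_cons, List.not_mem_nil, or_false, forall_eq_or_imp, forall_eq,
        holds_two_mul, holds_two_mul_add_one]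
      refine ⟨?_, ?_, ?_, ?_, ?_, ?_, ?_, ?_, ?_, ?_, ?_, ?_⟩ <;> tauto

/-- Soundness of the search: the literals collected along a branch hold for the cycle in question,
and no cycle can visit required vertices on both sides of a cut all of whose edges are unused. Hence
only the leaves `sol` survive. -/
lemma RefTree.lit_of_check {K : Constraints} {ends : List (ℕ × ℕ)} {cyc : List ℕ}
    (hK : ∀ (v : ℕ) (o : Bool) (a b c : ℕ), K[v]? = some (o, a, b, c) →
      if o = true then ZeroOrTwo (lit a) (lit b) (lit c) else TwoOf (lit a) (lit b) (lit c))
    (hcut : ∀ X : ℕ → Bool, (∀ i u v : ℕ, ends[i]? = some (u, v) → lit i → X u = X v) →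
      ∀ (r₀ r₁ : ℕ) (k₀ k₁ : ℕ × ℕ × ℕ), K[r₀]? = some (false, k₀) → K[r₁]? = some (false, k₁) →
        X r₀ = X r₁) :
    ∀ (t : RefTree) (s : ℕ), t.check K ends cyc s = true → HoldsAll lit s → ∀ i ∈ cyc, lit i := by
  intro t
  have hfold : ∀ (vs : List ℕ) (s : ℕ), HoldsAll lit s →
      HoldsAll lit (vs.foldl (UHC.propagate K) s) := by
    intro vs
    induction vs with
    | nil => exact fun s hs => hs
    | cons v vs ih => exact fun s hs => ih _ (hs.propagate hK)
  induction t with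
  | conf i =>
    intro s hs h
    rw [check, Bool.and_eq_true] at hs
    exact absurd (holds_two_mul.1 (h _ hs.1)) (holds_two_mul_add_one.1 (h _ hs.2))
  | sol =>
    intro s hs h i hi
    rw [check, List.all_eq_true] at hs
    exact holds_two_mul.1 (h _ (hs i hi))
  | cut X r₀ r₁ =>
    intro s hs h
    simp only [check, Bool.and_eq_true, List.all_eq_true, Bool.or_eq_true, beq_iff_eq,
      Option.any_eq_true] at hs
    obtain ⟨⟨⟨⟨⟨⟨o₀, k₀⟩, h0, h0'⟩, ⟨⟨o₁, k₁⟩, h1, h1'⟩⟩, h2⟩, h3⟩, h4⟩ := hs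
    simp only [Bool.not_eq_eq_eq_not, Bool.not_true] at h0' h1' h3
    subst h0' h1'
    have := hcut X.testBit (fun i u v hi hl => by
      rcases h4 ((u, v), i) (by rw [List.mem_zipIdx_iff_getElem?]; exact hi) with h5 | h5
      · exact h5
      · exact absurd hl (holds_two_mul_add_one.1 (h _ h5))) r₀ r₁ k₀ k₁ h0 h1
    rw [h2, h3] at this
    cases this
  | node i vs l ws r ihl ihr =>
    intro s hs h
    rw [check, Bool.and_eq_true] at hs
    by_cases hi : lit i
    · exact ihl _ hs.1 (hfold _ _ (h.or (holds_two_mul.2 hi)))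
    · exact ihr _ hs.2 (hfold _ _ (h.or (holds_two_mul_add_one.2 hi)))

end Checker

/-! ### The base graph and its cubic counterpart. -/

section Data

/-- The places of a cubic graph and their counterparts in the base graph: a vertex `z`; a triangle
`k, k + 1, k + 2` whose middle vertex is also joined to `x` and `y`; or nothing at all, for a
vertex whose neighbours are the triangles at `k₁`, `k₂`, `k₃`. The last three arguments are the
edges of the cubic graph at this place. -/
inductive Site
  | plain (z a b c : ℕ)
  | triple (k x y a b c : ℕ)
  | hub (k₁ k₂ k₃ a b c : ℕ)

/-- The neighbourhoods in the base graph. -/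
def baseNbrs : List (List ℕ) :=
    [[1, 13, 78], [0, 2, 3], [1, 3, 11, 58], [1, 2, 4], [3, 5, 6], [4, 6, 40, 54], [4, 5, 7],
    [6, 8, 9], [7, 9, 65, 73], [7, 8, 10], [9, 11, 12], [2, 10, 12, 58], [10, 11, 13], [0, 12,
    14], [13, 15, 52], [14, 16, 56], [15, 17, 45], [16, 18, 19], [17, 19, 43, 50], [17, 18, 20],
    [19, 21, 31], [20, 22, 23], [21, 23, 29, 36], [21, 22, 24], [23, 25, 26], [24, 26, 33, 47],
    [24, 25, 27], [26, 28, 38], [27, 29, 30], [22, 28, 30, 36], [28, 29, 31], [20, 30, 32], [31,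
    33, 34], [25, 32, 34, 47], [32, 33, 35], [34, 36, 37], [22, 29, 35, 37], [35, 36, 38], [27,
    37, 39], [38, 40, 41], [5, 39, 41, 54], [39, 40, 42], [41, 43, 44], [18, 42, 44, 50], [42,
    43, 45], [16, 44, 46], [45, 47, 48], [25, 33, 46, 48], [46, 47, 49], [48, 50, 51], [18, 43,
    49, 51], [49, 50, 52], [14, 51, 53], [52, 54, 55], [5, 40, 53, 55], [53, 54, 56], [15, 55,
    57], [56, 58, 59], [2, 11, 57, 59], [57, 58, 60], [59, 61, 71], [60, 62, 63], [61, 63, 69,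
    76], [61, 62, 64], [63, 65, 66], [8, 64, 66, 73], [64, 65, 67], [66, 68, 78], [67, 69, 70],
    [62, 68, 70, 76], [68, 69, 71], [60, 70, 72], [71, 73, 74], [8, 65, 72, 74], [72, 73, 75],
    [74, 76, 77], [62, 69, 75, 77], [75, 76, 78], [0, 67, 77]]

/-- The places of the cubic graph. -/
def baseSites : List Site :=
    [.triple 72 65 8 3 0 11, .triple 75 69 62 0 1 6, .plain 78 2 8 1, .plain 0 16 28 2, .plain
    71 15 4 3, .triple 68 76 62 7 4 5, .hub 68 75 61 5 6 13, .plain 67 9 7 8, .triple 64 73 8 12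
    9 10, .hub 64 72 7 10 11 22, .triple 61 69 76 14 12 13, .plain 60 18 14 15, .triple 1 58 11
    16 17 20, .triple 4 40 54 17 21 42, .triple 57 2 11 23 18 19, .hub 57 1 10 19 20 26, .triple
    7 65 73 21 25 22, .plain 56 31 24 23, .triple 53 40 5 32 24 43, .triple 10 58 2 25 27 26,
    .plain 13 28 27 29, .plain 14 29 30 33, .plain 15 30 46 31, .plain 52 33 34 32, .triple 49
    43 18 35 34 39, .triple 46 33 25 36 35 52, .plain 45 47 37 36, .triple 42 50 18 40 37 38,
    .hub 42 49 17 38 39 49, .triple 39 5 54 44 40 41, .hub 39 4 53 41 42 43, .plain 38 60 45 44,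
    .triple 35 29 22 50 45 63, .plain 16 46 48 47, .triple 17 43 50 48 53 49, .triple 32 47 25
    55 50 51, .hub 32 46 24 51 52 58, .plain 20 53 54 56, .triple 21 29 36 54 57 64, .plain 31
    56 65 55, .triple 24 33 47 57 59 58, .plain 27 59 61 60, .triple 28 36 22 61 65 62, .hub 28
    35 21 62 63 64]

/-- The edges of the base graph that correspond to the edges of the cubic graph, and pairs
`(k, 100)` for edges from a triangle to a hub. -/
def baseEdges : List (ℕ × ℕ) :=
    [(74, 75), (77, 78), (0, 78), (71, 72), (70, 71), (68, 100), (75, 100), (67, 68), (67, 78),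
    (66, 67), (64, 100), (72, 100), (63, 64), (61, 100), (60, 61), (60, 71), (0, 1), (3, 4),
    (59, 60), (57, 100), (1, 100), (6, 7), (7, 100), (56, 57), (55, 56), (9, 10), (10, 100),
    (12, 13), (0, 13), (13, 14), (14, 15), (15, 56), (52, 53), (14, 52), (51, 52), (48, 49),
    (45, 46), (44, 45), (42, 100), (49, 100), (41, 42), (39, 100), (4, 100), (53, 100), (38,
    39), (37, 38), (15, 16), (16, 45), (16, 17), (17, 100), (34, 35), (32, 100), (46, 100), (19,
    20), (20, 21), (31, 32), (20, 31), (23, 24), (24, 100), (26, 27), (27, 38), (27, 28), (28,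
    100), (35, 100), (21, 100), (30, 31)]

/-- The ends of the edges of the cubic graph. -/
def cubicEnds : List (ℕ × ℕ) :=
    [(0, 1), (1, 2), (3, 2), (4, 0), (5, 4), (5, 6), (1, 6), (7, 5), (7, 2), (8, 7), (8, 9), (0,
    9), (10, 8), (10, 6), (11, 10), (11, 4), (3, 12), (12, 13), (14, 11), (14, 15), (12, 15),
    (13, 16), (16, 9), (17, 14), (18, 17), (16, 19), (19, 15), (19, 20), (3, 20), (20, 21), (21,
    22), (22, 17), (23, 18), (21, 23), (24, 23), (25, 24), (26, 25), (27, 26), (27, 28), (24,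
    28), (29, 27), (29, 30), (13, 30), (18, 30), (31, 29), (32, 31), (22, 33), (33, 26), (33,
    34), (34, 28), (35, 32), (35, 36), (25, 36), (34, 37), (37, 38), (39, 35), (37, 39), (38,
    40), (40, 36), (40, 41), (41, 31), (41, 42), (42, 43), (32, 43), (38, 43), (42, 39)]

/-- The edges of the given cycle of the cubic graph. -/
def cubicCycle : List ℕ :=
    [0, 1, 2, 3, 4, 7, 9, 12, 14, 16, 17, 18, 21, 23, 24, 25, 27, 29, 30, 32, 34, 35, 36, 37,
    40, 44, 45, 46, 48, 50, 53, 54, 55, 57, 59, 61, 65]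

/-- The place to which a vertex of the base graph belongs. -/
def baseSite : List ℕ :=
    [3, 12, 12, 12, 13, 13, 13, 16, 16, 16, 19, 19, 19, 20, 21, 22, 33, 34, 34, 34, 37, 38, 38,
    38, 40, 40, 40, 41, 42, 42, 42, 39, 35, 35, 35, 32, 32, 32, 31, 29, 29, 29, 27, 27, 27, 26,
    25, 25, 25, 24, 24, 24, 23, 18, 18, 18, 17, 14, 14, 14, 11, 10, 10, 10, 8, 8, 8, 7, 5, 5, 5,
    4, 0, 0, 0, 1, 1, 1, 2]

/-- The optional vertices of the base graph. -/
def baseOptional : List ℕ :=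
    [1, 4, 7, 10, 13, 16, 17, 20, 21, 24, 28, 32, 35, 38, 39, 42, 46, 49, 52, 53, 56, 57, 60,
    61, 64, 68, 72, 75, 78]

/-- The vertices of the base graph at which blocks will be substituted. -/
def baseTargets : List ℕ :=
    [0, 3, 6, 9, 12, 14, 15, 19, 23, 26, 27, 30, 31, 34, 37, 41, 44, 45, 48, 51, 55, 59, 63, 66,
    67, 70, 71, 74, 77]

/-- The chords at these vertices. -/
def basePartner : List ℕ :=
    [13, 1, 2, 1, 4, 5, 4, 7, 8, 7, 10, 11, 10, 13, 52, 56, 16, 17, 18, 17, 20, 21, 22, 21, 24,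
    25, 24, 38, 28, 29, 28, 20, 32, 33, 32, 35, 36, 35, 38, 39, 40, 39, 42, 43, 42, 16, 46, 47,
    46, 49, 50, 49, 52, 53, 54, 53, 56, 57, 58, 57, 60, 61, 62, 61, 64, 65, 64, 78, 68, 69, 68,
    60, 72, 73, 72, 75, 76, 75, 78]

/-- The proof that the cycle is the only one. -/
def baseTree : RefTree :=
    .node 0 [] (.node 1 [1] (.node 2 [2, 7] (.node 5 [5, 6, 4, 0] (.node 12 [8, 10, 9, 11, 16]
    (.cut 17592186042399 0 5) [8, 10, 9, 11, 14] (.node 16 [3] (.node 20 [12, 15, 13, 19, 16]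
    (.conf 25) [12, 15] (.node 21 [13, 16, 19, 20] (.cut 81919 0 14) [13, 16, 19, 20, 21] (.node
    31 [17, 22, 18, 23, 30, 24, 29] (.cut 1089470463 0 24) [17, 22] (.node 32 [18, 23, 30, 24]
    (.node 36 [25] (.node 47 [26, 33, 27, 34, 28] (.conf 49) [26, 33] (.node 38 [27, 28, 29, 34]
    (.cut 17591664902143 0 24) [27, 28, 29, 34] (.cut 27916238847 0 32))) [25, 26, 33, 34, 28,
    27, 29] (.cut 10417602559 0 24)) [18, 23, 30, 29] (.cut 1074790399 0 21))))) [3, 12, 15, 19,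
    16, 20, 13, 21] (.cut 1642495 0 12))) [5, 6, 10, 8] (.node 3 [0, 4, 9, 11, 16] (.node 16 [3]
    (.node 17 [12, 13] (.node 19 [14, 15, 19, 20, 21] (.cut 654783 0 18) [14, 15, 19, 20] (.node
    24 [17, 22, 21] (.node 32 [18, 23, 30, 29] (.node 35 [24] (.node 38 [27, 28, 26, 25, 33, 34]
    (.cut 8724118975 0 27) [27, 28, 34, 33, 26, 25] (.node 45 [31, 41] (.node 58 [36, 40, 38,
    37, 39, 35, 42, 32] (.cut 9241427410367 0 35) [36, 40, 35, 32] (.node 54 [37, 38, 39, 43]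
    .sol [37, 38, 39, 43] (.cut 754572033471 0 38))) [31, 32] (.node 51 [35, 36, 39, 37, 38, 40,
    43, 41] (.cut 7312987094463 0 32) [35, 36, 40, 41, 42, 43, 39, 38] (.cut 3739574304191 0
    32)))) [24, 25] (.node 37 [26, 27, 33, 28, 34] (.cut 26071760319 0 25) [26, 27, 33, 28, 34]
    (.conf 49))) [18, 23, 30, 24] (.node 36 [25] (.node 47 [26, 33, 27, 34, 28] (.conf 49) [26,
    33] (.node 38 [27, 28, 29, 34] (.cut 17591657528767 0 24) [27, 28, 29, 34] (.cut 27908865471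
    0 32))) [25, 26, 33, 34, 28, 27, 29] (.cut 10410229183 0 24))) [17, 18, 30] (.node 30 [21,
    22, 23] (.cut 8093119 0 18) [21, 22, 23, 24] (.node 36 [25] (.node 47 [26, 33, 27, 34, 28]
    (.conf 49) [26, 33] (.node 38 [27, 28, 29, 34] (.cut 17591665917375 0 24) [27, 28, 29, 34]
    (.cut 27917254079 0 32))) [25, 26, 33, 34, 28, 27, 29] (.cut 10418617791 0 24))))) [12, 13]
    (.node 19 [14, 15, 19, 20] (.cut 56767 0 13) [14, 15, 19, 20, 21] (.node 31 [17, 22, 18, 23,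
    30, 24, 29] (.cut 1089469887 0 24) [17, 22] (.node 32 [18, 23, 30, 24] (.node 36 [25] (.node
    47 [26, 33, 27, 34, 28] (.conf 49) [26, 33] (.node 38 [27, 28, 29, 34] (.cut 17591664901567
    0 24) [27, 28, 29, 34] (.cut 27916238271 0 32))) [25, 26, 33, 34, 28, 27, 29] (.cut
    10417601983 0 24)) [18, 23, 30, 29] (.cut 1074789823 0 21))))) [3, 12, 13] (.node 19 [14,
    15, 19, 20, 21] (.cut 1703359 0 18) [14, 15, 19, 20] (.cut 17592185408959 0 12))) [0, 4, 9,
    11, 14] (.cut 17592186040847 0 4))) [2, 3] (.node 3 [0] (.node 4 [4] (.node 7 [5, 7, 6, 8,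
    10, 9, 11] (.cut 183 0 3) [5, 7, 6] (.node 12 [8, 10, 9, 11, 16, 14] (.cut 1527 0 3) [8, 10,
    9, 11] (.node 17 [12] (.node 21 [13, 16, 19, 15, 20, 14, 21] (.cut 1703935 0 18) [13, 16]
    (.node 27 [19, 20, 15, 21, 14] (.node 31 [17, 22, 18, 23, 30, 24, 29] (.cut 1090486271 0 24)
    [17, 22] (.node 32 [18, 23, 30, 24] (.node 36 [25] (.node 47 [26, 33, 27, 34, 28] (.conf 49)
    [26, 33] (.node 38 [27, 28, 29, 34] (.cut 17591665917951 0 24) [27, 28, 29, 34] (.cut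
    27917254655 0 32))) [25, 26, 33, 34, 28, 27, 29] (.cut 10418618367 0 24)) [18, 23, 30, 29]
    (.cut 1075806207 0 21))) [19, 20, 15, 14] (.cut 643063 0 3))) [12, 13, 16, 19, 15, 20, 14,
    21] (.cut 17592184434679 0 3)))) [4, 5, 6, 7, 8, 9, 10, 11] (.node 17 [12] (.node 21 [13,
    16, 19, 15, 20, 14, 21] (.cut 1703935 0 18) [13, 16] (.node 27 [19, 20, 15, 21, 14] (.node
    31 [17, 22, 18, 23, 30, 24, 29] (.cut 1090486271 0 24) [17, 22] (.node 32 [18, 23, 30, 24]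
    (.node 36 [25] (.node 47 [26, 33, 27, 34, 28] (.conf 49) [26, 33] (.node 38 [27, 28, 29, 34]
    (.cut 17591665917951 0 24) [27, 28, 29, 34] (.cut 27917254655 0 32))) [25, 26, 33, 34, 28,
    27, 29] (.cut 10418618367 0 24)) [18, 23, 30, 29] (.cut 1075806207 0 21))) [19, 20, 15, 14]
    (.cut 643063 0 3))) [12, 13, 16, 19, 15, 20, 14, 21] (.cut 17592184434679 0 3))) [0, 4]
    (.node 7 [5, 7, 6, 8, 10, 9, 11, 16, 14] (.cut 4023 0 3) [5, 7, 6] (.node 10 [8, 9, 10, 16,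
    11, 14] (.cut 903 0 3) [8, 9, 10, 11] (.node 17 [12] (.node 21 [13, 16, 19, 15, 20, 14, 21]
    (.cut 1703935 0 18) [13, 16] (.node 27 [19, 20, 15, 21, 14] (.node 31 [17, 22, 18, 23, 30,
    24, 29] (.cut 1090486271 0 24) [17, 22] (.node 32 [18, 23, 30, 24] (.node 36 [25] (.node 47
    [26, 33, 27, 34, 28] (.conf 49) [26, 33] (.node 38 [27, 28, 29, 34] (.cut 17591665917951 0
    24) [27, 28, 29, 34] (.cut 27917254655 0 32))) [25, 26, 33, 34, 28, 27, 29] (.cut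
    10418618367 0 24)) [18, 23, 30, 29] (.cut 1075806207 0 21))) [19, 20, 15, 14] (.cut 643063 0
    3))) [12, 13, 16, 19, 15, 20, 14, 21] (.cut 17592184434679 0 3)))))) [1] (.node 3 [0] (.node
    4 [4] (.node 5 [5, 6, 7, 10, 2, 8, 11, 9, 16] (.cut 115 0 3) [5, 6] (.node 8 [2, 7, 8, 9,
    10, 11, 14] (.node 16 [3] (.node 20 [12, 15, 13, 19, 16] (.conf 25) [12, 15] (.node 21 [13,
    16, 19, 20] (.cut 79871 0 14) [13, 16, 19, 20, 21] (.node 31 [17, 22, 18, 23, 30, 24, 29]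
    (.cut 1089468415 0 24) [17, 22] (.node 32 [18, 23, 30, 24] (.node 36 [25] (.node 47 [26, 33,
    27, 34, 28] (.conf 49) [26, 33] (.node 38 [27, 28, 29, 34] (.cut 17591664900095 0 24) [27,
    28, 29, 34] (.cut 27916236799 0 32))) [25, 26, 33, 34, 28, 27, 29] (.cut 10417600511 0 24))
    [18, 23, 30, 29] (.cut 1074788351 0 21))))) [3, 12, 15, 19, 16, 20, 13, 21] (.cut 1640447 0
    12)) [2, 7, 3] (.node 12 [8, 10, 9, 11, 16, 14] (.cut 1523 0 3) [8, 10, 9, 11] (.node 17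
    [12] (.node 21 [13, 16, 19, 15, 20, 14, 21] (.cut 1703931 0 18) [13, 16] (.node 27 [19, 20,
    15, 21, 14] (.node 31 [17, 22, 18, 23, 30, 24, 29] (.cut 1090486267 0 24) [17, 22] (.node 32
    [18, 23, 30, 24] (.node 36 [25] (.node 47 [26, 33, 27, 34, 28] (.conf 49) [26, 33] (.node 38
    [27, 28, 29, 34] (.cut 17591665917947 0 24) [27, 28, 29, 34] (.cut 27917254651 0 32))) [25,
    26, 33, 34, 28, 27, 29] (.cut 10418618363 0 24)) [18, 23, 30, 29] (.cut 1075806203 0 21)))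
    [19, 20, 15, 14] (.cut 643059 0 3))) [12, 13, 16, 19, 15, 20, 14, 21] (.cut 17592184434675 0
    3))))) [4, 5, 6, 10, 11, 14] (.node 9 [7, 8, 2, 9, 3, 16] (.cut 3571 0 3) [7, 8, 2, 9]
    (.node 16 [3] (.node 20 [12, 15, 13, 19, 16] (.conf 25) [12, 15] (.node 21 [13, 16, 19, 20]
    (.cut 81919 0 14) [13, 16, 19, 20, 21] (.node 31 [17, 22, 18, 23, 30, 24, 29] (.cut
    1089470463 0 24) [17, 22] (.node 32 [18, 23, 30, 24] (.node 36 [25] (.node 47 [26, 33, 27,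
    34, 28] (.conf 49) [26, 33] (.node 38 [27, 28, 29, 34] (.cut 17591664902143 0 24) [27, 28,
    29, 34] (.cut 27916238847 0 32))) [25, 26, 33, 34, 28, 27, 29] (.cut 10417602559 0 24)) [18,
    23, 30, 29] (.cut 1074790399 0 21))))) [3, 12, 15, 19, 16, 20, 13, 21] (.cut 1642495 0
    12)))) [0, 4] (.node 5 [5, 6, 7, 10, 2, 8, 11, 9, 14] (.node 16 [3] (.node 20 [12, 15, 13,
    19, 16] (.conf 25) [12, 15] (.node 21 [13, 16, 19, 20] (.cut 81919 0 14) [13, 16, 19, 20,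
    21] (.node 31 [17, 22, 18, 23, 30, 24, 29] (.cut 1089470463 0 24) [17, 22] (.node 32 [18,
    23, 30, 24] (.node 36 [25] (.node 47 [26, 33, 27, 34, 28] (.conf 49) [26, 33] (.node 38 [27,
    28, 29, 34] (.cut 17591664902143 0 24) [27, 28, 29, 34] (.cut 27916238847 0 32))) [25, 26,
    33, 34, 28, 27, 29] (.cut 10417602559 0 24)) [18, 23, 30, 29] (.cut 1074790399 0 21))))) [3,
    12, 15, 19, 16, 20, 13, 21] (.cut 1642495 0 12)) [5, 6] (.node 14 [10, 11, 8, 14, 7, 9, 2,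
    16, 3] (.cut 4083 0 3) [10, 11] (.node 9 [7, 8, 2, 9, 3] (.node 17 [12] (.node 21 [13, 16,
    19, 15, 20, 14, 21] (.cut 1703931 0 18) [13, 16] (.node 27 [19, 20, 15, 21, 14] (.node 31
    [17, 22, 18, 23, 30, 24, 29] (.cut 1090486267 0 24) [17, 22] (.node 32 [18, 23, 30, 24]
    (.node 36 [25] (.node 47 [26, 33, 27, 34, 28] (.conf 49) [26, 33] (.node 38 [27, 28, 29, 34]
    (.cut 17591665917947 0 24) [27, 28, 29, 34] (.cut 27917254651 0 32))) [25, 26, 33, 34, 28,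
    27, 29] (.cut 10418618363 0 24)) [18, 23, 30, 29] (.cut 1075806203 0 21))) [19, 20, 15, 14]
    (.cut 643059 0 3))) [12, 13, 16, 19, 15, 20, 14, 21] (.cut 17592184434675 0 3)) [7, 8, 2, 9,
    16] (.cut 1859 0 3)))))) [0, 1] (.node 2 [2, 7] (.node 4 [4, 5, 6] (.node 10 [8, 9, 10, 16,
    11] (.cut 945 0 1) [8, 9, 10, 11, 14] (.node 16 [3] (.node 20 [12, 15, 13, 19, 16] (.conf
    25) [12, 15] (.node 21 [13, 16, 19, 20] (.cut 79871 0 14) [13, 16, 19, 20, 21] (.node 31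
    [17, 22, 18, 23, 30, 24, 29] (.cut 1089468415 0 24) [17, 22] (.node 32 [18, 23, 30, 24]
    (.node 36 [25] (.node 47 [26, 33, 27, 34, 28] (.conf 49) [26, 33] (.node 38 [27, 28, 29, 34]
    (.cut 17591664900095 0 24) [27, 28, 29, 34] (.cut 27916236799 0 32))) [25, 26, 33, 34, 28,
    27, 29] (.cut 10417600511 0 24)) [18, 23, 30, 29] (.cut 1074788351 0 21))))) [3, 12, 15, 19,
    16, 20, 13, 21] (.cut 1640447 0 12))) [4, 5, 6, 10, 8, 11, 9, 14] (.node 16 [3] (.node 20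
    [12, 15, 13, 19, 16] (.conf 25) [12, 15] (.node 21 [13, 16, 19, 20] (.cut 81919 0 14) [13,
    16, 19, 20, 21] (.node 31 [17, 22, 18, 23, 30, 24, 29] (.cut 1089470463 0 24) [17, 22]
    (.node 32 [18, 23, 30, 24] (.node 36 [25] (.node 47 [26, 33, 27, 34, 28] (.conf 49) [26, 33]
    (.node 38 [27, 28, 29, 34] (.cut 17591664902143 0 24) [27, 28, 29, 34] (.cut 27916238847 0
    32))) [25, 26, 33, 34, 28, 27, 29] (.cut 10417602559 0 24)) [18, 23, 30, 29] (.cut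
    1074790399 0 21))))) [3, 12, 15, 19, 16, 20, 13, 21] (.cut 1642495 0 12))) [2, 3] (.node 4
    [4] (.node 5 [5, 6, 7, 10, 8, 11, 9] (.node 17 [12] (.node 21 [13, 16, 19, 15, 20, 14, 21]
    (.cut 1703935 0 18) [13, 16] (.node 27 [19, 20, 15, 21, 14] (.node 31 [17, 22, 18, 23, 30,
    24, 29] (.cut 1090486271 0 24) [17, 22] (.node 32 [18, 23, 30, 24] (.node 36 [25] (.node 47
    [26, 33, 27, 34, 28] (.conf 49) [26, 33] (.node 38 [27, 28, 29, 34] (.cut 17591665917951 0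
    24) [27, 28, 29, 34] (.cut 27917254655 0 32))) [25, 26, 33, 34, 28, 27, 29] (.cut
    10418618367 0 24)) [18, 23, 30, 29] (.cut 1075806207 0 21))) [19, 20, 15, 14] (.cut 643063 0
    3))) [12, 13, 16, 19, 15, 20, 14, 21] (.cut 17592184434679 0 3)) [5, 6, 7, 8, 9, 10, 16, 11,
    14] (.cut 2039 0 3)) [4, 5, 6, 7, 10, 8, 11, 9, 14, 16] (.cut 3857 0 1)))

/-- The constraints in the cubic graph. -/
def cubicConstraints : Constraints :=
  baseSites.map fun
    | .plain z a b c => (baseOptional.contains z, a, b, c)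
    | .triple _ _ _ a b c => (false, a, b, c)
    | .hub _ _ _ a b c => (true, a, b, c)

/-- The search starts with the empty bit mask, that is, with no assumption about any edge. -/
lemma baseTree_check : baseTree.check cubicConstraints cubicEnds cubicCycle 0 = true := by
  decide +kernel

end Data


/-! ### Consistency of the data. -/

section Base

/-- The neighbourhood of a vertex in the base graph. -/
def baseNbrsAt (u : ℕ) : List ℕ := baseNbrs.getD u []

/-- Here `k`, `k + 1`, `k + 2` is a triangle whose middle vertex is also joined to `x` and `y`. -/
def isTriple (k x y : ℕ) : Bool :=
  1 ≤ k && k + 2 < 79 && (baseNbrsAt k).all (fun q => q == k - 1 || q == k + 1 || q == k + 2) &&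
    (baseNbrsAt (k + 1)).all (fun q => q == k || q == k + 2 || q == x || q == y) &&
    (baseNbrsAt (k + 2)).all (fun q => q == k || q == k + 1 || q == k + 3) &&
    !baseOptional.contains (k + 1) && !baseOptional.contains (k + 2) && x != y &&
    (x < k || k + 2 < x) && (y < k || k + 2 < y)

/-- The edge of the base graph for a given edge of the cubic graph. -/
def baseEdge (i : ℕ) : ℕ × ℕ := baseEdges.getD i (0, 0)

/-- The end different from `z`. -/
def otherEnd (z : ℕ) (e : ℕ × ℕ) : ℕ := if e.1 = z then e.2 else e.1

/-- The edge `e` is not at a hub and contains `z`. -/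
def isEdgeAt (z : ℕ) (e : ℕ × ℕ) : Bool := e.2 != 100 && (e.1 == z || e.2 == z)

/-- The data at a place are consistent. -/
def Site.valid : Site → Bool
  | plain z a b c => z < 79 && isEdgeAt z (baseEdge a) && isEdgeAt z (baseEdge b) &&
      isEdgeAt z (baseEdge c) && otherEnd z (baseEdge a) != otherEnd z (baseEdge b) &&
      otherEnd z (baseEdge a) != otherEnd z (baseEdge c) &&
      otherEnd z (baseEdge b) != otherEnd z (baseEdge c) &&
      (baseNbrsAt z).all (fun q => q == otherEnd z (baseEdge a) || q == otherEnd z (baseEdge b) ||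
        q == otherEnd z (baseEdge c))
  | triple k x y a b c => isTriple k x y && baseEdge a == (k - 1, k) &&
      baseEdge b == (k + 2, k + 3) && baseEdge c == (k, 100) && k != 100 && k + 3 != 100
  | hub k₁ k₂ k₃ a b c => baseEdge a == (k₁, 100) && baseEdge b == (k₂, 100) &&
      baseEdge c == (k₃, 100) && isTriple k₁ (k₂ + 1) (k₃ + 1) &&
      isTriple k₂ (k₁ + 1) (k₃ + 1) && isTriple k₃ (k₁ + 1) (k₂ + 1)

lemma valid_of_mem_baseSites : ∀ s ∈ baseSites, s.valid = true := by decide +kernel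

/-- The edge to the hub, for the middle vertex of a triangle. -/
def baseMid (z : ℕ) : Option ℕ :=
  match baseSites.getD (baseSite.getD z 0) (.plain 0 0 0 0) with
  | .triple k _ _ _ _ c => if z = k + 1 then some c else none
  | _ => none

/-- `u` and `v` are joined by an edge that corresponds to an edge of the cubic graph, or they
belong to the same place, or to two triangles at the same hub. -/
def edgeValid (u v : ℕ) : Bool :=
  match baseMid u, baseMid v with
  | none, none => baseSite.getD u 0 == baseSite.getD v 0 ||
      (List.range 66).any fun i => baseEdge i == (u, v) && v != 100 &&
        cubicEnds[i]? == some (baseSite.getD u 0, baseSite.getD v 0)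
  | none, some i => u < 79 && baseSite.getD u 0 == baseSite.getD v 0 &&
      (u == v - 1 || u == v + 1) && baseEdge i == (v - 1, 100) && 1 ≤ v &&
      (cubicEnds.getD i (0, 0)).1 == baseSite.getD v 0 && i < cubicEnds.length &&
      match baseSites.getD (baseSite.getD v 0) (.plain 0 0 0 0) with
      | .triple k x y _ _ _ => isTriple k x y && k + 1 == v
      | _ => false
  | some i, some j => (cubicEnds.getD i (0, 0)).2 == (cubicEnds.getD j (0, 0)).2 &&
      u != v - 1 && u != v + 1 && v != u - 1 && v != u + 1
  | _, _ => false

/-- The test `edgeValid` expects the middle vertex of a triangle as the second argument when only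
one of the two is such a vertex, hence both orders are tried. -/
lemma edgeValid_or : ∀ u < 79, ∀ v ∈ baseNbrsAt u, edgeValid u v = true ∨ edgeValid v u = true := by
  decide +kernel

/-- A vertex of the base graph for every required place. -/
def Site.rep : Site → ℕ
  | plain z _ _ _ => z
  | triple k _ _ _ _ _ => k + 2
  | hub _ _ _ _ _ _ => 0

/-- A representative must not be a middle vertex, for then its place does not depend on the cycle
under consideration; in a triangle, `k + 2` serves. -/
lemma rep_spec : ∀ s ∈ baseSites.zipIdx,
    (match s.1 with | .hub _ _ _ _ _ _ => true | _ => false) = true ∨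
      (baseSite.getD s.1.rep 0 = s.2 ∧ baseMid s.1.rep = none ∧ s.1.rep < 79) := by
  decide +kernel

/-- The edge from `u` to `u + 1` belongs to the given cycle of the cubic graph. -/
def onCycle (u : ℕ) : Bool := cubicCycle.any fun i => baseEdge i == (u, u + 1)

/-- The triples at a hub have their outer edges on the given cycle, and contain `u, u + 1`. -/
def Site.hubOnCycle (u : ℕ) : Site → Bool
  | hub k₁ k₂ k₃ _ _ _ => onCycle (k₁ - 1) && onCycle (k₁ + 2) && onCycle (k₂ - 1) &&
      onCycle (k₂ + 2) && onCycle (k₃ - 1) && onCycle (k₃ + 2) &&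
      (u == k₁ || u == k₁ + 1 || u == k₂ || u == k₂ + 1 || u == k₃ || u == k₃ + 1)
  | _ => false

/-- Those edges of the cycle `0, 1, …, 78` that do not come from the cubic cycle run inside the
triangles at hubs, each of which the cubic cycle passes by its two outer edges. -/
lemma onCycle_or : ∀ u < 78, onCycle u = true ∨ ∃ s ∈ baseSites, s.hubOnCycle u = true := by
  decide +kernel

lemma zero_spec : baseEdge 2 = (0, 78) ∧ 2 ∈ cubicCycle ∧ 0 ∉ baseOptional := by
  decide +kernel

lemma baseNbrsAt_symm : ∀ u < 79, ∀ v ∈ baseNbrsAt u, u ∈ baseNbrsAt v ∧ u ≠ v := by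
  decide +kernel

end Base

/-! ### From cycles of the base graph to edge sets of the cubic graph. -/

section Lifting

lemma IsCyc.zeroOrTwo {V : Type*} {D : SimpleGraph V} (hD : IsCyc D) {v a b c : V} (hab : a ≠ b)
    (hac : a ≠ c) (hbc : b ≠ c) (h : ∀ w, D.Adj v w → w = a ∨ w = b ∨ w = c) :
    ZeroOrTwo (D.Adj v a) (D.Adj v b) (D.Adj v c) := by
  unfold ZeroOrTwo TwoOf
  obtain h0 | ⟨p, q, hpq, hz⟩ := hD.deg v
  · exact Or.inl ⟨h0 _, h0 _, h0 _⟩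
  · have hp := h p ((hz p).2 (Or.inl rfl))
    have hq := h q ((hz q).2 (Or.inr rfl))
    simp only [hz]
    grind

lemma IsCyc.twoOf {V : Type*} {D : SimpleGraph V} (hD : IsCyc D) {v a b c : V} (hab : a ≠ b)
    (hac : a ≠ c) (hbc : b ≠ c) (h : ∀ w, D.Adj v w → w = a ∨ w = b ∨ w = c)
    (hv : ∃ w, D.Adj v w) : TwoOf (D.Adj v a) (D.Adj v b) (D.Adj v c) := by
  refine (hD.zeroOrTwo hab hac hbc h).resolve_left fun h0 => ?_
  obtain ⟨w, hw⟩ := hv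
  rcases h w hw with rfl | rfl | rfl
  exacts [h0.1 hw, h0.2.1 hw, h0.2.2 hw]

/-- Exactly two of four propositions hold. -/
def TwoOfFour (p q r s : Prop) : Prop :=
  (p ∧ q ∧ ¬ r ∧ ¬ s) ∨ (p ∧ ¬ q ∧ r ∧ ¬ s) ∨
    (p ∧ ¬ q ∧ ¬ r ∧ s) ∨ (¬ p ∧ q ∧ r ∧ ¬ s) ∨ (¬ p ∧ q ∧ ¬ r ∧ s) ∨ (¬ p ∧ ¬ q ∧ r ∧ s)

end Lifting


lemma IsCyc.twoOfFour {V : Type*} {D : SimpleGraph V} (hD : IsCyc D) {v a b c d : V} (hab : a ≠ b)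
    (hac : a ≠ c) (had : a ≠ d) (hbc : b ≠ c) (hbd : b ≠ d) (hcd : c ≠ d)
    (h : ∀ w, D.Adj v w → w = a ∨ w = b ∨ w = c ∨ w = d) (hv : ∃ w, D.Adj v w) :
    TwoOfFour (D.Adj v a) (D.Adj v b) (D.Adj v c) (D.Adj v d) := by
  unfold TwoOfFour
  obtain h0 | ⟨p, q, hpq, hz⟩ := hD.deg v
  · exact absurd hv (by simpa using h0)
  · have hp := h p ((hz p).2 (Or.inl rfl))
    have hq := h q ((hz q).2 (Or.inr rfl))
    simp only [hz]
    grind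

/-- A cycle in the base graph, seen as a graph on the natural numbers, that visits all vertices
except possibly the optional ones. -/
structure IsBaseCyc (D : SimpleGraph ℕ) : Prop where
  isCyc : IsCyc D
  mem : ∀ u v, D.Adj u v → v ∈ baseNbrsAt u
  exists_adj : ∀ u < 79, u ∉ baseOptional → ∃ v, D.Adj u v

namespace IsBaseCyc

variable {D : SimpleGraph ℕ}

lemma lt (h : IsBaseCyc D) {u v : ℕ} (huv : D.Adj u v) : u < 79 := by
  by_contra hu
  have := h.mem u v huv
  rw [baseNbrsAt, List.getD_eq_getElem?_getD, List.getElem?_eq_none (by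
    change 79 ≤ u; omega)] at this
  simp at this

/-- The value of an edge of the cubic graph. -/
def lit (D : SimpleGraph ℕ) (i : ℕ) : Prop :=
  -- An edge to a hub counts as used when the cycle takes exactly one of the two outer edges of the
  -- triangle, so that it has to leave through the middle vertex.
  if (baseEdge i).2 = 100 then
    ¬ (D.Adj ((baseEdge i).1 - 1) (baseEdge i).1 ↔ D.Adj ((baseEdge i).1 + 2) ((baseEdge i).1 + 3))
  else D.Adj (baseEdge i).1 (baseEdge i).2

lemma lit_iff {i p q : ℕ} (h : baseEdge i = (p, q)) (hq : q ≠ 100) : lit D i ↔ D.Adj p q := by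
  simp [lit, h, hq]

lemma lit_hub_iff {i k : ℕ} (h : baseEdge i = (k, 100)) :
    lit D i ↔ ¬ (D.Adj (k - 1) k ↔ D.Adj (k + 2) (k + 3)) := by
  simp [lit, h]

/-- If neither outer edge were used, the required vertex `k + 2` would force the cycle to be the
triangle itself. Beyond that, parity of the cut around the triangle relates its outer edges to the
two edges from its middle vertex to `x` and `y`. -/
lemma triple (h : IsBaseCyc D) {k x y : ℕ} (hk : isTriple k x y = true) :
    TwoOf (D.Adj (k - 1) k) (D.Adj (k + 2) (k + 3))
      (¬ (D.Adj (k - 1) k ↔ D.Adj (k + 2) (k + 3))) ∧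
    (¬ (D.Adj (k - 1) k ↔ D.Adj (k + 2) (k + 3)) ↔ ¬ (D.Adj (k + 1) x ↔ D.Adj (k + 1) y)) ∧
    (¬ D.Adj (k + 1) x → ¬ D.Adj (k + 1) y → D.Adj k (k + 1) ∧ D.Adj (k + 1) (k + 2)) ∧
    (D.Adj (k + 1) x → D.Adj (k + 1) y → ¬ D.Adj (k + 1) k ∧ ¬ D.Adj (k + 1) (k + 2)) ∧
    ∀ w, D.Adj (k + 1) w → w = k ∨ w = k + 2 ∨ w = x ∨ w = y := by
  simp only [isTriple, Bool.and_eq_true, List.all_eq_true, Bool.or_eq_true, beq_iff_eq,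
    decide_eq_true_eq, bne_iff_ne, Bool.not_eq_eq_eq_not, Bool.not_true, List.contains_eq_mem,
    decide_eq_false_iff_not, ne_eq] at hk
  obtain ⟨⟨⟨⟨⟨⟨⟨⟨⟨hk1, hk2⟩, n0⟩, n1⟩, n2⟩, o1⟩, o2⟩, hxy⟩, hx⟩, hy⟩ := hk
  -- The vertex `k` may be optional, whereas `k + 1` and `k + 2` have to be visited.
  have e0 := h.isCyc.zeroOrTwo (v := k) (a := k - 1) (b := k + 1) (c := k + 2) (by omega) (by omega)
    (by omega) fun w hw => by have := n0 w (h.mem _ _ hw); tauto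
  have e2 := h.isCyc.twoOf (v := k + 2) (a := k) (b := k + 1) (c := k + 3) (by omega) (by omega)
    (by omega) (fun w hw => by have := n2 w (h.mem _ _ hw); tauto) (h.exists_adj _ hk2 o2)
  have e1' : ∀ w, D.Adj (k + 1) w → w = k ∨ w = k + 2 ∨ w = x ∨ w = y :=
    fun w hw => by have := n1 w (h.mem _ _ hw); tauto
  have e1 := h.isCyc.twoOfFour (v := k + 1) (a := k) (b := k + 2) (c := x) (d := y) (by omega)
    (by omega) (by omega) (by omega) (by omega) hxy e1' (h.exists_adj _ (by omega) o1)
  -- A closed triangle misses the required vertex `0`, as `1 ≤ k`.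
  have e3 : ¬ (D.Adj k (k + 1) ∧ D.Adj (k + 1) (k + 2) ∧ D.Adj k (k + 2)) := by
    rintro ⟨h1, h2, h3⟩
    obtain ⟨z, hz⟩ := h.exists_adj 0 (by omega) zero_spec.2.2
    refine h.isCyc.false_of_closed (X := {k, k + 1, k + 2}) ?_ (by simp) h1 (v' := 0) (by
      simp only [Set.mem_insert_iff, Set.mem_singleton_iff]; omega) hz
    rintro v w hvw (rfl | rfl | rfl)
    · rcases h.isCyc.eq_or_eq_of_adj (by omega) h1 h3 hvw with rfl | rfl <;> simp
    · rcases h.isCyc.eq_or_eq_of_adj (by omega) h1.symm h2 hvw with rfl | rfl <;> simp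
    · rcases h.isCyc.eq_or_eq_of_adj (by omega) h2.symm h3.symm hvw with rfl | rfl <;> simp
  rw [D.adj_comm k (k - 1)] at e0
  rw [D.adj_comm (k + 2) k, D.adj_comm (k + 2) (k + 1)] at e2
  rw [D.adj_comm (k + 1) k] at e1 ⊢
  simp only [ZeroOrTwo, TwoOf, TwoOfFour] at e0 e1 e2 ⊢
  clear n0 n1 n2 hx hy hxy
  generalize D.Adj (k - 1) k = A at *
  generalize D.Adj (k + 2) (k + 3) = B at *
  generalize D.Adj k (k + 1) = P at *
  generalize D.Adj (k + 1) (k + 2) = Q at *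
  generalize D.Adj k (k + 2) = S at *
  generalize D.Adj (k + 1) x = t at *
  generalize D.Adj (k + 1) y = t' at *
  refine ⟨?_, ?_, ?_, ?_, e1'⟩ <;> clear e1'
  all_goals
    by_cases A <;> by_cases B <;> by_cases P <;> by_cases Q <;> by_cases S <;> by_cases t <;>
      by_cases t' <;> simp_all

/-- The translated edge set is locally admissible for the search, although it need not be a single
cycle of the cubic graph. -/
lemma constraint (h : IsBaseCyc D) (v : ℕ) (o : Bool) (a b c : ℕ)
    (hv : cubicConstraints[v]? = some (o, a, b, c)) :
    if o = true then ZeroOrTwo (lit D a) (lit D b) (lit D c)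
    else TwoOf (lit D a) (lit D b) (lit D c) := by
  rw [cubicConstraints, List.getElem?_map, Option.map_eq_some_iff] at hv
  obtain ⟨s, hs, hv⟩ := hv
  have hval := valid_of_mem_baseSites s (List.mem_of_getElem? hs)
  cases s with
  | plain z a' b' c' =>
    simp only [Prod.mk.injEq] at hv
    obtain ⟨rfl, rfl, rfl, rfl⟩ := hv
    simp only [Site.valid, Bool.and_eq_true, bne_iff_ne, List.all_eq_true, Bool.or_eq_true,
      beq_iff_eq, decide_eq_true_eq] at hval
    obtain ⟨⟨⟨⟨⟨⟨⟨hz, ea⟩, eb⟩, ec⟩, hab⟩, hac⟩, hbc⟩, hn⟩ := hval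
    have hend : ∀ i, isEdgeAt z (baseEdge i) = true →
        (D.Adj z (otherEnd z (baseEdge i)) ↔ lit D i) := by
      intro i hi
      simp only [isEdgeAt, Bool.and_eq_true, bne_iff_ne, Bool.or_eq_true, beq_iff_eq] at hi
      obtain ⟨h1, h2⟩ := hi
      rw [lit_iff (Prod.mk.eta (p := baseEdge i)).symm h1, otherEnd]
      split_ifs with h3
      · rw [h3]
      · rw [h2.resolve_left h3, D.adj_comm]
    have hsub : ∀ w, D.Adj z w → w = otherEnd z (baseEdge a') ∨ w = otherEnd z (baseEdge b') ∨
        w = otherEnd z (baseEdge c') := fun w hw => by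
      have := hn w (h.mem _ _ hw); tauto
    rw [← hend _ ea, ← hend _ eb, ← hend _ ec]
    split_ifs with ho
    · exact h.isCyc.zeroOrTwo hab hac hbc hsub
    · refine h.isCyc.twoOf hab hac hbc hsub (h.exists_adj z hz ?_)
      simpa using ho
  | triple k x y a' b' c' =>
    simp only [Prod.mk.injEq] at hv
    obtain ⟨rfl, rfl, rfl, rfl⟩ := hv
    simp only [Site.valid, Bool.and_eq_true, bne_iff_ne, beq_iff_eq] at hval
    obtain ⟨⟨⟨⟨⟨hk, ea⟩, eb⟩, ec⟩, h1⟩, h2⟩ := hval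
    rw [lit_iff ea h1, lit_iff eb h2, lit_hub_iff ec]
    simpa using (h.triple hk).1
  | hub k₁ k₂ k₃ a' b' c' =>
    simp only [Prod.mk.injEq] at hv
    obtain ⟨rfl, rfl, rfl, rfl⟩ := hv
    simp only [Site.valid, Bool.and_eq_true, beq_iff_eq] at hval
    obtain ⟨⟨⟨⟨⟨ea, eb⟩, ec⟩, t1⟩, t2⟩, t3⟩ := hval
    -- Each hub edge is the exclusive or of two of the three edges joining the middle vertices, so
    -- an even number of the hub edges is used.
    rw [lit_hub_iff ea, lit_hub_iff eb, lit_hub_iff ec, (h.triple t1).2.1, (h.triple t2).2.1,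
      (h.triple t3).2.1, D.adj_comm (k₂ + 1) (k₁ + 1), D.adj_comm (k₃ + 1) (k₁ + 1),
      D.adj_comm (k₃ + 1) (k₂ + 1)]
    simp only [ZeroOrTwo, TwoOf, if_true]
    tauto

open Classical in
/-- The place of the cubic graph at which a cycle of the base graph passes a vertex: the middle
vertex of a triangle is moved to the hub if the cycle uses an edge towards the hub. -/
noncomputable def place (D : SimpleGraph ℕ) (z : ℕ) : ℕ :=
  match baseMid z with
  | none => baseSite.getD z 0
  | some i => if ∃ w, D.Adj z w ∧ w ≠ z - 1 ∧ w ≠ z + 1 then (cubicEnds.getD i (0, 0)).2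
      else baseSite.getD z 0

/-- Following an edge of `D`, the place either stays the same or moves along a used edge of the
cubic graph, so it cannot cross a cut without used edges. -/
lemma place_eq_of_edgeValid (h : IsBaseCyc D) {X : ℕ → Bool}
    (hX : ∀ i u v : ℕ, cubicEnds[i]? = some (u, v) → lit D i → X u = X v) {u v : ℕ}
    (huv : D.Adj u v) (hval : edgeValid u v = true) : X (place D u) = X (place D v) := by
  unfold edgeValid at hval
  unfold place
  rcases hu : baseMid u with _ | i <;> rcases hv : baseMid v with _ | j <;>
    simp only [hu, hv] at hval ⊢
  · simp only [Bool.or_eq_true, beq_iff_eq, List.any_eq_true, Bool.and_eq_true, bne_iff_ne] at hval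
    rcases hval with hval | ⟨i, -, ⟨h1, h2⟩, h3⟩
    · rw [hval]
    · exact hX i _ _ h3 ((lit_iff h1 h2).2 huv)
  · split at hval
    · rename_i k x y _ _ _ _
      simp only [beq_iff_eq, Bool.and_eq_true, Bool.or_eq_true, decide_eq_true_eq] at hval
      obtain ⟨⟨⟨⟨⟨⟨⟨h0, h1⟩, h2⟩, h3⟩, h4⟩, h5⟩, h6⟩, h7, rfl⟩ := hval
      simp only [Nat.add_sub_cancel] at *
      split_ifs with ht
      · rw [h1, ← h5]
        refine hX j _ _ ?_ ?_
        · rw [List.getD_eq_getElem?_getD, List.getElem?_eq_getElem h6]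
          rfl
        -- The middle vertex has one edge into its triangle and one towards the hub, hence exactly
        -- one of its two edges to `x` and `y`; this is what makes the hub edge used.
        · rw [lit_hub_iff h3, (h.triple h7).2.1]
          obtain ⟨w, hw, hw1, hw2⟩ := ht
          have hb := (h.triple h7).2.2.2.1
          have hc := (h.triple h7).2.2.2.2 w hw
          have hd : D.Adj (k + 1) k ∨ D.Adj (k + 1) (k + 2) := by
            rcases h2 with rfl | rfl
            exacts [Or.inl huv.symm, Or.inr huv.symm]
          rcases hc with rfl | rfl | rfl | rfl
          · exact absurd rfl hw1
          · exact absurd rfl hw2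
          · tauto
          · tauto
      · rw [h1]
    · simp at hval
  · simp at hval
  · simp only [Bool.and_eq_true, beq_iff_eq, bne_iff_ne] at hval
    obtain ⟨⟨⟨⟨h1, h2⟩, h3⟩, h4⟩, h5⟩ := hval
    rw [if_pos ⟨v, huv, h4, h5⟩, if_pos ⟨u, huv.symm, h2, h3⟩, h1]

lemma place_eq (h : IsBaseCyc D) {X : ℕ → Bool}
    (hX : ∀ i u v : ℕ, cubicEnds[i]? = some (u, v) → lit D i → X u = X v) {u v : ℕ}
    (huv : D.Adj u v) : X (place D u) = X (place D v) := by
  rcases edgeValid_or u (h.lt huv) v (h.mem _ _ huv) with h1 | h1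
  · exact h.place_eq_of_edgeValid hX huv h1
  · exact (h.place_eq_of_edgeValid hX huv.symm h1).symm

lemma exists_place (h : IsBaseCyc D) {r : ℕ} {k : ℕ × ℕ × ℕ}
    (hr : cubicConstraints[r]? = some (false, k)) : ∃ z w, place D z = r ∧ D.Adj z w := by
  rw [cubicConstraints, List.getElem?_map, Option.map_eq_some_iff] at hr
  obtain ⟨s, hs, hv⟩ := hr
  have hrep := rep_spec (s, r) (List.mem_zipIdx_iff_getElem?.2 hs)
  have hval := valid_of_mem_baseSites s (List.mem_of_getElem? hs)
  have key : baseSite.getD s.rep 0 = r → baseMid s.rep = none → s.rep < 79 →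
      s.rep ∉ baseOptional → ∃ z w, place D z = r ∧ D.Adj z w := by
    intro h1 h2 h3 h4
    obtain ⟨w, hw⟩ := h.exists_adj _ h3 h4
    exact ⟨s.rep, w, by rw [place, h2]; exact h1, hw⟩
  cases s with
  | plain z a b c =>
    obtain ⟨h1, h2, h3⟩ := hrep.resolve_left (by simp)
    simp only [Prod.mk.injEq] at hv
    exact key h1 h2 h3 (by simpa [Site.rep] using hv.1)
  | triple k x y a b c =>
    obtain ⟨h1, h2, h3⟩ := hrep.resolve_left (by simp)
    refine key h1 h2 h3 ?_
    simp only [Site.valid, Bool.and_eq_true] at hval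
    have := hval.1.1.1.1.1
    simp only [isTriple, Bool.and_eq_true] at this
    have := this.1.1.1.2
    simpa [Site.rep] using this
  | hub => simp at hv

/-- The vertices of the base graph whose place lies on one side of the cut form a closed part of the
connected cycle `D`. -/
lemma cut (h : IsBaseCyc D) {X : ℕ → Bool}
    (hX : ∀ i u v : ℕ, cubicEnds[i]? = some (u, v) → lit D i → X u = X v) {r₀ r₁ : ℕ}
    {k₀ k₁ : ℕ × ℕ × ℕ} (h0 : cubicConstraints[r₀]? = some (false, k₀))
    (h1 : cubicConstraints[r₁]? = some (false, k₁)) : X r₀ = X r₁ := by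
  obtain ⟨z₀, w₀, rfl, hw₀⟩ := h.exists_place h0
  obtain ⟨z₁, w₁, rfl, hw₁⟩ := h.exists_place h1
  by_contra hne
  exact h.isCyc.false_of_closed (X := {z | X (place D z) = X (place D z₀)})
    (fun v w hvw hv => (h.place_eq hX hvw).symm.trans hv) (v := z₀) rfl hw₀ (v' := z₁)
    (fun h' => hne h'.symm) hw₁

lemma lit_of_mem (h : IsBaseCyc D) : ∀ i ∈ cubicCycle, lit D i :=
  RefTree.lit_of_check h.constraint (fun _ hX _ _ _ _ h0 h1 => h.cut hX h0 h1) baseTree 0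
    baseTree_check fun k hk => by simp at hk

lemma adj_of_onCycle (h : IsBaseCyc D) {u : ℕ} (hu : u ≠ 99) (ho : onCycle u = true) :
    D.Adj u (u + 1) := by
  simp only [onCycle, List.any_eq_true, beq_iff_eq] at ho
  obtain ⟨i, hi, he⟩ := ho
  exact (lit_iff he (by omega)).1 (h.lit_of_mem i hi)

/-- The search yields the edges outside the hubs. At a hub all three triangles are then passed by
both outer edges, and it remains to see that the cycle traverses each of them along `k, k + 1, k +
2`. -/
lemma adj_succ (h : IsBaseCyc D) {u : ℕ} (hu : u < 78) : D.Adj u (u + 1) := by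
  rcases onCycle_or u hu with ho | ⟨s, hs, ho⟩
  · exact h.adj_of_onCycle (by omega) ho
  have hval := valid_of_mem_baseSites s hs
  cases s with
  | plain => simp [Site.hubOnCycle] at ho
  | triple => simp [Site.hubOnCycle] at ho
  | hub k₁ k₂ k₃ a b c =>
    simp only [Site.valid, Bool.and_eq_true, beq_iff_eq] at hval
    obtain ⟨⟨⟨-, t1⟩, t2⟩, t3⟩ := hval
    simp only [Site.hubOnCycle, Bool.and_eq_true, Bool.or_eq_true, beq_iff_eq] at ho
    obtain ⟨⟨⟨⟨⟨⟨o1, o2⟩, o3⟩, o4⟩, o5⟩, o6⟩, hu'⟩ := ho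
    have hb : ∀ {k x y}, isTriple k x y = true → onCycle (k - 1) = true → onCycle (k + 2) = true →
        (D.Adj (k + 1) x ↔ D.Adj (k + 1) y) := by
      intro k x y ht ho ho'
      have hk : 1 ≤ k ∧ k + 2 < 79 := by
        simp only [isTriple, Bool.and_eq_true, decide_eq_true_eq] at ht
        exact ht.1.1.1.1.1.1.1.1
      have h1 := h.adj_of_onCycle (by omega) ho
      rw [Nat.sub_add_cancel hk.1] at h1
      have h2 := h.adj_of_onCycle (by omega) ho'
      exact not_not.1 ((h.triple ht).2.1.not.1 (by simp [h1, h2]))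
    have b1 := hb t1 o1 o2
    have b2 := hb t2 o3 o4
    have b3 := hb t3 o5 o6
    rw [D.adj_comm (k₂ + 1) (k₁ + 1)] at b2
    rw [D.adj_comm (k₃ + 1) (k₁ + 1), D.adj_comm (k₃ + 1) (k₂ + 1)] at b3
    -- With both outer edges used, a middle vertex has both or none of its edges to the other two.
    -- One such edge would therefore give the closed triangle of all three middle vertices.
    have hno : ¬ D.Adj (k₁ + 1) (k₂ + 1) := by
      intro h1
      have h2 := b1.1 h1
      have h3 := b2.1 h1
      obtain ⟨z, hz⟩ := h.exists_adj 0 (by omega) zero_spec.2.2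
      refine h.isCyc.false_of_closed (X := {k₁ + 1, k₂ + 1, k₃ + 1}) ?_ (by simp) h1 (v' := 0) (by
        simp) hz
      rintro v w hvw (rfl | rfl | rfl)
      · rcases h.isCyc.eq_or_eq_of_adj h3.ne h1 h2 hvw with rfl | rfl <;> simp
      · rcases h.isCyc.eq_or_eq_of_adj h2.ne h1.symm h3 hvw with rfl | rfl <;> simp
      · rcases h.isCyc.eq_or_eq_of_adj h1.ne h2.symm h3.symm hvw with rfl | rfl <;> simp
    have hno' := fun h' => hno (b1.2 h')
    have hno'' := fun h' => hno (b2.2 h')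
    have c1 := (h.triple t1).2.2.1 hno hno'
    have c2 := (h.triple t2).2.2.1 (fun h' => hno h'.symm) hno''
    have c3 := (h.triple t3).2.2.1 (fun h' => hno' h'.symm) fun h' => hno'' h'.symm
    rcases hu' with ((((rfl | rfl) | rfl) | rfl) | rfl) | rfl
    exacts [c1.1, c1.2, c2.1, c2.2, c3.1, c3.2]

lemma adj_zero (h : IsBaseCyc D) : D.Adj 0 78 :=
  (lit_iff zero_spec.1 (by omega)).1 (h.lit_of_mem 2 zero_spec.2.1)

end IsBaseCyc


/-! ### The base graph as a skeleton, and strict blocks from seeds. -/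

/-- The base graph. -/
def base : SimpleGraph (Fin 79) where
  Adj u v := v.1 ∈ baseNbrsAt u.1
  symm := ⟨fun u v h => (baseNbrsAt_symm u u.2 v h).1⟩
  loopless := ⟨fun u h => (baseNbrsAt_symm u u.2 u h).2 rfl⟩

instance : DecidableRel base.Adj := fun u v => inferInstanceAs (Decidable (v.1 ∈ baseNbrsAt u.1))

/-- The hamiltonian cycle of the base graph. -/
abbrev baseCycle : SimpleGraph (Fin 79) := finCycle 79 (by norm_num)

instance : DecidableRel baseCycle.Adj := fun u v => inferInstanceAs (Decidable
  (u.1 + 1 = v.1 ∨ v.1 + 1 = u.1 ∨ (u.1 = 0 ∧ v.1 + 1 = 79) ∨ (v.1 = 0 ∧ u.1 + 1 = 79)))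

/-- The other end of the chord at a vertex of degree 3. -/
def baseChord (v : Fin 79) : Fin 79 :=
  ⟨basePartner.getD v.1 0 % 79, Nat.mod_lt _ (by norm_num)⟩

/-- The vertices of the base graph at which blocks will be substituted. -/
def baseTargetSet : Finset (Fin 79) := Finset.univ.filter fun v => v.1 ∈ baseTargets

lemma baseCycle_le : baseCycle ≤ base := by
  have : ∀ u v : Fin 79, baseCycle.Adj u v → base.Adj u v := by decide +kernel
  exact fun u v => this u v

lemma map_val_adj {n : ℕ} {D : SimpleGraph (Fin n)} {u v : ℕ} :
    (D.map Fin.valEmbedding).Adj u v ↔ ∃ u' v' : Fin n, D.Adj u' v' ∧ u'.1 = u ∧ v'.1 = v :=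
  SimpleGraph.map_adj Fin.valEmbedding D u v

lemma isBaseCyc_map {D : SimpleGraph (Fin 79)} (hle : D ≤ base) (hD : IsCyc D)
    (h : ∀ v : Fin 79, v.1 ∉ baseOptional → ∃ w, D.Adj v w) :
    IsBaseCyc (D.map Fin.valEmbedding) where
  isCyc :=
    { exists_adj := by
        obtain ⟨v, w, hvw⟩ := hD.exists_adj
        exact ⟨v, w, map_val_adj.2 ⟨v, w, hvw, rfl, rfl⟩⟩
      deg := by
        intro v
        simp only [map_val_adj]
        by_cases hv : v < 79
        · rcases hD.deg ⟨v, hv⟩ with h0 | ⟨a, b, hab, hz⟩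
          · left
            rintro w ⟨u', w', h', h1, rfl⟩
            exact h0 w' (by convert h'; exact h1.symm)
          · refine Or.inr ⟨a, b, fun h' => hab (Fin.ext h'), fun z => ⟨?_, ?_⟩⟩
            · rintro ⟨u', w', h', h1, rfl⟩
              have hu : u' = ⟨v, hv⟩ := Fin.ext h1
              rcases (hz w').1 (hu ▸ h') with rfl | rfl
              exacts [Or.inl rfl, Or.inr rfl]
            · rintro (rfl | rfl)
              · exact ⟨⟨v, hv⟩, a, (hz a).2 (Or.inl rfl), rfl, rfl⟩
              · exact ⟨⟨v, hv⟩, b, (hz b).2 (Or.inr rfl), rfl, rfl⟩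
        · left
          rintro w ⟨u', w', -, rfl, -⟩
          exact hv u'.2
      closed := by
        simp only [map_val_adj]
        rintro X hX ⟨v, w, hv, ⟨v', w', h', rfl, rfl⟩⟩ _ _ ⟨v'', w'', h'', rfl, rfl⟩
        exact hD.closed {u | u.1 ∈ X} (fun u u' hu hu' => hX _ _ ⟨u, u', hu, rfl, rfl⟩ hu')
          ⟨v', w', hv, h'⟩ v'' w'' h'' }
  mem u v huv := by
    obtain ⟨u', v', h', rfl, rfl⟩ := map_val_adj.1 huv
    exact hle h'
  exists_adj u hu hu' := by
    obtain ⟨w, hw⟩ := h ⟨u, hu⟩ hu'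
    exact ⟨w, map_val_adj.2 ⟨⟨u, hu⟩, w, hw, rfl, rfl⟩⟩

lemma adj_of_map_adj {D : SimpleGraph (Fin 79)} {u v : Fin 79}
    (h : (D.map Fin.valEmbedding).Adj u v) : D.Adj u v :=
  (SimpleGraph.map_adj_apply (f := Fin.valEmbedding)).1 h

/-- Every admissible cycle contains all edges of the hamiltonian cycle, and a cycle that contains a
cycle equals it. -/
lemma uniqueCyc_base : UniqueCyc base {v | v.1 ∈ baseOptional} baseCycle where
  le := baseCycle_le
  isCyc := isCyc_finCycle _
  spanning := exists_finCycle_adj _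
  eq_of_isCyc D hle hD h := by
    have hB := isBaseCyc_map hle hD h
    refine hD.eq_of_le (isCyc_finCycle _) fun u v huv => ?_
    have hs : ∀ u v : Fin 79, u.1 + 1 = v.1 → D.Adj u v := fun u v h' => by
      have := hB.adj_succ (u := u.1) (by omega)
      rw [h'] at this
      exact adj_of_map_adj this
    have h0 : ∀ u v : Fin 79, u.1 = 0 → v.1 + 1 = 79 → D.Adj u v := fun u v h1 h2 => by
      have := hB.adj_zero
      refine adj_of_map_adj ?_
      rwa [h1, show v.1 = 78 by omega]
    rcases huv with h' | h' | ⟨h1, h2⟩ | ⟨h1, h2⟩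
    exacts [hs _ _ h', (hs _ _ h').symm, h0 _ _ h1 h2, (h0 _ _ h1 h2).symm]

/-- The arcs of the cycle between `y` and `z` are joined by a chord. -/
def chordValid (y z : ℕ) : Bool :=
  (List.range (z - y - 1)).any fun i => (baseNbrsAt (y + 1 + i)).any fun q =>
    (q < y || z < q) && q < 79

lemma chordValid_of_lt : ∀ y < 79, ∀ z < 79, y + 1 < z → (y ≠ 0 ∨ z + 1 ≠ 79) →
    chordValid y z = true := by
  decide +kernel

lemma noTwoCut_base : NoTwoCut base := by
  refine noTwoCut_of_chords (by norm_num) baseCycle_le fun y z hyz hz h => ?_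
  have := chordValid_of_lt y (by omega) z hz hyz h
  simp only [chordValid, List.any_eq_true, List.mem_range, Bool.and_eq_true, Bool.or_eq_true,
    decide_eq_true_eq] at this
  obtain ⟨i, hi, q, hq, hq', hq''⟩ := this
  exact ⟨⟨y + 1 + i, by omega⟩, ⟨q, hq''⟩, by simp; omega, by simp; omega, hq', hq⟩

lemma baseNbrsAt_nodup : ∀ u < 79, (baseNbrsAt u).Nodup ∧ ∀ v ∈ baseNbrsAt u, v < 79 := by
  decide +kernel

lemma ncard_base (u : Fin 79) : {v | base.Adj u v}.ncard = (baseNbrsAt u).length := by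
  have h := baseNbrsAt_nodup u u.2
  rw [← List.toFinset_card_of_nodup h.1, ← Set.ncard_coe_finset,
    ← Set.ncard_image_of_injective _ Fin.val_injective]
  congr 1
  ext v
  simp only [Set.mem_image, Set.mem_ofPred_eq, List.coe_toFinset]
  exact ⟨by rintro ⟨w, hw, rfl⟩; exact hw, fun hv => ⟨⟨v, h.2 v hv⟩, hv, rfl⟩⟩

lemma image_baseChord : baseChord '' baseTargetSet = {v | v.1 ∈ baseOptional} := by
  have h1 : ∀ v : Fin 79, v.1 ∈ baseTargets → (baseChord v).1 ∈ baseOptional := by decide +kernel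
  have h2 : ∀ v : Fin 79, v.1 ∈ baseOptional → ∃ x : Fin 79,
      x.1 ∈ baseTargets ∧ baseChord x = v := by decide +kernel
  ext v
  simp only [baseTargetSet, Finset.coe_filter, Finset.mem_univ, true_and, Set.mem_image,
    Set.mem_ofPred_eq]
  constructor
  · rintro ⟨x, hx, rfl⟩
    exact h1 x hx
  · exact fun hv => h2 v hv

lemma card_baseTargetSet : baseTargetSet.card = 29 := by decide +kernel

/-- The 58 cubic vertices are paired up by 29 chords, with one end of each chord a target and the
other optional. Here `E = H`: uniqueness does not need the chords to be removed. The vertex 2, of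
degree 4, lies on no such chord. -/
lemma isSkeleton_base : IsSkeleton base base baseCycle baseTargetSet baseChord := by
  have hX : ∀ v, v ∈ baseTargetSet ↔ v.1 ∈ baseTargets := by simp [baseTargetSet]
  have h1 : ∀ x : Fin 79, x.1 ∈ baseTargets → base.Adj x (baseChord x) ∧
      ¬ baseCycle.Adj x (baseChord x) ∧ (baseNbrsAt x).length = 3 ∧
      (baseNbrsAt (baseChord x)).length = 3 ∧ (baseChord x).1 ∉ baseTargets ∧
      (baseChord x).1 ≠ 2 := by decide +kernel
  have h2 : ∀ x y : Fin 79, x.1 ∈ baseTargets → y.1 ∈ baseTargets → baseChord x = baseChord y →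
      x = y := by decide +kernel
  exact
    { noTwoCut := noTwoCut_base
      three_lt := by simp
      le := le_rfl
      adj_or := fun u v h => Or.inl h
      unique := image_baseChord ▸ uniqueCyc_base
      notMem := fun x hx y hy h => (h1 x ((hX x).1 hx)).2.2.2.2.1 (h ▸ (hX y).1 hy)
      inj := fun x hx y hy h => h2 x y ((hX x).1 hx) ((hX y).1 hy) h
      adj := fun x hx => (h1 x ((hX x).1 hx)).1
      not_adj := fun x hx => (h1 x ((hX x).1 hx)).2.1
      ncard_x := fun x hx => (ncard_base x).trans (h1 x ((hX x).1 hx)).2.2.1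
      ncard_c := fun x hx => (ncard_base _).trans (h1 x ((hX x).1 hx)).2.2.2.1
      free := ⟨2, fun h => absurd ((hX 2).1 h) (by decide +kernel), fun x hx h =>
        (h1 x ((hX x).1 hx)).2.2.2.2.2 (by rw [h]; rfl)⟩ }

lemma numDegree_base (d : ℕ) : numDegree base d =
    (Finset.univ.filter fun u : Fin 79 => (baseNbrsAt u).length = d).card := by
  rw [numDegree_eq_ncard, ← Set.ncard_coe_finset]
  simp only [ncard_base]
  congr 1
  ext
  simp

lemma numDegree_base_three : numDegree base 3 = 58 := by
  rw [numDegree_base]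
  decide +kernel

lemma numDegree_base_eq_zero {d : ℕ} (h3 : d ≠ 3) (h4 : d ≠ 4) : numDegree base d = 0 := by
  rw [numDegree_base, Finset.card_eq_zero, Finset.filter_eq_empty_iff]
  have h : ∀ u : Fin 79, (baseNbrsAt u).length = 3 ∨ (baseNbrsAt u).length = 4 := by decide +kernel
  intro u _ hu
  rcases h u with h' | h' <;> omega

/-- A seed for `e` yields a block all of whose vertices have degree 4 or `e` after an insertion, and
which can be substituted even if the uniqueness of the cycle depends on it. -/
theorem HasSeed.exists_block {e : ℕ} (h : HasSeed e) :
    ∃ (W : Type) (_ : Fintype W) (B : SimpleGraph W) (p q : W) (R : Set W)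
      (CB : SimpleGraph (Option W)), p ≠ q ∧ UniqueCyc (addVertex B {p, q}) ∅ CB ∧
        IsConnectedBlock B p q R ∧ IsStrictBlock B p q R ∧ R.ncard + 2 = e ∧
        ∀ w, blockDegree B p q R w = 4 ∨ blockDegree B p q R w = e := by
  obtain ⟨n, G, s, t, hG⟩ := h
  obtain ⟨R, CB, hst, hCB, hconn, hR, hdeg⟩ := hG.isBlock
  -- The seed block need not be strict, but the chords of the base graph belong to `E`. All 58
  -- vertices of degree 3 are consumed, and 29 vertices of degree `e` are created.
  obtain ⟨V', _, H, C, hH, -, hC, -, hd⟩ := IsSkeleton.exists_substitution hst hCB hconn 29 _ base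
    base baseCycle baseTargetSet baseChord card_baseTargetSet isSkeleton_base
    (Or.inl isSkeleton_base.adj)
  have he : 4 ≤ e := hG.four_le
  have hRe : 2 + R.ncard = e := by omega
  have hcnt : ∀ d, d ≠ 4 → {w | blockDegree G s t R w = d}.ncard = 0 := by
    intro d hd
    simp only [hdeg]
    simp [Ne.symm hd]
  have hne : numDegree H e ≠ 0 := by
    have := hd e
    rw [if_neg (by omega), if_pos hRe.symm] at this
    omega
  have hzero : ∀ d, d ≠ 4 → d ≠ e → numDegree H d = 0 := by
    intro d h4 hde
    have := hd d
    rw [hcnt d h4, hRe, if_neg hde] at this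
    by_cases h3 : d = 3
    · rw [h3, numDegree_base_three] at this
      simp at this
      rw [h3]
      omega
    · rw [numDegree_base_eq_zero h3 h4] at this
      omega
  rw [numDegree_eq_ncard] at hne
  obtain ⟨y, hy⟩ := Set.nonempty_of_ncard_ne_zero hne
  -- Deleting a vertex of degree `e` again gives `|R'| + 2 = e`, and now uniqueness in `H` makes the
  -- block strict.
  obtain ⟨B, p, q, R', CB', hpq, hB, hconn', hstrict, hR', hdeg'⟩ :=
    exists_block_of_uniqueCyc hH hC hy (by omega)
  classical
  refine ⟨{v // v ≠ y}, inferInstance, B, p, q, R', CB', hpq, hB, hconn', hstrict, hR', ?_⟩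
  intro w
  by_contra! hw
  have := hdeg' (blockDegree B p q R' w)
  rw [hzero _ hw.1 hw.2] at this
  have h0 : {w' | blockDegree B p q R' w' = blockDegree B p q R' w}.ncard = 0 := by omega
  rw [Set.ncard_eq_zero (Set.toFinite _)] at h0
  exact absurd (show w ∈ {w' | blockDegree B p q R' w' = blockDegree B p q R' w} from rfl)
    (by rw [h0]; simp)


/-! ### Bipartite graphs with alternating labels. -/

section Bipartite

/-- The bipartite graph on `Fin (2 * m)` in which `2 * k` and `2 * j + 1` are joined if `r k j`. -/
def bip (m : ℕ) (r : ℕ → ℕ → Prop) : SimpleGraph (Fin (2 * m)) where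
  Adj u v := (u.1 % 2 = 0 ∧ v.1 % 2 = 1 ∧ r (u.1 / 2) (v.1 / 2)) ∨
    (v.1 % 2 = 0 ∧ u.1 % 2 = 1 ∧ r (v.1 / 2) (u.1 / 2))
  symm := ⟨fun u v h => h.symm⟩
  loopless := ⟨fun u h => by omega⟩

variable {m : ℕ} {r : ℕ → ℕ → Prop}

lemma bip_adj_of_even {u v : Fin (2 * m)} (hu : u.1 % 2 = 0) :
    (bip m r).Adj u v ↔ v.1 % 2 = 1 ∧ r (u.1 / 2) (v.1 / 2) := by
  simp [bip, hu]

lemma bip_adj_of_odd {u v : Fin (2 * m)} (hu : u.1 % 2 = 1) :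
    (bip m r).Adj u v ↔ v.1 % 2 = 0 ∧ r (v.1 / 2) (u.1 / 2) := by
  simp [bip, hu]

lemma ncard_bip_of_even {u : Fin (2 * m)} (hu : u.1 % 2 = 0) :
    {v | (bip m r).Adj u v}.ncard = {j | j < m ∧ r (u.1 / 2) j}.ncard := by
  simp only [bip_adj_of_even hu]
  rw [← Set.InjOn.ncard_image (f := fun v : Fin (2 * m) => v.1 / 2)]
  · congr 1
    ext j
    simp only [Set.mem_image, Set.mem_ofPred_eq]
    constructor
    · rintro ⟨v, ⟨-, hv⟩, rfl⟩
      exact ⟨by omega, hv⟩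
    · rintro ⟨hj, hr⟩
      have h1 : (2 * j + 1) / 2 = j := by omega
      exact ⟨⟨2 * j + 1, by omega⟩, ⟨by simp, by simpa [h1] using hr⟩, h1⟩
  · rintro v ⟨hv, -⟩ w ⟨hw, -⟩ h
    simp only at h
    exact Fin.ext (by omega)

lemma ncard_bip_of_odd {u : Fin (2 * m)} (hu : u.1 % 2 = 1) :
    {v | (bip m r).Adj u v}.ncard = {k | k < m ∧ r k (u.1 / 2)}.ncard := by
  simp only [bip_adj_of_odd hu]
  rw [← Set.InjOn.ncard_image (f := fun v : Fin (2 * m) => v.1 / 2)]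
  · congr 1
    ext j
    simp only [Set.mem_image, Set.mem_ofPred_eq]
    constructor
    · rintro ⟨v, ⟨-, hv⟩, rfl⟩
      exact ⟨by omega, hv⟩
    · rintro ⟨hj, hr⟩
      have h1 : (2 * j) / 2 = j := by omega
      exact ⟨⟨2 * j, by omega⟩, ⟨by simp, by simpa [h1] using hr⟩, h1⟩
  · rintro v ⟨hv, -⟩ w ⟨hw, -⟩ h
    simp only at h
    exact Fin.ext (by omega)

end Bipartite

/-! ### Partitions of an interval into classes of prescribed sizes. -/

section Partition

/-- The number of `i < n` with the property `P`. -/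
noncomputable def cnt (P : ℕ → Prop) (n : ℕ) : ℕ := {i | i < n ∧ P i}.ncard

lemma cnt_eq_count (P : ℕ → Prop) [DecidablePred P] (n : ℕ) : cnt P n = Nat.count P n := by
  rw [cnt, Nat.count_eq_card_filter_range, ← Set.ncard_coe_finset]
  congr 1
  ext
  simp

lemma cnt_add (P : ℕ → Prop) (a b : ℕ) : cnt P (a + b) = cnt P a + cnt (fun k => P (a + k)) b := by
  classical
  simp only [cnt_eq_count]
  exact Nat.count_add P a b

lemma cnt_eq_self {P : ℕ → Prop} {n : ℕ} (h : ∀ i < n, P i) : cnt P n = n := by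
  classical
  rw [cnt_eq_count]
  exact Nat.count_iff_forall.2 h

lemma cnt_eq_zero {P : ℕ → Prop} {n : ℕ} (h : ∀ i < n, ¬ P i) : cnt P n = 0 := by
  classical
  rw [cnt_eq_count]
  exact Nat.count_iff_forall_not.2 h

lemma cnt_congr {P Q : ℕ → Prop} {n : ℕ} (h : ∀ i < n, P i ↔ Q i) : cnt P n = cnt Q n := by
  unfold cnt
  congr 1
  ext i
  exact and_congr_right (h i)

/-- The number of indices below `N` with the same value as `i`. -/
noncomputable def fibre (g : ℕ → ℕ) (N i : ℕ) : ℕ := cnt (fun j => g j = g i) N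

/-- The classes are consecutive intervals of the lengths listed in `l`, so indices of the same class
differ by less than `S`. -/
lemma exists_partition (S : ℕ) : ∀ l : List ℕ, (∀ s ∈ l, s ≤ S) →
    ∃ g : ℕ → ℕ, (∀ i < l.sum, g i < l.length) ∧
      (∀ i j, i < l.sum → j < l.sum → g i = g j → j < i + S) ∧
      ∀ d, cnt (fun i => fibre g l.sum i = d) l.sum = d * l.count d := by
  intro l
  induction l with
  | nil => exact fun _ => ⟨id, by simp, by simp, by simp [cnt]⟩
  | cons s l ih =>
    intro hl
    obtain ⟨g, hg1, hg2, hg3⟩ := ih fun t ht => hl t (List.mem_cons_of_mem _ ht)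
    have hs : s ≤ S := hl s List.mem_cons_self
    have hsum : (s :: l).sum = l.sum + s := by rw [List.sum_cons, add_comm]
    let g' : ℕ → ℕ := fun i => if i < l.sum then g i else l.length
    have e1 : ∀ i, i < l.sum → g' i = g i := fun i hi => if_pos hi
    have e2 : ∀ i, ¬ i < l.sum → g' i = l.length := fun i hi => if_neg hi
    have f1 : ∀ i, i < l.sum → fibre g' (l.sum + s) i = fibre g l.sum i := by
      intro i hi
      unfold fibre
      rw [cnt_add, cnt_eq_zero (P := fun k => g' (l.sum + k) = g' i), add_zero]
      · exact cnt_congr fun j hj => by rw [e1 j hj, e1 i hi]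
      · intro k _ h
        rw [e2 _ (by omega), e1 i hi] at h
        have := hg1 i hi
        omega
    have f2 : ∀ i, ¬ i < l.sum → fibre g' (l.sum + s) i = s := by
      intro i hi
      unfold fibre
      rw [cnt_add, cnt_eq_zero, zero_add, cnt_eq_self]
      · intro k _
        rw [e2 _ (by omega), e2 i hi]
      · intro k hk h
        rw [e1 k hk, e2 i hi] at h
        have := hg1 k hk
        omega
    refine ⟨g', fun i _ => ?_, fun i j hi hj hij => ?_, fun d => ?_⟩
    · rw [List.length_cons]
      by_cases hi : i < l.sum
      · rw [e1 i hi]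
        have := hg1 i hi
        omega
      · rw [e2 i hi]
        omega
    · rw [hsum] at hi hj
      by_cases hi' : i < l.sum <;> by_cases hj' : j < l.sum
      · rw [e1 i hi', e1 j hj'] at hij
        exact hg2 i j hi' hj' hij
      · rw [e1 i hi', e2 j hj'] at hij
        have := hg1 i hi'
        omega
      · omega
      · omega
    · rw [hsum, cnt_add, cnt_congr (Q := fun i => fibre g l.sum i = d) fun i hi => by rw [f1 i hi],
        hg3, List.count_cons]
      by_cases hd : s = d
      · rw [cnt_eq_self fun i _ => by rw [f2 _ (by omega)]; exact hd]
        simp [hd]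
        ring
      · rw [cnt_eq_zero fun i _ => by rw [f2 _ (by omega)]; exact hd]
        simp [hd]

end Partition

/-! ### The bipartite skeleton. -/

section Skeleton

/-- The edges of the skeleton apart from the chords at which blocks are substituted. -/
def coreRel (N L : ℕ) (g : ℕ → ℕ) (k j : ℕ) : Prop :=
  j = k ∨ j + 1 = k ∨ (k = 0 ∧ j + 1 = N + L) ∨ (L ≤ k ∧ j < N ∧ g (k - L) = g j)

/-- The edges of the skeleton. -/
def skeletonRel (N L : ℕ) (g : ℕ → ℕ) (k j : ℕ) : Prop :=
  coreRel N L g k j ∨ (k < L ∧ j = N + k)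

variable {N L : ℕ} {g : ℕ → ℕ}

lemma finCycle_le_core (h : 3 ≤ 2 * (N + L)) :
    finCycle (2 * (N + L)) h ≤ bip (N + L) (coreRel N L g) := by
  have key : ∀ u v : Fin (2 * (N + L)), u.1 + 1 = v.1 ∨ (u.1 = 0 ∧ v.1 + 1 = 2 * (N + L)) →
      (bip (N + L) (coreRel N L g)).Adj u v := by
    intro u v huv
    by_cases hu : u.1 % 2 = 0
    · rw [bip_adj_of_even hu]
      refine ⟨by omega, ?_⟩
      rcases huv with h | h
      · exact Or.inl (by omega)
      · exact Or.inr (Or.inr (Or.inl (by omega)))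
    · rw [bip_adj_of_odd (by omega)]
      exact ⟨by omega, Or.inr (Or.inl (by omega))⟩
  rintro u v (h | h | h | h)
  exacts [key u v (Or.inl h), (key v u (Or.inl h)).symm, key u v (Or.inr h),
    (key v u (Or.inr h)).symm]

lemma core_le_skeleton :
    bip (N + L) (coreRel N L g) ≤ bip (N + L) (skeletonRel N L g) := by
  rintro u v (⟨h1, h2, h⟩ | ⟨h1, h2, h⟩)
  exacts [Or.inl ⟨h1, h2, Or.inl h⟩, Or.inr ⟨h1, h2, Or.inl h⟩]

/-- Even vertices are treated in increasing order. The first `L` of them have only their two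
neighbours on the cycle. By the bound on `g`, any other neighbour of a later one lies between two
even vertices treated before, so it is already saturated. Only the even vertices have to be visited,
which leaves all odd ones optional. -/
lemma finCycle_le_of_isCyc (h : 3 ≤ 2 * (N + L)) (hL : 1 ≤ L)
    (hg : ∀ i j, i < N → j < N → g i = g j → j + 1 < i + L) {D : SimpleGraph (Fin (2 * (N + L)))}
    (hD : D ≤ bip (N + L) (coreRel N L g)) (hcyc : IsCyc D)
    (hcov : ∀ v : Fin (2 * (N + L)), v.1 % 2 = 0 → ∃ w, D.Adj v w) :
    finCycle (2 * (N + L)) h ≤ D := by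
  have two : ∀ v x y : Fin (2 * (N + L)), (∃ w, D.Adj v w) → (∀ w, D.Adj v w → w = x ∨ w = y) →
      D.Adj v x ∧ D.Adj v y := by
    intro v x y hv hsub
    obtain ⟨a, b, hab, hz⟩ := (hcyc.deg v).resolve_left fun h0 => hv.elim h0
    have ha := hsub a ((hz a).2 (Or.inl rfl))
    have hb := hsub b ((hz b).2 (Or.inr rfl))
    rw [hz, hz]
    grind
  have key : ∀ k, k < N + L → ∀ u : Fin (2 * (N + L)), u.1 = 2 * k → ∀ v : Fin (2 * (N + L)),
      (v.1 = u.1 + 1 ∨ v.1 + 1 = u.1 ∨ (u.1 = 0 ∧ v.1 + 1 = 2 * (N + L))) → D.Adj u v := by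
    intro k
    induction k using Nat.strong_induction_on with
    | _ k ih =>
      intro hk u hu
      let x : Fin (2 * (N + L)) := ⟨2 * k + 1, by omega⟩
      let y : Fin (2 * (N + L)) := ⟨if k = 0 then 2 * (N + L) - 1 else 2 * k - 1, by
        split_ifs <;> omega⟩
      have hy : y.1 = if k = 0 then 2 * (N + L) - 1 else 2 * k - 1 := rfl
      have hxy : D.Adj u x ∧ D.Adj u y := by
        refine two u x y (hcov u (by omega)) fun w hw => ?_
        obtain ⟨hw1, hw2⟩ := (bip_adj_of_even (by omega)).1 (hD hw)
        have hwlt := w.2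
        rcases hw2 with h2 | h2 | h2 | ⟨h2, h3, h4⟩
        · left
          exact Fin.ext (by change w.1 = 2 * k + 1; omega)
        · right
          refine Fin.ext ?_
          rw [hy]
          split_ifs <;> omega
        · right
          refine Fin.ext ?_
          rw [hy]
          split_ifs <;> omega
        -- The odd vertex `w` already has its two edges, to `w - 1` and `w + 1`.
        · exfalso
          have h5 := hg _ _ (by omega) h3 h4
          have h6 := (ih (w.1 / 2) (by omega) (by omega) ⟨w.1 - 1, by omega⟩ (by simp; omega) w
            (Or.inl (by simp; omega))).symm
          have h7 := (ih (w.1 / 2 + 1) (by omega) (by omega) ⟨w.1 + 1, by omega⟩ (by simp; omega) w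
            (Or.inr (Or.inl (by simp)))).symm
          rcases hcyc.eq_or_eq_of_adj (by simp) h6 h7 hw.symm with h8 | h8
          · have := congrArg Fin.val h8
            simp at this
            omega
          · have := congrArg Fin.val h8
            simp at this
            omega
      intro v hv
      by_cases hvx : v.1 = 2 * k + 1
      · rw [show v = x from Fin.ext hvx]
        exact hxy.1
      · have : v = y := Fin.ext (by rw [hy]; split_ifs <;> omega)
        rw [this]
        exact hxy.2
  have key' : ∀ u v : Fin (2 * (N + L)), u.1 % 2 = 0 →
      (v.1 = u.1 + 1 ∨ v.1 + 1 = u.1 ∨ (u.1 = 0 ∧ v.1 + 1 = 2 * (N + L))) → D.Adj u v :=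
    fun u v hu hv => key (u.1 / 2) (by omega) u (by omega) v hv
  intro u v huv
  by_cases hu : u.1 % 2 = 0
  · refine key' u v hu ?_
    rcases huv with h | h | h | h <;> omega
  · refine (key' v u ?_ ?_).symm
    · rcases huv with h | h | h | h <;> omega
    · rcases huv with h | h | h | h <;> omega

/-- Each even vertex has a neighbour `2 * L - 1` steps back around the cycle: for `k ≥ L` from `g (k
- L) = g (k - L)`, for `k < L` through its chord. -/
lemma skeleton_adj_of_even {p q : Fin (2 * (N + L))} (hp : p.1 % 2 = 0)
    (h : q.1 + (2 * L - 1) = p.1 ∨ (p.1 < 2 * L - 1 ∧ q.1 + (2 * L - 1) = p.1 + 2 * (N + L)))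
    (hL : 1 ≤ L) : (bip (N + L) (skeletonRel N L g)).Adj p q := by
  rw [bip_adj_of_even hp]
  refine ⟨by omega, ?_⟩
  rcases h with h | ⟨h, h'⟩
  · refine Or.inl (Or.inr (Or.inr (Or.inr ⟨by omega, by omega, ?_⟩)))
    congr 1
    omega
  · exact Or.inr (by omega)

/-- The edges of length `2 * L - 1` suffice. This length is at least 3, and by `L ≤ N + 1` at most
half of the cycle, so such an edge at the border of the shorter arc leaves that arc. -/
lemma noTwoCut_skeleton (h : 3 ≤ 2 * (N + L)) (hL : 2 ≤ L) (hLN : L ≤ N + 1) :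
    NoTwoCut (bip (N + L) (skeletonRel N L g)) := by
  refine noTwoCut_of_chords h ((finCycle_le_core h).trans core_le_skeleton) fun y z hyz hz hne => ?_
  have even : ∀ p q : ℕ, p % 2 = 0 → (q + (2 * L - 1) = p ∨
      (p < 2 * L - 1 ∧ q + (2 * L - 1) = p + 2 * (N + L))) → ∀ (hp : p < 2 * (N + L))
      (hq : q < 2 * (N + L)), (bip (N + L) (skeletonRel N L g)).Adj ⟨p, hp⟩ ⟨q, hq⟩ :=
    fun p q h1 h2 hp hq => skeleton_adj_of_even h1 h2 (by omega)
  have inner : ∀ p q : ℕ, y < p → p < z → (q < y ∨ (z < q ∧ q < 2 * (N + L))) →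
      (∀ (hp : p < 2 * (N + L)) (hq : q < 2 * (N + L)),
        (bip (N + L) (skeletonRel N L g)).Adj ⟨p, hp⟩ ⟨q, hq⟩) →
      ∃ p q : Fin (2 * (N + L)), y < p.1 ∧ p.1 < z ∧ (q.1 < y ∨ z < q.1) ∧
        (bip (N + L) (skeletonRel N L g)).Adj p q :=
    fun p q h1 h2 h3 h4 => ⟨⟨p, by omega⟩, ⟨q, by omega⟩, h1, h2, by simp; omega, h4 _ _⟩
  -- Going back at least 3 steps from one of the first two vertices of the arc passes `y`, and going
  -- back at most `N + L` steps does not reach the arc again from the other side.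
  have evenInner : ∀ p, p % 2 = 0 → y < p → p ≤ y + 2 → p < z → z ≤ y + (N + L) →
      ∃ p q : Fin (2 * (N + L)), y < p.1 ∧ p.1 < z ∧ (q.1 < y ∨ z < q.1) ∧
        (bip (N + L) (skeletonRel N L g)).Adj p q := by
    intro p h0 h1 h2 h3 h4
    by_cases h5 : 2 * L - 1 ≤ p
    · exact inner p (p - (2 * L - 1)) h1 h3 (by omega) (even _ _ h0 (by omega))
    · exact inner p (p + 2 * (N + L) - (2 * L - 1)) h1 h3 (by omega) (even _ _ h0 (by omega))
  -- If the arc between `y` and `z` is not the shorter one, the edge is taken at a vertex just after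
  -- `z` instead, cyclically.
  by_cases hI : z ≤ y + (N + L)
  · by_cases h1 : (y + 1) % 2 = 0
    · exact evenInner _ h1 (by omega) (by omega) hyz hI
    by_cases h2 : y + 2 < z
    · exact evenInner (y + 2) (by omega) (by omega) (by omega) h2 hI
    · by_cases h3 : y + 1 + (2 * L - 1) < 2 * (N + L)
      · exact inner (y + 1) (y + 1 + (2 * L - 1)) (by omega) (by omega) (by omega)
          fun hp hq => (even _ _ (by omega) (by omega) hq hp).symm
      · exact inner (y + 1) (y + 1 + (2 * L - 1) - 2 * (N + L)) (by omega) (by omega) (by omega)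
          fun hp hq => (even _ _ (by omega) (by omega) hq hp).symm
  · by_cases h1 : z % 2 = 1
    · by_cases h2 : z + 1 < 2 * (N + L)
      · exact inner (z + 1 - (2 * L - 1)) (z + 1) (by omega) (by omega) (by omega)
          fun hp hq => (even _ _ (by omega) (by omega) hq hp).symm
      · exact inner (z + 1 - (2 * L - 1)) 0 (by omega) (by omega) (by omega)
          fun hp hq => (even _ _ (by omega) (by omega) hq hp).symm
    · by_cases h2 : z + 2 < 2 * (N + L)
      · exact inner (z + 2 - (2 * L - 1)) (z + 2) (by omega) (by omega) (by omega)
          fun hp hq => (even _ _ (by omega) (by omega) hq hp).symm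
      · by_cases h3 : y = 0
        · exact inner (2 * L - 2) (2 * (N + L) - 1) (by omega) (by omega) (by omega)
            (even _ _ (by omega) (by omega))
        · exact inner (z + 2 - (2 * L - 1)) 0 (by omega) (by omega) (by omega)
            fun hp hq => (even _ _ (by omega) (by omega) hq hp).symm

end Skeleton


section Skeleton

variable {N L : ℕ} {g : ℕ → ℕ}

/-- The end of the chord at a vertex in the first part of the skeleton. -/
def skeletonChord (N L : ℕ) (v : Fin (2 * (N + L))) : Fin (2 * (N + L)) :=
  ⟨(v.1 + 2 * N + 1) % (2 * (N + L)), Nat.mod_lt _ (by have := v.2; omega)⟩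

/-- The vertices of the skeleton at which blocks are substituted. -/
def skeletonTargets (N L : ℕ) : Finset (Fin (2 * (N + L))) :=
  Finset.univ.filter fun v => v.1 % 2 = 0 ∧ v.1 / 2 < L

/-- The degree of the vertex `v` in the skeleton. -/
noncomputable def skeletonDegree (N L : ℕ) (g : ℕ → ℕ) (v : ℕ) : ℕ :=
  if v % 2 = 0 then (if v / 2 < L then 3 else 2 + fibre g N (v / 2 - L))
  else (if v / 2 < N then 2 + fibre g N (v / 2) else 3)

lemma ncard_insert_insert {a b : ℕ} {P : ℕ → Prop} (hab : a ≠ b) {N : ℕ}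
    (ha : a < N → ¬ P a) (hb : b < N → ¬ P b) :
    (insert a (insert b {i | i < N ∧ P i})).ncard = 2 + cnt P N := by
  have hfin : {i | i < N ∧ P i}.Finite := (Set.finite_lt_nat N).subset fun i hi => hi.1
  rw [Set.ncard_insert_of_notMem _ (hfin.insert b), Set.ncard_insert_of_notMem _ hfin, cnt]
  · omega
  · exact fun h => hb h.1 h.2
  · rintro (h | h)
    exacts [hab h, ha h.1 h.2]

/-- The bound on `g` ensures that edges within a class differ from the two edges of the cycle, so
every class adds exactly its size to the degree. -/
lemma ncard_skeleton (hL : 2 ≤ L) (hN : 1 ≤ N)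
    (hg : ∀ i j, i < N → j < N → g i = g j → j + 1 < i + L) (u : Fin (2 * (N + L))) :
    {v | (bip (N + L) (skeletonRel N L g)).Adj u v}.ncard = skeletonDegree N L g u := by
  have hu := u.2
  unfold skeletonDegree
  split_ifs with h0 h1 h1
  · rw [ncard_bip_of_even h0, Set.ncard_eq_three]
    refine ⟨u.1 / 2, if u.1 / 2 = 0 then N + L - 1 else u.1 / 2 - 1, N + u.1 / 2, ?_, ?_, ?_, ?_⟩
    · split_ifs <;> omega
    · omega
    · split_ifs <;> omega
    · ext j
      simp only [skeletonRel, coreRel, Set.mem_ofPred_eq, Set.mem_insert_iff,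
        Set.mem_singleton_iff]
      split_ifs <;> omega
  · rw [ncard_bip_of_even h0, fibre, ← ncard_insert_insert (a := u.1 / 2) (b := u.1 / 2 - 1)
      (by omega)]
    · congr 1
      ext j
      simp only [skeletonRel, coreRel, Set.mem_ofPred_eq, Set.mem_insert_iff,
        eq_comm (a := g (u.1 / 2 - L))]
      omega
    · intro h h'
      have := hg _ _ (by omega) h h'.symm
      omega
    · intro h h'
      have := hg _ _ (by omega) h h'.symm
      omega
  · have hc : ∀ c, cnt (fun i => L ≤ i ∧ g (i - L) = c) (N + L) = cnt (fun j => g j = c) N := by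
      intro c
      rw [add_comm N L, cnt_add, cnt_eq_zero (fun i hi h => absurd h.1 (by omega)), zero_add]
      exact cnt_congr fun i _ => by simp
    rw [ncard_bip_of_odd (by omega), fibre, ← hc, ← ncard_insert_insert (a := u.1 / 2)
      (b := u.1 / 2 + 1) (by omega)]
    · congr 1
      ext j
      simp only [skeletonRel, coreRel, Set.mem_ofPred_eq, Set.mem_insert_iff]
      omega
    · rintro - ⟨h, h'⟩
      have := hg _ _ (by omega) (by omega) h'
      omega
    · rintro - ⟨h, h'⟩
      have := hg _ _ (by omega) (by omega) h'
      omega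
  · rw [ncard_bip_of_odd (by omega), Set.ncard_eq_three]
    refine ⟨u.1 / 2, if u.1 / 2 + 1 = N + L then 0 else u.1 / 2 + 1, u.1 / 2 - N, ?_, ?_, ?_, ?_⟩
    · split_ifs <;> omega
    · omega
    · split_ifs <;> omega
    · ext j
      simp only [skeletonRel, coreRel, Set.mem_ofPred_eq, Set.mem_insert_iff,
        Set.mem_singleton_iff]
      split_ifs <;> omega

lemma cnt_two_mul (P : ℕ → Prop) (m : ℕ) :
    cnt P (2 * m) = cnt (fun k => P (2 * k)) m + cnt (fun k => P (2 * k + 1)) m := by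
  classical
  simp only [cnt_eq_count]
  induction m with
  | zero => simp
  | succ m ih =>
    rw [show 2 * (m + 1) = 2 * m + 1 + 1 by ring, Nat.count_succ, Nat.count_succ, ih,
      Nat.count_succ, Nat.count_succ]
    ring

/-- Each class occurs once among the even and once among the odd vertices, whence the factor 2; the
`L` targets and their `L` chord ends are cubic. -/
lemma numDegree_skeleton (hL : 2 ≤ L) (hN : 1 ≤ N)
    (hg : ∀ i j, i < N → j < N → g i = g j → j + 1 < i + L) (d : ℕ) :
    numDegree (bip (N + L) (skeletonRel N L g)) d =
      2 * cnt (fun i => 2 + fibre g N i = d) N + 2 * if d = 3 then L else 0 := by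
  have h1 : numDegree (bip (N + L) (skeletonRel N L g)) d =
      cnt (fun v => skeletonDegree N L g v = d) (2 * (N + L)) := by
    rw [numDegree_eq_ncard, cnt, ← Set.ncard_image_of_injective _ Fin.val_injective]
    simp only [ncard_skeleton hL hN hg]
    congr 1
    ext v
    exact ⟨by rintro ⟨w, hw, rfl⟩; exact ⟨w.2, hw⟩, fun hv => ⟨⟨v, hv.1⟩, hv.2, rfl⟩⟩
  have hL3 : cnt (fun _ => 3 = d) L = if d = 3 then L else 0 := by
    split_ifs with h
    · exact cnt_eq_self fun _ _ => h.symm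
    · exact cnt_eq_zero fun _ _ h' => h h'.symm
  rw [h1, cnt_two_mul]
  nth_rw 1 [add_comm N L]
  rw [cnt_add, cnt_add]
  rw [cnt_congr (Q := fun _ => 3 = d) (n := L), hL3,
    cnt_congr (Q := fun i => 2 + fibre g N i = d) (n := N),
    cnt_congr (P := fun k => skeletonDegree N L g (2 * k + 1) = d)
      (Q := fun i => 2 + fibre g N i = d) (n := N),
    cnt_congr (P := fun k => skeletonDegree N L g (2 * (N + k) + 1) = d)
      (Q := fun _ => 3 = d) (n := L), hL3]
  · ring
  · intro i hi
    have e1 : (2 * (N + i) + 1) / 2 = N + i := by omega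
    simp [skeletonDegree, e1]
  · intro i hi
    have e1 : (2 * i + 1) / 2 = i := by omega
    simp [skeletonDegree, e1, hi]
  · intro i hi
    have e1 : (2 * (L + i)) / 2 = L + i := by omega
    simp [skeletonDegree, e1]
  · intro i hi
    have e1 : (2 * i) / 2 = i := by omega
    simp [skeletonDegree, hi]

lemma skeletonChord_val {v : Fin (2 * (N + L))} (hv : v.1 % 2 = 0 ∧ v.1 / 2 < L) :
    (skeletonChord N L v).1 = v.1 + 2 * N + 1 :=
  Nat.mod_eq_of_lt (by omega)

lemma mem_skeletonTargets {v : Fin (2 * (N + L))} :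
    v ∈ skeletonTargets N L ↔ v.1 % 2 = 0 ∧ v.1 / 2 < L := by
  simp [skeletonTargets]

lemma card_skeletonTargets : (skeletonTargets N L).card = L := by
  refine (Finset.card_bij (t := Finset.range L) (fun v _ => v.1 / 2) ?_ ?_ ?_).trans
    (Finset.card_range L)
  · intro v hv
    simpa using (mem_skeletonTargets.1 hv).2
  · intro v hv w hw h
    have h1 := mem_skeletonTargets.1 hv
    have h2 := mem_skeletonTargets.1 hw
    exact Fin.ext (by omega)
  · intro k hk
    have hk' := Finset.mem_range.1 hk
    exact ⟨⟨2 * k, by omega⟩, mem_skeletonTargets.2 ⟨by simp, by simp; omega⟩, by simp⟩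

theorem isSkeleton_skeleton (h : 3 ≤ 2 * (N + L)) (hL : 2 ≤ L) (hN : 1 ≤ N) (hLN : L ≤ N + 1)
    (hg : ∀ i j, i < N → j < N → g i = g j → j + 1 < i + L) :
    IsSkeleton (bip (N + L) (skeletonRel N L g)) (bip (N + L) (coreRel N L g))
      (finCycle (2 * (N + L)) h) (skeletonTargets N L) (skeletonChord N L) where
  noTwoCut := noTwoCut_skeleton h hL hLN
  three_lt := by rw [Fintype.card_fin]; omega
  le := core_le_skeleton
  adj_or u v huv := by
    rcases huv with ⟨h1, h2, h3 | h3⟩ | ⟨h1, h2, h3 | h3⟩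
    · exact Or.inl (Or.inl ⟨h1, h2, h3⟩)
    · refine Or.inr ⟨u, mem_skeletonTargets.2 ⟨h1, h3.1⟩, Or.inl ⟨rfl, Fin.ext ?_⟩⟩
      rw [skeletonChord_val ⟨h1, h3.1⟩]
      omega
    · exact Or.inl (Or.inr ⟨h1, h2, h3⟩)
    · refine Or.inr ⟨v, mem_skeletonTargets.2 ⟨h1, h3.1⟩, Or.inr ⟨rfl, Fin.ext ?_⟩⟩
      rw [skeletonChord_val ⟨h1, h3.1⟩]
      omega
  unique :=
    { le := finCycle_le_core h
      isCyc := isCyc_finCycle h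
      spanning := exists_finCycle_adj h
      eq_of_isCyc := fun D hD hcyc hcov => by
        refine hcyc.eq_of_le (isCyc_finCycle h)
          (finCycle_le_of_isCyc h (by omega) hg hD hcyc fun v hv => hcov v ?_)
        rintro ⟨x, hx, rfl⟩
        have hx' := mem_skeletonTargets.1 hx
        rw [skeletonChord_val hx'] at hv
        omega }
  notMem x hx y hy hxy := by
    have hx' := mem_skeletonTargets.1 hx
    have hy' := mem_skeletonTargets.1 hy
    have := skeletonChord_val hx'
    rw [hxy] at this
    omega
  inj x hx y hy hxy := by
    have h1 := skeletonChord_val (mem_skeletonTargets.1 hx)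
    have h2 := skeletonChord_val (mem_skeletonTargets.1 hy)
    rw [hxy] at h1
    exact Fin.ext (by omega)
  adj x hx := by
    have hx' := mem_skeletonTargets.1 hx
    rw [bip_adj_of_even hx'.1, skeletonChord_val hx']
    exact ⟨by omega, Or.inr ⟨hx'.2, by omega⟩⟩
  not_adj x hx hadj := by
    have hx' := mem_skeletonTargets.1 hx
    have h1 := skeletonChord_val hx'
    rcases hadj with h | h | h | h <;> omega
  ncard_x x hx := by
    have hx' := mem_skeletonTargets.1 hx
    rw [ncard_skeleton hL hN hg, skeletonDegree, if_pos hx'.1, if_pos hx'.2]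
  ncard_c x hx := by
    have hx' := mem_skeletonTargets.1 hx
    rw [ncard_skeleton hL hN hg, skeletonDegree, skeletonChord_val hx', if_neg (by omega),
      if_neg (by omega)]
  free := by
    refine ⟨⟨2 * L, by omega⟩, fun hx => ?_, fun x hx hxy => ?_⟩
    · have := (mem_skeletonTargets.1 hx).2
      simp at this
    · have h1 := skeletonChord_val (mem_skeletonTargets.1 hx)
      have h2 := mem_skeletonTargets.1 hx
      rw [hxy] at h1
      simp only at h1
      omega

end Skeleton


/-! ### Realizing prescribed multiplicities. -/

lemma exists_list {M : Finset ℕ} (hM : ∀ d ∈ M, 4 ≤ d) (κ : ℕ → ℕ) :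
    ∃ l : List ℕ, (∀ s ∈ l, s + 2 ≤ M.sup id) ∧ l.sum = ∑ d ∈ M, κ d * (d - 2) ∧
      ∀ d, 2 ≤ d → l.count (d - 2) = if d ∈ M then κ d else 0 := by
  have hcount : ∀ c, (∑ d ∈ M, Multiset.replicate (κ d) (d - 2)).toList.count c =
      ∑ d ∈ M, if d - 2 = c then κ d else 0 := by
    intro c
    rw [← Multiset.coe_count, Multiset.coe_toList, Multiset.count_sum']
    exact Finset.sum_congr rfl fun d _ => Multiset.count_replicate _ _ _
  -- There are `κ d` classes of size `d - 2`, each giving `d - 2` vertices of degree `d` on both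
  -- sides of the skeleton.
  refine ⟨(∑ d ∈ M, Multiset.replicate (κ d) (d - 2)).toList, fun s hs => ?_, ?_, fun d hd => ?_⟩
  · rw [Multiset.mem_toList, Multiset.mem_sum] at hs
    obtain ⟨d, hd, hs⟩ := hs
    rw [Multiset.eq_of_mem_replicate hs]
    have h1 : d ≤ M.sup id := Finset.le_sup (f := id) hd
    have := hM d hd
    omega
  · rw [← Multiset.sum_coe, Multiset.coe_toList, Multiset.sum_sum]
    simp
  · rw [hcount, ← Finset.sum_ite_eq' M d κ]
    refine Finset.sum_congr rfl fun δ hδ => ?_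
    have := hM δ hδ
    have h : δ - 2 = d - 2 ↔ δ = d := by omega
    simp only [h]

/-- Realizing graphs with prescribed numbers of vertices of each degree, up to a constant. -/
theorem exists_realizes {M : Finset ℕ} {e : ℕ} (hM : ∀ d ∈ M, 4 ≤ d) (h4 : 4 ∈ M) (he : e ∈ M)
    (hs : HasSeed e) : ∃ A B : ℕ, ∀ κ : ℕ → ℕ, (∀ d ∈ M, 1 ≤ κ d) →
      ∃ (n : ℕ) (G : SimpleGraph (Fin n)), Realizes G M ∧ n = A + 2 * ∑ d ∈ M, κ d * (d - 2) ∧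
        ∀ d ∈ M, 2 * ((d - 2) * κ d) ≤ numDegree G d ∧
          numDegree G d ≤ 2 * ((d - 2) * κ d) + B := by
  obtain ⟨W, _, B, p, q, R, CB, hpq, hCB, hconn, hstrict, hR, hdeg⟩ := hs.exists_block
  obtain ⟨S, hS⟩ : ∃ S, M.sup id = S + 2 := by
    have : 4 ≤ M.sup id := Finset.le_sup (f := id) h4
    exact ⟨M.sup id - 2, by omega⟩
  have hS2 : 2 ≤ S := by
    have : 4 ≤ M.sup id := Finset.le_sup (f := id) h4
    omega
  have hSM : S + 2 ∈ M := by
    obtain ⟨d, hd, hd'⟩ := Finset.exists_mem_eq_sup M ⟨4, h4⟩ id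
    rw [← hS, hd']
    exact hd
  -- With `L = S + 1`, the skeleton has `2 * (N + L)` vertices, of which `L` are replaced by blocks,
  -- so `A` is what exceeds `2 * N`. Each substitution contributes at most `|W| + 1` vertices of a
  -- given degree, which explains `B`. Neither depends on `κ`.
  refine ⟨(S + 1) + (S + 1) * Fintype.card W, (S + 1) * (Fintype.card W + 1), fun κ hκ => ?_⟩
  obtain ⟨l, hl1, hl2, hl3⟩ := exists_list hM κ
  obtain ⟨g, -, hg, hcnt⟩ := exists_partition S l fun s hs => by have := hl1 s hs; omega
  -- The largest degree `S + 2` occurs at least once and contributes a class of size `S`; this gives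
  -- `L ≤ N + 1`.
  have hlS : S ≤ l.sum := by
    rw [hl2]
    calc S ≤ κ (S + 2) * (S + 2 - 2) := by
          rw [Nat.add_sub_cancel]; exact Nat.le_mul_of_pos_left _ (hκ _ hSM)
      _ ≤ _ := Finset.single_le_sum (f := fun d => κ d * (d - 2)) (fun _ _ => Nat.zero_le _) hSM
  have hg' : ∀ i j, i < l.sum → j < l.sum → g i = g j → j + 1 < i + (S + 1) :=
    fun i j hi hj h => by have := hg i j hi hj h; omega
  obtain ⟨V', _, H, C, hH, h3, hC, hcard, hnum⟩ := IsSkeleton.exists_substitution hpq hCB hconn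
    (S + 1) _ _ _ _ _ _ card_skeletonTargets
    (isSkeleton_skeleton (N := l.sum) (L := S + 1) (g := g) (by omega) (by omega) (by omega)
      (by omega) hg') (Or.inr hstrict)
  have hcnt' : ∀ d, 2 ≤ d → cnt (fun i => 2 + fibre g l.sum i = d) l.sum =
      (d - 2) * if d ∈ M then κ d else 0 := by
    intro d hd
    rw [← hl3 d hd, ← hcnt]
    exact cnt_congr fun i _ => by omega
  have hW : ∀ d, {w | blockDegree B p q R w = d}.ncard ≤ Fintype.card W := fun d => by
    rw [← Nat.card_eq_fintype_card, ← Set.ncard_univ]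
    exact Set.ncard_le_ncard (Set.subset_univ _) (Set.toFinite _)
  have hRe : 2 + R.ncard = e := by omega
  simp only [numDegree_skeleton (N := l.sum) (L := S + 1) (g := g) (by omega) (by omega) hg', hRe]
    at hnum
  have hdegM : ∀ d ∈ M, 2 * ((d - 2) * κ d) ≤ numDegree H d ∧
      numDegree H d ≤ 2 * ((d - 2) * κ d) + (S + 1) * (Fintype.card W + 1) := by
    intro d hd
    have hd4 := hM d hd
    have h := hnum d
    have h3 : d ≠ 3 := by omega
    rw [hcnt' d (by omega), if_pos hd] at h
    simp only [if_neg h3] at h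
    have h' : {w | blockDegree B p q R w = d}.ncard + (if d = e then 1 else 0) ≤
        Fintype.card W + 1 := by
      have := hW d
      split_ifs <;> omega
    have := Nat.mul_le_mul_left (S + 1) h'
    omega
  have hdeg0 : ∀ d, d ∉ M → numDegree H d = 0 := by
    intro d hd
    have h := hnum d
    have h1 : cnt (fun i => 2 + fibre g l.sum i = d) l.sum = 0 := by
      by_cases h2 : 2 ≤ d
      · rw [hcnt' d h2, if_neg hd, mul_zero]
      · exact cnt_eq_zero fun i _ => by omega
    have h2 : {w | blockDegree B p q R w = d}.ncard = 0 := by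
      rw [Set.ncard_eq_zero (Set.toFinite _)]
      ext w
      simp only [Set.mem_ofPred_eq, Set.mem_empty_iff_false, iff_false]
      rintro rfl
      rcases hdeg w with h' | h' <;> rw [h'] at hd
      exacts [hd h4, hd he]
    have hde : d ≠ e := by
      rintro rfl
      exact hd he
    rw [h1, h2, if_neg hde] at h
    split_ifs at h <;> omega
  let φ : Fin (Fintype.card V') ≃ V' := (Fintype.equivFin V').symm
  refine ⟨Fintype.card V', H.comap φ, ⟨?_, ?_, ?_⟩, ?_, ?_⟩
  · rw [if_neg fun h => absurd (hM 2 h) (by omega)]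
    exact (hH.comap φ).isKConnected (by rwa [Fintype.card_fin])
  · have : Nonempty (Fin (Fintype.card V')) := ⟨⟨0, by omega⟩⟩
    have h := hC.comap φ
    rw [Set.preimage_empty] at h
    exact h.isUniquelyHamiltonian
  · refine degreeSet_eq _ fun d => ?_
    rw [numDegree_comap]
    refine ⟨fun h => by_contra fun h' => h (hdeg0 d h'), fun h => ?_⟩
    have h1 := (hdegM d h).1
    have h2 : 0 < (d - 2) * κ d := Nat.mul_pos (by have := hM d h; omega) (hκ d h)
    omega
  · rw [Fintype.card_fin] at hcard
    rw [← hl2]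
    omega
  · intro d hd
    rw [numDegree_comap]
    exact hdegM d hd

end UHC

/-! ### Realizability and strong realizability. -/

theorem theorem3p7 (D : Finset ℕ) (hD : ∀ d ∈ D, 4 < d)
    (hseed : UHC.HasSeed 4 ∨ ∃ d₁ : ℕ, IsLeast (D : Set ℕ) d₁ ∧ UHC.HasSeed d₁) :
    UHC.UhcRealizable (insert 4 D) ∧
      (D.Nonempty → UHC.StronglyUhcRealizable (insert 4 D)) := by
  have hM : ∀ d ∈ insert 4 D, 4 ≤ d := by
    intro d hd
    rcases Finset.mem_insert.1 hd with rfl | hd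
    exacts [le_rfl, (hD d hd).le]
  have h4 : 4 ∈ insert 4 D := Finset.mem_insert_self 4 D
  obtain ⟨e, he, hs⟩ : ∃ e ∈ insert 4 D, UHC.HasSeed e := by
    rcases hseed with h | ⟨d, hd, h⟩
    exacts [⟨4, h4, h⟩, ⟨d, Finset.mem_insert_of_mem hd.1, h⟩]
  have h4D : 4 ∉ D := fun h => lt_irrefl _ (hD 4 h)
  obtain ⟨A, B, hAB⟩ := UHC.exists_realizes hM h4 he hs
  refine ⟨?_, fun hne => ?_⟩
  · obtain ⟨n, G, hG, -⟩ := hAB (fun _ => 1) fun _ _ => le_rfl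
    exact ⟨n, G, hG⟩
  · refine ⟨?_, 4, ⟨by exact_mod_cast h4, fun d hd => hM d (by exact_mod_cast hd)⟩, ?_⟩
    · rw [Finset.card_insert_of_notMem h4D]
      have := hne.card_pos
      omega
    intro D₁ D₂ hdisj hunion
    rw [Finset.erase_insert h4D] at hunion
    -- Degrees in `D₁` keep multiplicity parameter 1, all others grow linearly. The degree 4 lies
    -- outside `D₁`, so the orders increase even if `D₂` is empty.
    let κ : ℕ → ℕ → ℕ := fun i d => if d ∈ D₁ then 1 else i + 1
    have hκ : ∀ i, ∀ d ∈ insert 4 D, 1 ≤ κ i d := by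
      intro i d _
      simp only [κ]
      split_ifs <;> omega
    choose n G hG hn hdeg using fun i => hAB (κ i) (hκ i)
    have h4D₁ : 4 ∉ D₁ := fun h => h4D (hunion ▸ Finset.mem_union_left _ h)
    let T : ℕ := ∑ d ∈ insert 4 D, (d - 2)
    have hκle : ∀ i d, κ i d ≤ i + 1 := by
      intro i d
      simp only [κ]
      split_ifs <;> omega
    have hnle : ∀ i, n i ≤ (i + 1) * (A + 2 * T) := by
      intro i
      rw [hn i]
      have h1 : ∑ d ∈ insert 4 D, κ i d * (d - 2) ≤ (i + 1) * T := by
        rw [Finset.mul_sum]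
        exact Finset.sum_le_sum fun d _ => Nat.mul_le_mul_right _ (hκle i d)
      have h2 : A ≤ (i + 1) * A := Nat.le_mul_of_pos_left _ (by omega)
      calc A + 2 * ∑ d ∈ insert 4 D, κ i d * (d - 2) ≤ (i + 1) * A + 2 * ((i + 1) * T) := by omega
        _ = (i + 1) * (A + 2 * T) := by ring
    -- The order of the `i`-th graph is at most `(i + 1) * (A + 2 * T)`, while every degree in `D₂`
    -- occurs at least `i + 1` times. The summand 1 in the denominator makes its positivity
    -- immediate.
    refine ⟨2 * ∑ d ∈ D₁, (d - 2) + B, 1 / (A + 2 * T + 1), by positivity, n, G, ?_, fun i =>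
      ⟨hG i, fun d hd => ?_, fun d hd => ?_⟩⟩
    · refine strictMono_nat_of_lt_succ fun i => ?_
      rw [hn, hn]
      have : ∑ d ∈ insert 4 D, κ i d * (d - 2) < ∑ d ∈ insert 4 D, κ (i + 1) d * (d - 2) := by
        refine Finset.sum_lt_sum (fun d _ => Nat.mul_le_mul_right _ ?_) ⟨4, h4, ?_⟩
        · simp only [κ]
          split_ifs <;> omega
        · simp only [κ, if_neg h4D₁]
          omega
      omega
    · have hdM : d ∈ insert 4 D :=
        Finset.mem_insert_of_mem (hunion ▸ Finset.mem_union_left _ hd)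
      refine ((hdeg i d hdM).2).trans ?_
      have h1 : κ i d = 1 := if_pos hd
      have h2 : d - 2 ≤ ∑ d ∈ D₁, (d - 2) :=
        Finset.single_le_sum (f := fun d => d - 2) (fun _ _ => Nat.zero_le _) hd
      rw [h1, mul_one]
      omega
    · have hdM : d ∈ insert 4 D :=
        Finset.mem_insert_of_mem (hunion ▸ Finset.mem_union_right _ hd)
      have h1 : κ i d = i + 1 := if_neg fun h => Finset.disjoint_left.1 hdisj h hd
      have h2 := (hdeg i d hdM).1
      rw [h1] at h2
      have h3 : i + 1 ≤ UHC.numDegree (G i) d := by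
        have h4 : i + 1 ≤ (d - 2) * (i + 1) :=
          Nat.le_mul_of_pos_left _ (by have := hM d hdM; omega)
        omega
      have h5 : (n i : ℝ) ≤ (i + 1) * (A + 2 * T) := by exact_mod_cast hnle i
      have h6 : ((i : ℝ) + 1) ≤ (UHC.numDegree (G i) d : ℝ) := by exact_mod_cast h3
      have hpos : (0 : ℝ) < A + 2 * T + 1 := by positivity
      rw [div_mul_eq_mul_div, one_mul, div_le_iff₀ hpos]
      have h7 : (0 : ℝ) ≤ i + 1 := by positivity
      nlinarith [mul_le_mul_of_nonneg_right h6 hpos.le]
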